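/- For elements $a,b$ of a group write $[a,b]=a^{-1}b^{-1}ab$ and $b^a=a^{-1}ba$. For a group $T$ let $1=Z_0(T)\le Z_1(T)\le\cdots$ be the upper central series ($Z_{i+1}(T)/Z_i(T)$ is the center of $T/Z_i(T)$) and $T=\gamma_1(T)\ge\gamma_2(T)\ge\cdots$ the lower central series ($\gamma_{i+1}(T)=[T,\gamma_i(T)]$). Let $\alpha\in\mathbb Z\setminus\{0,1,2\}$ and let $$G=G(\alpha)=\langle x,y \mid x^{[x,y]}=x^\alpha,\ y^{[y,x]}=y^\alpha\rangle$$ be the Macdonald group. Let $p$ be a prime factor of $\alpha-1$, let $m=v_p(\alpha-1)$, and let $J$ be a Sylow $p$-subgroup of $G$. Then $G$ is the internal direct product $G=J\times Q$ of $J$ and a subgroup $Q$ all of whose elements have finite order prime to $p$. Let $A,B\in J$ be the images of $x,y$ under the projection $G\to J$ with kernel $Q$, and let $C=[A,B]$. We say that we are in Case 1 if $p>3$, or $p=3$ and ($m>1$ or $(\alpha-1)/3\equiv 1 \bmod 3$); in Case 2 if $p=2$; and in Case 3 if $p=3$, $m=1$ and $(\alpha-1)/3\equiv -1\bmod 3$.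 The following hold. (a) In Case 1, $J$ is nilpotent of class $5$, and $$Z_1(J)=\langle A^{p^{2m}}\rangle,\quad Z_2(J)=\langle A^{p^{2m}},C^{p^m}\rangle,\quad Z_3(J)=\langle A^{p^m},B^{p^m},C^{p^m}\rangle,\quad Z_4(J)=\langle A^{p^m},B^{p^m},C\rangle.$$ Moreover $\gamma_i(J)=Z_{6-i}(J)$ for $1\le i\le 6$. (b) In Case 2, if $m>1$, $J$ is nilpotent of class $5$, and $$Z_1(J)=\langle A^{2^{2m-1}}\rangle,\quad Z_2(J)=\langle A^{2^{2m-1}},C^{2^{m-1}}\rangle,\quad Z_3(J)=\langle A^{2^m},B^{2^m},C^{2^{m-1}}\rangle,\quad Z_4(J)=\langle A^{2^{m-1}},B^{2^{m-1}},C\rangle.$$ Moreover $$\gamma_2(J)=\langle A^{2^m},B^{2^m},C\rangle,\quad \gamma_3(J)=\langle A^{2^m},B^{2^m},C^{2^m}\rangle,\quad \gamma_4(J)=\langle A^{2^{2m}},[A,B^{2^m}]\rangle,\quad \gamma_5(J)=\langle A^{2^{2m}}\rangle.$$ (c) In Case 3, $J$ is nilpotent of class $7$, and $$Z_1(J)=\langle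 A^{27}\rangle,\quad Z_2(J)=\langle A^{27},C^9\rangle,\quad Z_3(J)=\langle A^9,B^9,C^9\rangle,$$ $$Z_4(J)=\langle A^9,B^9,C^3\rangle,\quad Z_5(J)=\langle A^3,B^3,C^3\rangle,\quad Z_6(J)=\langle A^3,B^3,C\rangle.$$ Moreover $\gamma_i(J)=Z_{8-i}(J)$ for $1\le i\le 8$. -/

import Mathlib

/-- The commutator `[a, b] = a⁻¹ b⁻¹ a b`. (Mathlib's `⁅a, b⁆` is `a b a⁻¹ b⁻¹`.) -/
def gcomm {T : Type*} [Group T] (a b : T) : T := a⁻¹ * b⁻¹ * a * b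

/-- The conjugate `b ^ a = a⁻¹ b a`. -/
def conjBy {T : Type*} [Group T] (b a : T) : T := a⁻¹ * b * a

/-- The relators of the Macdonald group, on the free generators `x = of 0` and `y = of 1`:
`x ^ [x, y] = x ^ α` and `y ^ [y, x] = y ^ α`. -/
def macdonaldRels (α : ℤ) : Set (FreeGroup (Fin 2)) :=
  let x := FreeGroup.of (0 : Fin 2)
  let y := FreeGroup.of (1 : Fin 2)
  {conjBy x (gcomm x y) * (x ^ α)⁻¹, conjBy y (gcomm y x) * (y ^ α)⁻¹}

/-- The Macdonald group `G(α) = ⟨x, y | x ^ [x, y] = x ^ α, y ^ [y, x] = y ^ α⟩`. -/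
abbrev MacdonaldGroup (α : ℤ) : Type := PresentedGroup (macdonaldRels α)

/-- The first defining generator of `G(α)`. -/
def macdonaldX (α : ℤ) : MacdonaldGroup α := PresentedGroup.of 0

/-- The second defining generator of `G(α)`. -/
def macdonaldY (α : ℤ) : MacdonaldGroup α := PresentedGroup.of 1

/-- `π` is the projection onto the Sylow `p`-subgroup `P` of a decomposition `G = P × Q`, where
all elements of `Q = ker π` have finite order prime to `p`. As the kernel is
then the set of all elements of finite order prime to `p`, there is at most one such `π`. -/
structure IsSylowProjection {G : Type*} [Group G] {p : ℕ} (P : Sylow p G) (π : G →* P) :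
    Prop where
  map_self : ∀ x : P, π (x : G) = x
  commute_ker : ∀ x : P, ∀ g ∈ π.ker, Commute (x : G) g
  coprime_ker : ∀ g ∈ π.ker, (orderOf g).Coprime p

/-- Case 1: `p > 3`, or `p = 3` and (`m > 1` or `(α - 1) / 3 ≡ 1 mod 3`), with
`m = v_p(α - 1)`. -/
def IsCase1 (α : ℤ) (p : ℕ) : Prop :=
  3 < p ∨ p = 3 ∧ (1 < padicValInt p (α - 1) ∨ (α - 1) / 3 ≡ 1 [ZMOD 3])

/-- Case 2: `p = 2`. -/
def IsCase2 (p : ℕ) : Prop := p = 2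

/-- Case 3: `p = 3`, `m = 1` and `(α - 1) / 3 ≡ -1 mod 3`, with `m = v_p(α - 1)`. -/
def IsCase3 (α : ℤ) (p : ℕ) : Prop :=
  p = 3 ∧ padicValInt p (α - 1) = 1 ∧ (α - 1) / 3 ≡ -1 [ZMOD 3]

/-- The term `Z_i(T)` of the upper central series, with `Z_0(T) = 1`. -/
abbrev upperZ (T : Type*) [Group T] (i : ℕ) : Subgroup T := Subgroup.upperCentralSeries T i

/-- The term `γ_i(T)` of the lower central series, with the convention `γ_1(T) = T` (used only
for `i ≥ 1`; Mathlib numbers the series from `0`). -/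
abbrev lowerGamma (T : Type*) [Group T] (i : ℕ) : Subgroup T :=
  (⊤ : Subgroup T).lowerCentralSeries (i - 1)

/-- `T` is nilpotent of class exactly `c`. -/
def HasNilpotencyClass (T : Type*) [Group T] (c : ℕ) : Prop :=
  Group.IsNilpotent T ∧ Group.nilpotencyClass T = c

/-! Write `C = [A, B]` and `q = p ^ m`. The relations say that `C⁻¹ A C = A ^ α` and `C B C⁻¹ = B ^
α`. As `B⁻¹ A B = A C`, conjugation of powers is explicit: `B⁻¹ A ^ n B = C ^ n A ^ (α + ⋯ + α ^
n)`. Hence `[C ^ n, A] = A ^ (1 - α ^ n)` and `[A ^ n, B] = C ^ n A ^ e(n)` with an explicit `e(n)`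
(`gcomm_comm_pow_left`, `gcomm_pow_left`). Once the order of `A` and a central power of `A` are
known, these two formulas and lifting the exponent determine both central series.

Finiteness. Two evaluations of `[A ^ α, B ^ α]` (`zpow_eq_zpow`) show that the generators have
finite order prime to `α`. A similar computation with exponents `α ^ s` (`central_power`) gives
integers `E` with `A ^ E` central, `A ^ E B ^ E = 1` and `A ^ (E (α - 1)) = 1`. Letting `s` vary, an
argument in a finite field shows that every prime dividing the order of `A` divides `α - 1`. Central
cyclic subgroups can then be factored out one after another, so `G` is finite and nilpotent and `J`
splits off.

Order of `A` in `J`. The `p`-adic valuation `e` of `E` is `2m` in Case 1, `2m - 1` for `p = 2`, and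
`3` in Case 3 (for a suitable `s`), where the leading terms of an expansion cancel. So `A ^ p ^ e`
is central and `A ^ p ^ (e + m) = 1`. That the order is not smaller is seen on a permutation group:
triples `(i, l, j)` stand for words `A ^ i C ^ l B ^ j`, acted on by left multiplication, with
exponentials truncated to polynomials. Case 3 needs a larger model, verified numerically.

Central series. For odd `p` the candidates are `⟨A ^ q ^ a, B ^ q ^ a, C ^ q ^ c⟩`; commutation with
the generators replaces `(a, c)` by `(c + 1, a)`. This yields a chain of length `2T + 1`, with `T =
2` in Case 1 and `T = 3` in Case 3. It is the upper central series because no element of a term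
outside the preceding one is central modulo the one before that; exact valuations reduce this to the
order of `A`. The same commutators generate the lower central series, so the two agree. For `p = 2`
and even `n` the valuation of `e(n)` is one less than `m` plus that of `n`; the two series differ
and are treated separately. -/

/-! ### Power relations in a Macdonald pair -/

/-- The pair `(A, B)` satisfies the defining relations of the Macdonald group `G(α)`. -/
structure MacdonaldPair {G : Type*} [Group G] (α : ℤ) (A B : G) : Prop where
  left : (gcomm A B)⁻¹ * A * gcomm A B = A ^ α
  right : gcomm A B * B * (gcomm A B)⁻¹ = B ^ α

/-- The geometric sum `1 + α + ⋯ + α ^ (n - 1)`. -/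
def geomSum (α : ℤ) (n : ℕ) : ℤ := ∑ i ∈ Finset.range n, α ^ i

theorem geomSum_zero (α : ℤ) : geomSum α 0 = 0 := by simp [geomSum]

theorem geomSum_succ (α : ℤ) (n : ℕ) : geomSum α (n + 1) = α * geomSum α n + 1 := by
  simp only [geomSum, Finset.sum_range_succ', pow_zero, Finset.mul_sum, pow_succ']

theorem geomSum_mul (α : ℤ) (n : ℕ) : geomSum α n * (α - 1) = α ^ n - 1 :=
  geom_sum_mul α n

theorem gcomm_inv {G : Type*} [Group G] (A B : G) : (gcomm A B)⁻¹ = gcomm B A := by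
  simp [gcomm, mul_assoc]

theorem gcomm_map {G H : Type*} [Group G] [Group H] (f : G →* H) (A B : G) :
    f (gcomm A B) = gcomm (f A) (f B) := by
  simp [gcomm]

namespace MacdonaldPair

variable {G : Type*} [Group G] {α : ℤ} {A B : G}

theorem swap (h : MacdonaldPair α A B) : MacdonaldPair α B A := by
  constructor
  · rw [← gcomm_inv A B, inv_inv]; exact h.right
  · rw [← gcomm_inv A B, inv_inv]; exact h.left

theorem map {H : Type*} [Group H] (f : G →* H) (h : MacdonaldPair α A B) :
    MacdonaldPair α (f A) (f B) := by
  constructor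
  · rw [← gcomm_map, ← map_zpow, ← h.left]; simp
  · rw [← gcomm_map, ← map_zpow, ← h.right]; simp

/-- The exponent in the relations only matters modulo the orders of the generators. -/
theorem congr_exponent (h : MacdonaldPair α A B) {β : ℤ} {n : ℤ} (hA : A ^ n = 1) (hB : B ^ n = 1)
    (hαβ : n ∣ β - α) : MacdonaldPair β A B := by
  obtain ⟨k, hk⟩ := hαβ
  have hβ : β = α + n * k := by linarith
  constructor
  · rw [h.left, hβ, zpow_add, zpow_mul, hA]; simp
  · rw [h.right, hβ, zpow_add, zpow_mul, hB]; simp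

theorem conj_left_zpow (h : MacdonaldPair α A B) (n : ℤ) :
    (gcomm A B)⁻¹ * A ^ n * gcomm A B = A ^ (α * n) := by
  have := conj_zpow (i := n) (a := (gcomm A B)⁻¹) (b := A)
  rw [inv_inv] at this
  rw [← this, h.left, zpow_mul]

theorem zpow_mul_comm (h : MacdonaldPair α A B) (n : ℤ) :
    A ^ n * gcomm A B = gcomm A B * A ^ (α * n) := by
  rw [← h.conj_left_zpow]; group

theorem comm_mul_zpow (h : MacdonaldPair α A B) (n : ℤ) :
    gcomm A B * B ^ n = B ^ (α * n) * gcomm A B := by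
  have := h.swap.zpow_mul_comm n
  rw [← gcomm_inv] at this
  have h2 : gcomm A B * (B ^ n * (gcomm A B)⁻¹) * gcomm A B =
    gcomm A B * ((gcomm A B)⁻¹ * B ^ (α * n)) * gcomm A B := by rw [this]
  simpa [mul_assoc] using h2

theorem zpow_mul_comm_pow (h : MacdonaldPair α A B) (n : ℤ) (k : ℕ) :
    A ^ n * gcomm A B ^ k = gcomm A B ^ k * A ^ (α ^ k * n) := by
  induction k generalizing n with
  | zero => simp
  | succ k ih =>
    rw [pow_succ, ← mul_assoc, ih, mul_assoc, h.zpow_mul_comm, ← mul_assoc, pow_succ',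
      mul_assoc α]

theorem comm_pow_mul_zpow (h : MacdonaldPair α A B) (n : ℤ) (k : ℕ) :
    gcomm A B ^ k * B ^ n = B ^ (α ^ k * n) * gcomm A B ^ k := by
  induction k generalizing n with
  | zero => simp
  | succ k ih =>
    rw [pow_succ, mul_assoc, h.comm_mul_zpow, ← mul_assoc, ih, mul_assoc]
    congr 2
    ring_nf

theorem conj_right_eq (A B : G) : B⁻¹ * A * B = A * gcomm A B := by
  simp [gcomm, mul_assoc]

/-- `A * gcomm A B` is the conjugate `B⁻¹ A B`. Collecting the commutators on the left multiplies
the exponent of `A` by `α` at each step, whence the geometric sum. -/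
theorem mul_comm_pow (h : MacdonaldPair α A B) (n : ℕ) :
    (A * gcomm A B) ^ n = gcomm A B ^ n * A ^ (α * geomSum α n) := by
  induction n with
  | zero => simp [geomSum_zero]
  | succ n ih =>
    rw [pow_succ, ih, geomSum_succ, mul_assoc, ← mul_assoc (A ^ _) A, ← zpow_add_one,
      h.zpow_mul_comm, ← mul_assoc, ← pow_succ]

/-- `B⁻¹ A ^ n B = C ^ n A ^ (α + ⋯ + α ^ n)`. -/
theorem conj_pow (h : MacdonaldPair α A B) (n : ℕ) :
    B⁻¹ * A ^ n * B = gcomm A B ^ n * A ^ (α * geomSum α n) := by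
  rw [← h.mul_comm_pow, ← conj_right_eq]
  have := _root_.conj_pow (i := n) (a := B⁻¹) (b := A)
  rw [inv_inv] at this
  rw [this]

theorem conj_pow' (h : MacdonaldPair α A B) (n : ℕ) :
    A⁻¹ * B ^ n * A = (gcomm A B ^ n)⁻¹ * B ^ (α * geomSum α n) := by
  rw [h.swap.conj_pow, ← gcomm_inv, inv_pow]

end MacdonaldPair


/-! ### Relations between powers of the two generators -/

namespace MacdonaldPair

variable {G : Type*} [Group G] {α : ℤ} {A B : G}

/-- The hypothesis says that conjugation by `C ^ M` takes `A ^ (-E)` to `B ^ F`. The `α ^ M`-th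
power of `B ^ F` is also its conjugate under `C ^ M`, and cancelling this conjugation leaves a
relation without `C`. -/
theorem zpow_eq_of_comm_pow (h : MacdonaldPair α A B) {M : ℕ} {E F : ℤ}
    (hEF : gcomm A B ^ M * A ^ (-E) = B ^ F * gcomm A B ^ M) :
    A ^ (-(E * α ^ M)) = B ^ F := by
  have h1 : gcomm A B ^ M * A ^ (-E) * (gcomm A B ^ M)⁻¹ = B ^ F := by rw [hEF]; group
  have h2 : gcomm A B ^ M * A ^ (-E * α ^ M) * (gcomm A B ^ M)⁻¹ = B ^ (F * α ^ M) := by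
    rw [zpow_mul, zpow_mul, ← h1, ← conj_zpow]
  have h3 := h.comm_pow_mul_zpow F M
  rw [mul_comm F, ← mul_inv_eq_iff_eq_mul.mpr h3] at h2
  have h4 := mul_left_cancel (mul_right_cancel h2)
  rw [← h4]; congr 1; ring

/-- `B ^ F` commutes with `A` and `B`, hence with `C`, whereas conjugation by `C` raises it to the
power `α`. -/
theorem zpow_mul_sub_one_eq_one (h : MacdonaldPair α A B) {F : ℤ} (hF : Commute A (B ^ F)) :
    B ^ (F * (α - 1)) = 1 := by
  have hc : Commute (gcomm A B) (B ^ F) := by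
    unfold gcomm
    exact ((hF.inv_left.mul_left (((Commute.refl B).zpow_right F).inv_left)).mul_left hF).mul_left
      ((Commute.refl B).zpow_right F)
  have h1 := h.comm_mul_zpow F
  rw [hc.eq] at h1
  have h2 := mul_right_cancel h1
  rw [mul_sub, mul_one, zpow_sub, mul_comm F, ← h2]; simp

/-- A relation coming from two evaluations of `[A ^ α, B ^ α]`. -/
theorem zpow_eq_zpow (h : MacdonaldPair α A B) {M : ℕ} (hM : (M : ℤ) = α ^ 2) {N : ℤ}
    (hN : N = α ^ (1 + M) - geomSum α M) : A ^ (-(N * α ^ M)) = B ^ N := by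
  apply h.zpow_eq_of_comm_pow
  -- Since `Y ^ α = C Y C⁻¹`, conjugating `X ^ α` by `Y ^ α` amounts, up to `C`, to conjugating `C⁻¹
  -- X ^ α C = X ^ (α ^ 2)` by `Y`. This is where `M = α ^ 2` comes from.
  have key : ∀ {X Y : G}, MacdonaldPair α X Y →
      (Y ^ α)⁻¹ * X ^ α * Y ^ α = gcomm X Y ^ M * X ^ geomSum α M := by
    intro X Y hXY
    have e2 : gcomm X Y * X ^ (α * geomSum α M) * (gcomm X Y)⁻¹ = X ^ geomSum α M := by
      rw [← hXY.zpow_mul_comm]; group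
    calc (Y ^ α)⁻¹ * X ^ α * Y ^ α
        = gcomm X Y * (Y⁻¹ * ((gcomm X Y)⁻¹ * X ^ α * gcomm X Y) * Y) * (gcomm X Y)⁻¹ := by
          rw [← hXY.right]; group
      _ = gcomm X Y * (Y⁻¹ * X ^ M * Y) * (gcomm X Y)⁻¹ := by
          rw [hXY.conj_left_zpow, ← sq, ← hM, zpow_natCast]
      _ = gcomm X Y ^ M * (gcomm X Y * X ^ (α * geomSum α M) * (gcomm X Y)⁻¹) := by
          rw [hXY.conj_pow]; group
      _ = _ := by rw [e2]
  have k1 := key h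
  have k2 := key h.swap
  -- Both sides are `[A ^ α, B ^ α]`, computed through `(A, B)` on the left and through `(B, A)` on
  -- the right.
  have k3 : (A ^ α)⁻¹ * (gcomm A B ^ M * A ^ geomSum α M)
      = (gcomm B A ^ M * B ^ geomSum α M)⁻¹ * B ^ α := by
    rw [← k1, ← k2]; group
  rw [← gcomm_inv A B] at k3
  have k4 : A ^ (-α) * gcomm A B ^ M * A ^ geomSum α M
      = B ^ (- geomSum α M) * (gcomm A B ^ M * B ^ α) := by
    rw [zpow_neg, mul_assoc, k3]; group
  rw [h.zpow_mul_comm_pow, h.comm_pow_mul_zpow, mul_assoc, ← zpow_add, ← mul_assoc,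
    ← zpow_add] at k4
  have e1 : -N = α ^ M * -α + geomSum α M := by rw [hN]; ring
  have e2 : N = -geomSum α M + α ^ M * α := by rw [hN]; ring
  rw [e1, k4]; congr 2; exact e2.symm

/-- If `α` is invertible modulo the orders of `A` and `B`, with inverse `γ`, then certain powers
of `A` and `B` are central. -/
theorem central_power (h : MacdonaldPair α A B) {γ : ℤ} (hA : A ^ (α * γ) = A)
    (hB : B ^ (α * γ) = B) {s M : ℕ} (hM : (M : ℤ) = α ^ s) {E : ℤ}
    (hE : E = α ^ M - γ ^ s * (α * geomSum α M)) :
    Commute B (A ^ E) ∧ A ^ E * B ^ E = 1 ∧ A ^ (E * (α - 1)) = 1 := by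
  have pw : ∀ {X : G}, X ^ (α * γ) = X → ∀ (k : ℕ) (n : ℤ), X ^ ((α * γ) ^ k * n) = X ^ n := by
    intro X hX k n
    induction k with
    | zero => simp
    | succ k ih => rw [pow_succ', mul_assoc, zpow_mul, hX, ih]
  have key : ∀ {X Y : G}, MacdonaldPair α X Y → X ^ (α * γ) = X → Y ^ (α * γ) = Y →
      X ^ (-(E * α ^ M)) = Y ^ (M * E) := by
    intro X Y hXY hX hY
    apply hXY.zpow_eq_of_comm_pow
    set C := gcomm X Y with hC
    set t := γ ^ s * (α * geomSum α M) with ht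
    -- Two evaluations of `[X ^ M, Y]`: directly, and after `X ^ M = C⁻ˢ X Cˢ`, which turns it into
    -- a conjugate of `[X, Y ^ M]` because `Y ^ M = Cˢ Y C⁻ˢ`.
    have e1 : (X ^ M)⁻¹ * C ^ M * X ^ (α * geomSum α M)
        = (C ^ s)⁻¹ * (Y ^ (α * geomSum α M))⁻¹ * C ^ M * C ^ s * Y := by
      have f1 : X ^ M = (C ^ s)⁻¹ * X * C ^ s := by
        have := hXY.zpow_mul_comm_pow 1 s
        rw [mul_one, ← hM, zpow_natCast, zpow_one] at this
        rw [mul_assoc, this, ← mul_assoc, inv_mul_cancel, one_mul]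
      have f2 : Y ^ M = C ^ s * Y * (C ^ s)⁻¹ := by
        have := hXY.comm_pow_mul_zpow 1 s
        rw [mul_one, ← hM, zpow_natCast, zpow_one] at this
        rw [← hC] at this
        rw [this]; group
      have f3 := hXY.conj_pow M
      have f4 := hXY.conj_pow' M
      rw [← hC] at f3 f4
      calc (X ^ M)⁻¹ * C ^ M * X ^ (α * geomSum α M)
          = (X ^ M)⁻¹ * Y⁻¹ * X ^ M * Y := by rw [mul_assoc, ← f3]; group
        _ = (C ^ s)⁻¹ * (X⁻¹ * Y ^ M * X)⁻¹ * C ^ s * Y := by rw [f2, f1]; group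
        _ = _ := by rw [f4]; group
    have e2 : X ^ (α * geomSum α M) * (C ^ s)⁻¹ = (C ^ s)⁻¹ * X ^ t := by
      have := hXY.zpow_mul_comm_pow t s
      rw [ht, ← mul_assoc (α ^ s), ← mul_pow, pw hX, ← ht, ← hC] at this
      have h5 : (C ^ s)⁻¹ * (X ^ t * C ^ s) * (C ^ s)⁻¹
        = (C ^ s)⁻¹ * (C ^ s * X ^ (α * geomSum α M)) * (C ^ s)⁻¹ := by rw [this]
      simpa [mul_assoc] using h5.symm
    have e3 : (X ^ M)⁻¹ * (C ^ s)⁻¹ = (C ^ s)⁻¹ * X⁻¹ := by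
      have := hXY.zpow_mul_comm_pow 1 s
      rw [mul_one, ← hM, zpow_natCast, zpow_one, ← hC] at this
      rw [← mul_inv_rev, ← mul_inv_rev, this]
    have e4 : C ^ s * Y = Y ^ M * C ^ s := by
      have := hXY.comm_pow_mul_zpow 1 s
      rwa [mul_one, ← hM, zpow_natCast, zpow_one, ← hC] at this
    have e5 : X⁻¹ * C ^ M * X ^ t = (Y ^ (α * geomSum α M))⁻¹ * C ^ M * Y ^ M := by
      calc X⁻¹ * C ^ M * X ^ t
          = C ^ s * ((C ^ s)⁻¹ * X⁻¹) * C ^ M * X ^ t := by group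
        _ = C ^ s * (X ^ M)⁻¹ * C ^ M * ((C ^ s)⁻¹ * X ^ t) := by rw [← e3]; group
        _ = C ^ s * ((X ^ M)⁻¹ * C ^ M * X ^ (α * geomSum α M)) * (C ^ s)⁻¹ := by
          rw [← e2]; group
        _ = (Y ^ (α * geomSum α M))⁻¹ * C ^ M * (C ^ s * Y) * (C ^ s)⁻¹ := by rw [e1]; group
        _ = _ := by rw [e4]; group
    have e6 := hXY.zpow_mul_comm_pow (-1) M
    have e7 := hXY.comm_pow_mul_zpow (M : ℤ) M
    rw [← hC] at e6 e7
    rw [← zpow_neg_one X, e6, mul_assoc, ← zpow_add, mul_assoc, ← zpow_natCast Y M, e7,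
      ← mul_assoc, ← zpow_neg, ← zpow_add] at e5
    have g1 : -E = α ^ M * -1 + t := by rw [hE]; ring
    have g2 : Y ^ (M * E) = Y ^ (-(α * geomSum α M) + α ^ M * M) := by
      have : (M : ℤ) * E = α ^ M * M + (α * γ) ^ s * (-(α * geomSum α M)) := by
        rw [hE, hM]; ring
      rw [this, zpow_add, pw hY, ← zpow_add, add_comm]
    rw [g1, e5, g2]
  have k1 := key h hA hB
  have k2 := key h.swap hB hA
  have cB : ∀ {X Y : G}, MacdonaldPair α X Y → X ^ (α * γ) = X → Y ^ (α * γ) = Y →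
      Commute X (Y ^ E) := by
    intro X Y hXY hX hY
    have h1 := key hXY hX hY
    -- On `⟨Y⟩` the exponent `M = α ^ s` is undone by `γ ^ s`, so `Y ^ E` is a power of `Y ^ (M *
    -- E)`, which is a power of `X`.
    have h2 : Y ^ E = (Y ^ (M * E)) ^ (γ ^ s) := by
      rw [← zpow_mul, hM, ← pw hY s E]; congr 1; ring
    rw [h2, ← h1]
    exact ((Commute.refl X).zpow_right _).zpow_right _
  have oB := h.zpow_mul_sub_one_eq_one (cB h hA hB)
  have oA := h.swap.zpow_mul_sub_one_eq_one (cB h.swap hB hA)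
  refine ⟨cB h.swap hB hA, ?_, oA⟩
  -- Modulo `α - 1` every power of `α` is `1`, so it disappears from exponents that are multiples of
  -- `E`.
  have red : ∀ {X : G}, X ^ (E * (α - 1)) = 1 → ∀ k : ℕ, X ^ (E * α ^ k) = X ^ E := by
    intro X hX k
    obtain ⟨c, hc⟩ := (by simpa using sub_dvd_pow_sub_pow α 1 k : α - 1 ∣ α ^ k - 1)
    have : E * α ^ k = E + E * (α - 1) * c := by linear_combination E * hc
    rw [this, zpow_add, zpow_mul X (E * (α - 1)), hX]; simp
  rw [zpow_neg, red oA, hM, mul_comm, red oB] at k1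
  rw [← k1]; simp

end MacdonaldPair


/-! ### Orders of the generators and their prime divisors -/

/-- A field fact: the values `1 - (x - 1) x ^ s` cannot all be powers of `x ≠ 1`. -/
theorem not_forall_exists_pow_mul_eq_one {r : ℕ} [Fact r.Prime] {x : ZMod r} (hx0 : x ≠ 0)
    (hx1 : x ≠ 1) : ¬ ∀ s : ℕ, ∃ M : ℕ, x ^ M * (1 - (x - 1) * x ^ s) = 1 := by
  intro H
  have hd : 0 < orderOf x := orderOf_pos_iff.mpr (isOfFinOrder_iff_pow_eq_one.mpr
    ⟨r - 1, Nat.sub_pos_of_lt (Fact.out : r.Prime).one_lt, ZMod.pow_card_sub_one_eq_one hx0⟩)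
  set d := orderOf x with hdd
  have hsum : ∑ i ∈ Finset.range d, x ^ i = 0 := by
    have h1 := geom_sum_mul x d
    rw [hdd, pow_orderOf_eq_one, sub_self] at h1
    exact (mul_eq_zero.mp h1).resolve_right (sub_ne_zero.mpr hx1)
  choose M hM using H
  -- With `d` the order of `x`, the exponent `(d - 1) * M s` gives the inverse of `x ^ M s`.
  have hpow : ∀ s, 1 - (x - 1) * x ^ s = x ^ ((d - 1) * M s % d) := by
    intro s
    have h1 : x ^ ((d - 1) * M s % d) * x ^ M s = 1 := by
      rw [hdd, pow_mod_orderOf, ← hdd, ← pow_add]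
      have : (d - 1) * M s + M s = d * M s := by
        obtain ⟨e, he⟩ : ∃ e, d = e + 1 := ⟨d - 1, by omega⟩
        rw [he]; simp; ring
      rw [this, pow_mul, hdd, pow_orderOf_eq_one, one_pow]
    have h2 : x ^ M s ≠ 0 := pow_ne_zero _ hx0
    apply mul_left_cancel₀ h2
    rw [hM, mul_comm, h1]
  have hinj : Set.InjOn (fun s => (d - 1) * M s % d) (Finset.range d : Set ℕ) := by
    intro s hs t ht hst
    have hst' : x ^ ((d - 1) * M s % d) = x ^ ((d - 1) * M t % d) := by
      simp only at hst; rw [hst]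
    rw [← hpow, ← hpow] at hst'
    have h3 : x ^ s = x ^ t := mul_left_cancel₀ (sub_ne_zero.mpr hx1) (by linear_combination -hst')
    simp only [Finset.coe_range, Set.mem_Iio] at hs ht
    exact pow_injOn_Iio_orderOf hs ht h3
  have himg : (Finset.range d).image (fun s => (d - 1) * M s % d) = Finset.range d := by
    apply Finset.eq_of_subset_of_card_le
    · intro y hy
      obtain ⟨s, _, rfl⟩ := Finset.mem_image.mp hy
      exact Finset.mem_range.mpr (Nat.mod_lt _ hd)
    · rw [Finset.card_image_of_injOn hinj]
  -- The `d` values `1 - (x - 1) x ^ s` are distinct powers of `x`, hence all of them, and sum to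
  -- `0`. Summed directly they give `d`, which is nonzero in `ZMod r` because `d ∣ r - 1`.
  have h4 : ∑ s ∈ Finset.range d, (1 - (x - 1) * x ^ s) = 0 := by
    rw [Finset.sum_congr rfl (fun s _ => hpow s), ← Finset.sum_image (f := fun j => x ^ j) hinj,
      himg, hsum]
  rw [Finset.sum_sub_distrib, ← Finset.mul_sum, hsum] at h4
  simp only [Finset.sum_const, Finset.card_range, nsmul_eq_mul, mul_one, mul_zero, sub_zero] at h4
  rw [ZMod.natCast_eq_zero_iff] at h4
  have h5 : d ∣ r - 1 := orderOf_dvd_of_pow_eq_one (ZMod.pow_card_sub_one_eq_one hx0)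
  have h6 := Nat.le_of_dvd (Nat.sub_pos_of_lt (Fact.out : r.Prime).one_lt) (h4.trans h5)
  have := (Fact.out : r.Prime).one_lt
  omega

theorem dvd_geomSum_of_dvd {r : ℕ} {α : ℤ} (h : (r : ℤ) ∣ α - 1) (k : ℕ) :
    (r : ℤ) ∣ geomSum α k - k := by
  rw [← ZMod.intCast_zmod_eq_zero_iff_dvd] at *
  have h1 : (α : ZMod r) = 1 := by push_cast at h; exact sub_eq_zero.mp h
  simp [geomSum, h1]

theorem geomSum_mul_index (α : ℤ) (p k : ℕ) :
    geomSum α (p * k) = geomSum α k * geomSum (α ^ k) p := by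
  induction p with
  | zero => simp [geomSum]
  | succ p ih =>
    have : geomSum (α ^ k) (p + 1) = geomSum (α ^ k) p + (α ^ k) ^ p := by
      simp [geomSum, Finset.sum_range_succ]
    rw [this, mul_add, ← ih, Nat.succ_mul]
    simp only [geomSum, Finset.sum_range_add, Finset.sum_mul, ← pow_mul]
    congr 1
    apply Finset.sum_congr rfl
    intro i _
    rw [← pow_add, mul_comm k p, add_comm]

/-- If all primes dividing `k` divide `α - 1`, then `k` divides `1 + ⋯ + α ^ (k - 1)`, and the
quotient is `1` modulo any odd prime divisor of `α - 1`. -/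
theorem geomSum_eq_mul {α : ℤ} {k : ℕ} (hk0 : k ≠ 0)
    (hk : ∀ p : ℕ, p.Prime → p ∣ k → (p : ℤ) ∣ α - 1)
    {r : ℕ} (hr : r.Prime) (hr2 : r ≠ 2) (hrα : (r : ℤ) ∣ α - 1) :
    ∃ g : ℤ, geomSum α k = k * g ∧ (r : ℤ) ∣ g - 1 := by
  induction k using induction_on_primes with
  | zero => exact absurd rfl hk0
  | one => exact ⟨1, by simp [geomSum], by simp⟩
  | prime_mul p k hp ih =>
    have hk0' : k ≠ 0 := by rintro rfl; simp at hk0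
    obtain ⟨g, hg, hg1⟩ := ih hk0' (fun q hq hqk => hk q hq (hqk.mul_left p))
    have hpα := hk p hp (dvd_mul_right p k)
    have hβ : ∀ q : ℕ, (q : ℤ) ∣ α - 1 → (q : ℤ) ∣ α ^ k - 1 := fun q hq =>
      hq.trans (by simpa using sub_dvd_pow_sub_pow α 1 k)
    obtain ⟨g', hg'⟩ : (p : ℤ) ∣ geomSum (α ^ k) p :=
      (dvd_sub_left (dvd_refl _)).mp (dvd_geomSum_of_dvd (hβ p hpα) p)
    have hg'1 : (r : ℤ) ∣ g' - 1 := by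
      by_cases hpr : p = r
      · subst hpr
        obtain ⟨x, hx⟩ := hβ p hpα
        have hβx : α ^ k = 1 + p * x := by linarith
        -- A geometric sum with ratio `1 + p x`, expanded modulo `p ^ 2`. At `n = p` odd, `p`
        -- divides `p.choose 2`, so the sum is `p` times a number congruent to `1` modulo `p`.
        have h1 : ∀ n : ℕ, ((p : ℤ) ^ 2) ∣ geomSum (α ^ k) n - (n + p * x * (n.choose 2 : ℕ)) := by
          intro n
          induction n with
          | zero => simp [geomSum]
          | succ n ih =>
            rw [geomSum_succ, hβx] at *
            obtain ⟨y, hy⟩ := ih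
            have hc : ((n + 1).choose 2 : ℤ) = n + (n.choose 2 : ℕ) := by
              rw [Nat.choose_succ_succ' n 1]; simp
            rw [hc]
            refine ⟨y * (1 + p * x) + x ^ 2 * (n.choose 2 : ℕ), ?_⟩
            push_cast
            linear_combination (1 + p * x) * hy
        obtain ⟨y, hy⟩ := h1 p
        have hc : (p : ℤ) ∣ (p.choose 2 : ℕ) := by
          exact_mod_cast hp.dvd_choose_self (by norm_num) (lt_of_le_of_ne hp.two_le (Ne.symm hr2))
        obtain ⟨z, hz⟩ := hc
        rw [hg', hz] at hy
        refine ⟨x * z + y, ?_⟩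
        have hp0 : (p : ℤ) ≠ 0 := by exact_mod_cast hp.ne_zero
        apply mul_left_cancel₀ hp0
        linear_combination hy
      · have h1 := dvd_geomSum_of_dvd (hβ r hrα) p
        rw [hg'] at h1
        have h2 : (r : ℤ) ∣ p * (g' - 1) := by convert h1 using 1; ring
        exact (Int.Prime.dvd_mul' hr h2).resolve_left (by
          intro h; exact hpr ((Nat.prime_dvd_prime_iff_eq hr hp).mp (by exact_mod_cast h)).symm)
    refine ⟨g * g', ?_, ?_⟩
    · rw [geomSum_mul_index, hg, hg']; push_cast; ring
    · have : g * g' - 1 = (g - 1) * g' + (g' - 1) := by ring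
      rw [this]; exact dvd_add (hg1.mul_right _) hg'1

theorem dvd_geomSum {α : ℤ} {k : ℕ} (hk0 : k ≠ 0)
    (hk : ∀ p : ℕ, p.Prime → p ∣ k → (p : ℤ) ∣ α - 1) : (k : ℤ) ∣ geomSum α k := by
  induction k using induction_on_primes with
  | zero => exact absurd rfl hk0
  | one => simp
  | prime_mul p k hp ih =>
    have hk0' : k ≠ 0 := by rintro rfl; simp at hk0
    have h1 := ih hk0' (fun q hq hqk => hk q hq (hqk.mul_left p))
    have hpα := (hk p hp (dvd_mul_right p k)).trans
      (by simpa using sub_dvd_pow_sub_pow α 1 k : α - 1 ∣ α ^ k - 1)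
    have h2 : (p : ℤ) ∣ geomSum (α ^ k) p :=
      (dvd_sub_left (dvd_refl _)).mp (dvd_geomSum_of_dvd hpα p)
    rw [geomSum_mul_index, mul_comm p]
    push_cast
    exact mul_dvd_mul h1 h2

namespace MacdonaldPair

variable {G : Type*} [Group G] {α : ℤ} {A B : G}

/-- The generators have finite order, coprime to `α`. -/
theorem exists_pow_eq_one (h : MacdonaldPair α A B) (h0 : α ≠ 0) (h1 : α ≠ 1) :
    ∃ n : ℕ, 0 < n ∧ A ^ n = 1 ∧ B ^ n = 1 ∧ IsCoprime (n : ℤ) α := by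
  -- For `α = -1` the integer `N` used below is `0` and gives no information; the relations are then
  -- exploited directly.
  by_cases hm1 : α = -1
  · subst hm1
    have key : ∀ {X Y : G}, MacdonaldPair (-1) X Y → X ^ 4 = 1 := by
      intro X Y hXY
      have e1 := hXY.conj_pow 2
      have e0 : geomSum (-1) 2 = 0 := by norm_num [geomSum, Finset.sum_range_succ]
      rw [e0, mul_zero, zpow_zero, mul_one] at e1
      have e2 := hXY.comm_pow_mul_zpow 1 2
      norm_num at e2
      have e3 : X ^ 2 = gcomm X Y ^ 2 := by
        have : Y * (Y⁻¹ * X ^ 2 * Y) * Y⁻¹ = Y * gcomm X Y ^ 2 * Y⁻¹ := by rw [e1]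
        rw [← e2] at this
        simpa [mul_assoc] using this
      have e4 := hXY.zpow_mul_comm 2
      have e5 : X ^ (2 : ℤ) = gcomm X Y ^ 2 := by rw [← e3]; norm_cast
      have e6 : gcomm X Y * X ^ (-1 * 2 : ℤ) = gcomm X Y * X ^ (2 : ℤ) := by
        rw [← e4, e5]; group
      have e7 := mul_left_cancel e6
      have e8 : X ^ (4 : ℤ) = 1 := by
        have : (4 : ℤ) = 2 - (-1 * 2) := by norm_num
        rw [this, zpow_sub, e7, mul_inv_cancel]
      exact_mod_cast e8
    exact ⟨4, by norm_num, key h, key h.swap, by norm_num [isCoprime_one_right.neg_right]⟩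
  · set M : ℕ := α.natAbs ^ 2 with hMdef
    have hM : (M : ℤ) = α ^ 2 := by simp [hMdef]
    set N : ℤ := α ^ (1 + M) - geomSum α M with hN
    have e1 := h.zpow_eq_zpow hM hN
    have e2 := h.swap.zpow_eq_zpow hM hN
    have oB := h.zpow_mul_sub_one_eq_one (F := N) (by
      rw [← e1]; exact (Commute.refl A).zpow_right _)
    have oA := h.swap.zpow_mul_sub_one_eq_one (F := N) (by
      rw [← e2]; exact (Commute.refl B).zpow_right _)
    -- This form shows at once that `N (α - 1)` is nonzero and prime to `α`.
    have e3 : N * (α - 1) = α ^ M * (α * (α - 1) - 1) + 1 := by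
      rw [hN, sub_mul, geomSum_mul]; ring
    have hM2 : 2 ≤ M := by
      have : 2 ≤ α.natAbs := by omega
      nlinarith
    have hne : N * (α - 1) ≠ 0 := by
      intro hz
      rw [hz] at e3
      have : α ^ M ∣ 1 := ⟨-(α * (α - 1) - 1), by linear_combination -e3⟩
      have h2 : α ∣ 1 := (dvd_pow_self α (by omega)).trans this
      rcases Int.isUnit_iff.mp (isUnit_of_dvd_one h2) with h | h
      · exact h1 h
      · exact hm1 h
    refine ⟨(N * (α - 1)).natAbs, Int.natAbs_pos.mpr hne, ?_, ?_, ?_⟩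
    · exact pow_natAbs_eq_one.mpr oA
    · exact pow_natAbs_eq_one.mpr oB
    · have hc : IsCoprime (N * (α - 1)) α := by
        rw [e3]
        obtain ⟨M', hM'⟩ : ∃ M', M = M' + 1 := ⟨M - 1, by omega⟩
        exact ⟨1, -(α ^ M' * (α * (α - 1) - 1)), by rw [hM']; ring⟩
      rcases Int.natAbs_eq (N * (α - 1)) with h | h
      · rw [← h]; exact hc
      · have := hc.neg_left
        rw [h, neg_neg] at this
        exact this

/-- Every prime dividing the order of `A` divides `α - 1`. -/
theorem prime_dvd_sub_one (h : MacdonaldPair α A B) (h0 : α ≠ 0) (h1 : α ≠ 1) {r : ℕ}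
    (hr : r.Prime) (hrA : r ∣ orderOf A) : (r : ℤ) ∣ α - 1 := by
  have := Fact.mk hr
  obtain ⟨n, hn, hAn, hBn, hcop⟩ := h.exists_pow_eq_one h0 h1
  by_contra hrα
  -- replace `α` by a natural number
  set a : ℕ := (α % n).toNat + n with ha
  have haα : (n : ℤ) ∣ (a : ℤ) - α := by
    have : (0 : ℤ) ≤ α % n := Int.emod_nonneg _ (by omega)
    rw [ha]; push_cast; rw [Int.toNat_of_nonneg this]
    have := Int.emod_add_mul_ediv α n
    exact ⟨1 - α / n, by linear_combination this⟩
  have hA' : A ^ (n : ℤ) = 1 := by exact_mod_cast hAn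
  have hB' : B ^ (n : ℤ) = 1 := by exact_mod_cast hBn
  have h' : MacdonaldPair (a : ℤ) A B := h.congr_exponent hA' hB' haα
  have hcop' : IsCoprime (n : ℤ) (a : ℤ) := by
    obtain ⟨k, hk⟩ := haα
    have : (a : ℤ) = α + n * k := by linarith
    rw [this]; exact IsCoprime.add_mul_left_right hcop k
  obtain ⟨u, γ, huγ⟩ := hcop'
  have hinv : ∀ {X : G}, X ^ (n : ℤ) = 1 → X ^ ((a : ℤ) * γ) = X := by
    intro X hX
    have : (a : ℤ) * γ = 1 - n * u := by linarith
    rw [this, zpow_sub, zpow_mul, hX]; simp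
  have hrn : r ∣ n := hrA.trans (orderOf_dvd_of_pow_eq_one hAn)
  have hrn' : ((n : ℤ) : ZMod r) = 0 := by
    rw [ZMod.intCast_zmod_eq_zero_iff_dvd]; exact_mod_cast hrn
  set x : ZMod r := (a : ZMod r) with hx
  have hxγ : x * (γ : ZMod r) = 1 := by
    have := congrArg (Int.cast : ℤ → ZMod r) huγ
    push_cast at this
    push_cast at hrn'
    rw [hrn'] at this
    rw [← this, hx]; ring
  have hx0 : x ≠ 0 := by
    intro hx0; rw [hx0, zero_mul] at hxγ; exact zero_ne_one hxγ
  have hxa : x = (α : ZMod r) := by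
    have : (((a : ℤ) - α : ℤ) : ZMod r) = 0 := by
      rw [ZMod.intCast_zmod_eq_zero_iff_dvd]; exact (by exact_mod_cast hrn : (r : ℤ) ∣ n).trans haα
    push_cast at this
    exact sub_eq_zero.mp this
  have hx1 : x ≠ 1 := by
    intro hx1
    apply hrα
    rw [← ZMod.intCast_zmod_eq_zero_iff_dvd]
    push_cast
    rw [← hxa, hx1, sub_self]
  apply not_forall_exists_pow_mul_eq_one hx0 hx1
  intro s
  -- `central_power` is used with `s + 1`: its exponent carries an extra factor `α`, and cancelling
  -- it leaves `x ^ s`.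
  refine ⟨a ^ (s + 1), ?_⟩
  have hE := (h'.central_power (hinv hA') (hinv hB') (s := s + 1) (M := a ^ (s + 1))
    (by push_cast; rfl) rfl).2.2
  rw [← orderOf_dvd_iff_zpow_eq_one] at hE
  have hE2 : (r : ℤ) ∣ _ := (Int.natCast_dvd_natCast.mpr hrA).trans hE
  rw [← ZMod.intCast_zmod_eq_zero_iff_dvd] at hE2
  set M := a ^ (s + 1) with hM
  have hg := congrArg (Int.cast : ℤ → ZMod r) (geomSum_mul (a : ℤ) M)
  push_cast at hE2 hg
  rw [← hx] at hE2 hg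
  have hE3 := (mul_eq_zero.mp hE2).resolve_right (sub_ne_zero.mpr hx1)
  have hxs : x ^ (s + 1) * (γ : ZMod r) ^ (s + 1) = 1 := by rw [← mul_pow, hxγ, one_pow]
  have e : x ^ (s + 1) * x ^ M = x * (geomSum (a : ℤ) M : ZMod r) := by
    linear_combination x ^ (s + 1) * hE3 + x * (geomSum (a : ℤ) M : ZMod r) * hxs
  have e2 : x ^ s * x ^ M = (geomSum (a : ℤ) M : ZMod r) := by
    apply mul_left_cancel₀ hx0; rw [← e]; ring
  linear_combination -(x - 1) * e2 - hg

end MacdonaldPair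


/-! ### Nilpotency and finiteness of the Macdonald group -/

theorem isNilpotent_and_finite_of_central {G : Type*} [Group G] {z : G}
    (hz : z ∈ Subgroup.center G) (hfin : IsOfFinOrder z) {N : Subgroup G} [N.Normal]
    (hN : N = Subgroup.zpowers z)
    (h : Group.IsNilpotent (G ⧸ N) ∧ Finite (G ⧸ N)) :
    Group.IsNilpotent G ∧ Finite G := by
  obtain ⟨h1, h2⟩ := h
  constructor
  · apply Subgroup.isNilpotent_of_ker_le_center (QuotientGroup.mk' N)
    rw [QuotientGroup.ker_mk', hN, Subgroup.zpowers_le]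
    exact hz
  · have : Finite N := by
      rw [hN]; exact (finite_zpowers.mpr hfin).to_subtype
    exact Finite.of_subgroup_quotient N

theorem mem_center_of_commute {G : Type*} [Group G] {A B z : G}
    (hgen : Subgroup.closure {A, B} = ⊤) (hA : Commute A z) (hB : Commute B z) :
    z ∈ Subgroup.center G := by
  rw [← Subgroup.centralizer_univ, ← Subgroup.coe_top, ← hgen, Subgroup.centralizer_closure]
  rw [Subgroup.mem_centralizer_iff]
  rintro g (rfl | rfl)
  · exact hA
  · exact hB

theorem zpowers_normal_of_mem_center {G : Type*} [Group G] {z : G}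
    (hz : z ∈ Subgroup.center G) : (Subgroup.zpowers z).Normal := by
  refine ⟨fun n hn g => ?_⟩
  obtain ⟨k, rfl⟩ := Subgroup.mem_zpowers_iff.mp hn
  rw [(Subgroup.mem_center_iff.mp (Subgroup.zpow_mem _ hz k) g), mul_inv_cancel_right]
  exact hn

theorem closure_map_eq_top {G H : Type*} [Group G] [Group H] {A B : G}
    (hgen : Subgroup.closure {A, B} = ⊤) {f : G →* H} (hf : Function.Surjective f) :
    Subgroup.closure {f A, f B} = ⊤ := by
  rw [← Set.image_pair, ← MonoidHom.map_closure, hgen, ← MonoidHom.range_eq_map,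
    MonoidHom.range_eq_top.mpr hf]

namespace MacdonaldPair

theorem comm_pow_eq {G : Type*} [Group G] {α : ℤ} {A B : G} (h : MacdonaldPair α A B) {n : ℕ}
    (hA : A ^ n = 1) : gcomm A B ^ n = A ^ (-(α * geomSum α n)) := by
  have := h.conj_pow n
  rw [hA, mul_one, inv_mul_cancel] at this
  rw [zpow_neg]; exact eq_inv_of_mul_eq_one_left this.symm

theorem isOfFinOrder_comm {G : Type*} [Group G] {α : ℤ} {A B : G} (h : MacdonaldPair α A B) {n : ℕ}
    (hn : 0 < n) (hA : A ^ n = 1) : IsOfFinOrder (gcomm A B) := by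
  rw [isOfFinOrder_iff_pow_eq_one]
  refine ⟨n * n, Nat.mul_pos hn hn, ?_⟩
  rw [pow_mul, h.comm_pow_eq hA, ← zpow_natCast, ← zpow_mul, mul_comm, zpow_mul, zpow_natCast, hA,
    one_zpow]

/-- A Macdonald group in which the generators have order dividing `n` is nilpotent and finite as
soon as all primes dividing `n` divide `α - 1`. -/
theorem isNilpotent_and_finite {α : ℤ} {n : ℕ} (hn0 : n ≠ 0)
    (hn : ∀ p : ℕ, p.Prime → p ∣ n → (p : ℤ) ∣ α - 1) {G : Type*} [Group G] {A B : G}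
    (h : MacdonaldPair α A B) (hgen : Subgroup.closure {A, B} = ⊤) (hA : A ^ n = 1)
    (hB : B ^ n = 1) : Group.IsNilpotent G ∧ Finite G := by
  induction n using induction_on_primes generalizing G with
  | zero => exact absurd rfl hn0
  | one =>
    have : (⊥ : Subgroup G) = ⊤ := by
      rw [← hgen, eq_comm, Subgroup.closure_eq_bot_iff]
      rintro g (rfl | rfl) <;> simp_all
    have : Subsingleton G := (Subgroup.subsingleton_iff).mp (subsingleton_of_bot_eq_top this)
    exact ⟨inferInstance, inferInstance⟩
  | prime_mul r k hr ih =>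
    have hk0 : k ≠ 0 := by rintro rfl; simp at hn0
    have hkα : ∀ p : ℕ, p.Prime → p ∣ k → (p : ℤ) ∣ α - 1 := fun q hq hqk =>
      hn q hq (hqk.mul_left r)
    have hrα := hn r hr (dvd_mul_right r k)
    have hn' : 0 < r * k := Nat.pos_of_ne_zero hn0
    -- The generators have order dividing `r * k`, so this congruence makes `C ^ k` act trivially on
    -- both.
    have hdvd : ((r * k : ℕ) : ℤ) ∣ α ^ k - 1 := by
      rw [← geomSum_mul, mul_comm r k]; push_cast
      exact mul_dvd_mul (dvd_geomSum hk0 hkα) hrα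
    have hpow : ∀ {X : G}, X ^ (r * k) = 1 → X ^ (α ^ k) = X := by
      intro X hX
      obtain ⟨c, hc⟩ := hdvd
      have : α ^ k = 1 + (r * k : ℕ) * c := by linarith
      rw [this, zpow_add, zpow_mul, zpow_natCast, hX]; simp
    -- `C ^ k` is central
    have hCc : gcomm A B ^ k ∈ Subgroup.center G := by
      apply mem_center_of_commute hgen
      · have := h.zpow_mul_comm_pow 1 k
        rw [mul_one, zpow_one, hpow hA] at this
        exact this
      · have := h.comm_pow_mul_zpow 1 k
        rw [mul_one, zpow_one, hpow hB] at this
        exact this.symm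
    obtain ⟨N₁, hN₁⟩ : ∃ N, N = Subgroup.zpowers (gcomm A B ^ k) := ⟨_, rfl⟩
    have : N₁.Normal := hN₁ ▸ zpowers_normal_of_mem_center hCc
    apply isNilpotent_and_finite_of_central hCc ((h.isOfFinOrder_comm hn' hA).pow) hN₁
    have hs₁ := QuotientGroup.mk'_surjective N₁
    set f₁ := QuotientGroup.mk' N₁
    have h₁ := h.map f₁
    have hgen₁ := closure_map_eq_top hgen hs₁
    have hC₁ : gcomm (f₁ A) (f₁ B) ^ k = 1 := by
      rw [← gcomm_map, ← map_pow, ← MonoidHom.mem_ker, QuotientGroup.ker_mk', hN₁]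
      exact Subgroup.mem_zpowers _
    have hA₁ : f₁ A ^ (r * k) = 1 := by rw [← map_pow, hA, map_one]
    have hB₁ : f₁ B ^ (r * k) = 1 := by rw [← map_pow, hB, map_one]
    generalize f₁ A = A₁ at *
    generalize f₁ B = B₁ at *
    -- `A ^ k` is central modulo `C ^ k`
    have hcomm : ∀ {X Y : G ⧸ N₁}, MacdonaldPair α X Y → X ^ (r * k) = 1 → gcomm X Y ^ k = 1 →
        Commute Y (X ^ k) := by
      intro X Y hXY hX hC
      have e1 := hXY.conj_pow k
      rw [hC, one_mul] at e1
      -- Write the geometric sum as `k g`. For odd `r`, `g` is `1` modulo `r`. For `r = 2` only the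
      -- parity of `g` matters: if `g` is even the power vanishes and `X ^ k`, being conjugate to
      -- it, is trivial.
      have e2 : X ^ (α * geomSum α k) = X ^ k ∨ X ^ (α * geomSum α k) = 1 := by
        have red : ∀ c : ℤ, X ^ (((r * k : ℕ) : ℤ) * c) = 1 := by
          intro c; rw [zpow_mul, zpow_natCast, hX, one_zpow]
        obtain ⟨d, hd⟩ := hrα
        by_cases hr2 : r = 2
        · obtain ⟨g, hg⟩ := dvd_geomSum hk0 hkα
          rcases Int.even_or_odd' g with ⟨c, hc | hc⟩
          · right
            rw [← red (α * c)]; congr 1; rw [hg, hc, hr2]; push_cast; ring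
          · left
            have : α * geomSum α k = k + ((r * k : ℕ) : ℤ) * (c + d * g) := by
              have : α = 1 + 2 * d := by rw [hr2] at hd; push_cast at hd; linarith
              rw [hg, hc, hr2, this]; push_cast; ring
            rw [this, zpow_add, red, mul_one, zpow_natCast]
        · left
          obtain ⟨g, hg, c, hc⟩ := geomSum_eq_mul hk0 hkα hr hr2 ⟨d, hd⟩
          have : α * geomSum α k = k + ((r * k : ℕ) : ℤ) * (c + d * g) := by
            rw [hg]; push_cast; linear_combination (k : ℤ) * hc + (k : ℤ) * g * hd
          rw [this, zpow_add, red, mul_one, zpow_natCast]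
      rcases e2 with e2 | e2
      · rw [e2] at e1
        have : X ^ k * Y = Y * X ^ k := by
          calc X ^ k * Y = Y * (Y⁻¹ * X ^ k * Y) := by group
            _ = _ := by rw [e1]
        exact this.symm
      · rw [e2] at e1
        have : X ^ k = 1 := by
          have : Y * (Y⁻¹ * X ^ k * Y) * Y⁻¹ = 1 := by rw [e1]; group
          simpa [mul_assoc] using this
        rw [this]; exact Commute.one_right Y
    have hAc : A₁ ^ k ∈ Subgroup.center (G ⧸ N₁) :=
      mem_center_of_commute hgen₁ ((Commute.refl _).pow_right k) (hcomm h₁ hA₁ hC₁)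
    have hfo : ∀ {X : G ⧸ N₁}, X ^ (r * k) = 1 → IsOfFinOrder X := fun hX =>
      isOfFinOrder_iff_pow_eq_one.mpr ⟨r * k, hn', hX⟩
    have := zpowers_normal_of_mem_center hAc
    apply isNilpotent_and_finite_of_central hAc (hfo hA₁).pow rfl
    set N₂ := Subgroup.zpowers (A₁ ^ k)
    have hs₂ := QuotientGroup.mk'_surjective N₂
    have hBc : B₁ ^ k ∈ Subgroup.center (G ⧸ N₁) :=
      mem_center_of_commute hgen₁ (hcomm h₁.swap hB₁ (by rw [← gcomm_inv, inv_pow, hC₁, inv_one]))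
        ((Commute.refl _).pow_right k)
    set f₂ := QuotientGroup.mk' N₂
    have hA₂ : f₂ A₁ ^ k = 1 := by
      rw [← map_pow, ← MonoidHom.mem_ker, QuotientGroup.ker_mk']
      exact Subgroup.mem_zpowers _
    have h₂ := h₁.map f₂
    have hgen₂ := closure_map_eq_top hgen₁ hs₂
    have hBc₂ : f₂ B₁ ^ k ∈ Subgroup.center ((G ⧸ N₁) ⧸ N₂) := by
      rw [← map_pow]
      exact mem_center_of_commute hgen₂
        (Commute.map (Subgroup.mem_center_iff.mp hBc A₁ : Commute A₁ (B₁ ^ k)) f₂)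
        (Commute.map (Subgroup.mem_center_iff.mp hBc B₁ : Commute B₁ (B₁ ^ k)) f₂)
    have := zpowers_normal_of_mem_center hBc₂
    apply isNilpotent_and_finite_of_central hBc₂ 
      (by rw [← map_pow]; exact f₂.isOfFinOrder (hfo hB₁).pow) rfl
    have hs₃ := QuotientGroup.mk'_surjective (Subgroup.zpowers (f₂ B₁ ^ k))
    set f₃ := QuotientGroup.mk' (Subgroup.zpowers (f₂ B₁ ^ k))
    apply ih hk0 hkα (h₂.map f₃) (closure_map_eq_top hgen₂ hs₃)
    · exact (map_pow f₃ _ k).symm.trans (by rw [hA₂, map_one])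
    · refine (map_pow f₃ _ k).symm.trans ?_
      rw [← MonoidHom.mem_ker, QuotientGroup.ker_mk']
      exact Subgroup.mem_zpowers _

end MacdonaldPair

theorem macdonaldPair_macdonaldGroup (α : ℤ) :
    MacdonaldPair α (macdonaldX α) (macdonaldY α) := by
  have key : ∀ r ∈ macdonaldRels α, PresentedGroup.mk (macdonaldRels α) r = 1 := fun r hr =>
    (PresentedGroup.one_of_mem hr)
  have key₁ := key _ (Set.mem_insert _ _)
  have key₂ := key _ (Set.mem_insert_of_mem _ rfl)
  rw [map_mul, map_inv, mul_inv_eq_one, map_zpow] at key₁ key₂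
  simp only [conjBy, gcomm_map, map_mul, map_inv] at key₁ key₂
  refine ⟨key₁, ?_⟩
  rw [← gcomm_inv, inv_inv] at key₂
  exact key₂

theorem closure_macdonald (α : ℤ) :
    Subgroup.closure {macdonaldX α, macdonaldY α} = ⊤ := by
  rw [← PresentedGroup.closure_range_of]
  congr 1
  ext g
  simp [macdonaldX, macdonaldY, Fin.exists_fin_two, eq_comm]

theorem macdonaldGroup_isNilpotent_and_finite {α : ℤ} (h0 : α ≠ 0) (h1 : α ≠ 1) :
    Group.IsNilpotent (MacdonaldGroup α) ∧ Finite (MacdonaldGroup α) := by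
  have h := macdonaldPair_macdonaldGroup α
  obtain ⟨n, hn, hA, hB, -⟩ := h.exists_pow_eq_one h0 h1
  have hA0 : orderOf (macdonaldX α) ≠ 0 :=
    (orderOf_pos_iff.mpr (isOfFinOrder_iff_pow_eq_one.mpr ⟨n, hn, hA⟩)).ne'
  have hB0 : orderOf (macdonaldY α) ≠ 0 :=
    (orderOf_pos_iff.mpr (isOfFinOrder_iff_pow_eq_one.mpr ⟨n, hn, hB⟩)).ne'
  apply MacdonaldPair.isNilpotent_and_finite
    (n := orderOf (macdonaldX α) * orderOf (macdonaldY α)) (mul_ne_zero hA0 hB0) _ h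
    (closure_macdonald α)
  · rw [pow_mul, pow_orderOf_eq_one, one_pow]
  · rw [mul_comm, pow_mul, pow_orderOf_eq_one, one_pow]
  · intro p hp hpn
    rcases (hp.dvd_mul).mp hpn with h' | h'
    · exact h.prime_dvd_sub_one h0 h1 hp h'
    · exact h.swap.prime_dvd_sub_one h0 h1 hp h'


/-! ### Splitting off a Sylow subgroup -/

/-- A finite nilpotent group splits off each of its Sylow subgroups. -/
theorem exists_isSylowProjection {G : Type*} [Group G] [Finite G] (hG : Group.IsNilpotent G)
    {p : ℕ} [hp : Fact p.Prime] (J : Sylow p G) : ∃ π : G →* J, IsSylowProjection J π := by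
  by_cases hpG : p ∈ (Nat.card G).primeFactors
  swap
  · have hcop : (Nat.card G).Coprime p := by
      rw [Nat.coprime_comm, hp.out.coprime_iff_not_dvd]
      intro h
      exact hpG (Nat.mem_primeFactors.mpr ⟨hp.out, h, Nat.card_pos.ne'⟩)
    have hJ : ∀ x : J, (x : G) = 1 := by
      intro x
      obtain ⟨k, hk⟩ := J.isPGroup' x
      have hk' : (x : G) ^ p ^ k = 1 := by exact_mod_cast congrArg Subtype.val hk
      have h1 := orderOf_dvd_of_pow_eq_one hk'
      have h2 := orderOf_dvd_natCard (x : G)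
      exact orderOf_eq_one_iff.mp (Nat.eq_one_of_dvd_coprimes (hcop.pow_right k) h2 h1)
    refine ⟨1, fun x => Subtype.ext (hJ x).symm, fun x g _ => ?_, fun g _ => ?_⟩
    · rw [hJ x]; exact Commute.one_left g
    · exact Nat.Coprime.coprime_dvd_left (orderOf_dvd_natCard g) hcop
  · obtain ⟨φ⟩ := ((Group.isNilpotent_of_finite_tfae (G := G)).out 0 4).mp hG
    have hJn : (J : Subgroup G).Normal := inferInstance
    have hss : ∀ P : Sylow p G, P = J := by
      have := Sylow.unique_of_normal J hJn
      intro P; exact Subsingleton.elim _ _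
    let q₀ : (Nat.card G).primeFactors := ⟨p, hpG⟩
    let ψ := φ.symm
    let c : G →* J := (((Pi.evalMonoidHom (fun P : Sylow p G => P) J).comp
      (Pi.evalMonoidHom
        (fun q : (Nat.card G).primeFactors => ∀ P : Sylow q G, P) q₀)).comp ψ.toMonoidHom)
    have hc : ∀ g, c g = ψ g q₀ J := fun g => rfl
    have hother : ∀ (z : G) (k : ℕ), z ^ p ^ k = 1 → ∀ q : (Nat.card G).primeFactors,
        q ≠ q₀ → ∀ P : Sylow q G, ψ z q P = 1 := by
      intro z k hz q hq P
      have hqp : (q : ℕ) ≠ p := fun h => hq (Subtype.ext h)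
      obtain ⟨j, hj⟩ := P.isPGroup' (ψ z q P)
      have h1 : (ψ z q P) ^ p ^ k = 1 := by
        have : ψ (z ^ p ^ k) q P = 1 := by rw [hz, map_one]; rfl
        rwa [map_pow] at this
      have hq' : (q : ℕ).Prime := Nat.prime_of_mem_primeFactors q.2
      exact orderOf_eq_one_iff.mp (Nat.eq_one_of_dvd_coprimes
        (Nat.Coprime.pow k j ((Nat.coprime_primes hp.out hq').mpr hqp.symm))
        (orderOf_dvd_of_pow_eq_one h1) (orderOf_dvd_of_pow_eq_one hj))
    have hone : ∀ (z : G), c z = 1 → (∀ q : (Nat.card G).primeFactors,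
        q ≠ q₀ → ∀ P : Sylow q G, ψ z q P = 1) → z = 1 := by
      intro z hz h
      apply ψ.injective
      rw [map_one]
      funext q P
      by_cases hq : q = q₀
      · subst hq
        have : P = J := hss P
        subst this
        exact hz
      · exact h q hq P
    have hpow : ∀ x : J, ∃ k, (x : G) ^ p ^ k = 1 := by
      intro x
      obtain ⟨k, hk⟩ := J.isPGroup' x
      exact ⟨k, by exact_mod_cast congrArg Subtype.val hk⟩
    -- The coordinate map `c` is only seen to be injective on `J`, hence to restrict to an
    -- automorphism; composing with the inverse of that automorphism makes it a projection.
    let σ : J →* J := c.comp (J : Subgroup G).subtype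
    have hσ : Function.Injective σ := by
      rw [injective_iff_map_eq_one]
      intro x hx
      obtain ⟨k, hk⟩ := hpow x
      exact Subtype.ext (hone x hx (hother x k hk))
    let e : J ≃* J := MulEquiv.ofBijective σ (Finite.injective_iff_bijective.mp hσ)
    refine ⟨e.symm.toMonoidHom.comp c, ?_, ?_, ?_⟩
    · intro x
      exact e.symm_apply_apply x
    · intro x g hg
      have hg' : c g = 1 := by
        rw [MonoidHom.mem_ker] at hg
        exact e.symm.injective (hg.trans (map_one _).symm)
      obtain ⟨k, hk⟩ := hpow x
      have hx := hother x k hk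
      apply ψ.injective
      rw [map_mul, map_mul]
      funext q P
      by_cases hq : q = q₀
      · subst hq
        have : P = J := hss P
        subst this
        have hg'' : ψ g q₀ P = 1 := hg'
        simp only [Pi.mul_apply, hg'', mul_one, one_mul]
      · simp only [Pi.mul_apply, hx q hq P, mul_one, one_mul]
    · intro g hg
      have hg' : c g = 1 := by
        rw [MonoidHom.mem_ker] at hg
        exact e.symm.injective (hg.trans (map_one _).symm)
      rw [Nat.coprime_comm, hp.out.coprime_iff_not_dvd]
      rintro ⟨d, hd⟩
      have hd0 : d ≠ 0 := by
        rintro rfl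
        rw [mul_zero] at hd
        exact (orderOf_pos g).ne' hd
      have h1 : (g ^ d) ^ p ^ 1 = 1 := by
        rw [pow_one, ← pow_mul, mul_comm, ← hd, pow_orderOf_eq_one]
      have h2 := hone (g ^ d) (by rw [map_pow, hg', one_pow]) (hother _ 1 h1)
      have h3 := Nat.le_of_dvd (Nat.pos_of_ne_zero hd0) (orderOf_dvd_of_pow_eq_one h2)
      rw [hd] at h3
      have := hp.out.two_le
      nlinarith [Nat.pos_of_ne_zero hd0]

namespace IsSylowProjection

variable {G : Type*} [Group G] {p : ℕ} {J : Sylow p G} {π : G →* J}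

theorem surjective (h : IsSylowProjection J π) : Function.Surjective π :=
  fun x => ⟨x, h.map_self x⟩

/-- Homomorphisms out of `G` detect the order of the projection of an element. -/
theorem exists_coprime_pow_eq_one (h : IsSylowProjection J π) {g : G} {k : ℕ}
    (hk : π g ^ k = 1) {X : Type*} [Group X] (f : G →* X) :
    ∃ t : ℕ, t.Coprime p ∧ f g ^ (k * t) = 1 := by
  have hker : g ^ k ∈ π.ker := by rw [MonoidHom.mem_ker, map_pow, hk]
  refine ⟨orderOf (g ^ k), h.coprime_ker _ hker, ?_⟩
  rw [← map_pow, pow_mul, pow_orderOf_eq_one, map_one]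

end IsSylowProjection


/-! ### A permutation model bounding the order of `A` from below -/

namespace MacdonaldModel

/-- Polynomial approximation of `(δ ^ i - 1) / (δ - 1)` for `δ = 1 + 12 ν`. -/
def expo (ν i : ℤ) : ℤ := i + 6 * ν * (i * (i - 1)) + 24 * ν ^ 2 * (i * (i - 1) * (i - 2))

/-- Polynomial approximation of `δ ^ l` for `δ = 1 + 12 ν`. -/
def weight (ν l : ℤ) : ℤ := 1 + 12 * ν * l + 72 * ν ^ 2 * (l * (l - 1))

/-- First coordinate of the `t`-th iterate of the model map; `T`, `S` stand for the binomial
coefficients `t.choose 2`, `t.choose 3`. -/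
def iterI (ν t T S i : ℤ) : ℤ :=
  i + t * (6 * ν * (i * (i - 1)) + 24 * ν ^ 2 * (i * (i - 1) * (i - 2))) +
    T * (36 * ν ^ 2 * ((2 * i - 1) * (i * (i - 1))) + 288 * ν ^ 3 * (i * (i - 1))) +
    S * (216 * ν ^ 3 * (i * (i - 1)))

/-- Increment of the second coordinate of the `t`-th iterate. -/
def iterL (ν t T S i : ℤ) : ℤ :=
  t * i + T * (6 * ν * (i * (i - 1))) + S * (36 * ν ^ 2 * ((2 * i - 1) * (i * (i - 1))))

/-- Normalized decrement of the third coordinate of the `t`-th iterate. -/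
def iterY (ν t T S i : ℤ) : ℤ :=
  t + T * (12 * ν * i + 72 * ν ^ 2 * (i * (i - 1))) +
    S * (72 * ν ^ 2 * (i * (i - 1)) + 144 * ν ^ 2 * i ^ 2)

/-- The binomial coefficients of an integer of either sign, carried as witnesses so that the
coefficients `1 / 2` and `1 / 6` hidden in the polynomials can be handled integrally. -/
theorem exists_choose (i : ℤ) : ∃ u v : ℤ, 2 * u = i * (i - 1) ∧ 3 * v = u * (i - 2) := by
  obtain ⟨u, hu⟩ := (Int.even_mul_pred_self i).two_dvd
  have h3 : (3 : ℤ) ∣ 2 * (u * (i - 2)) := by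
    rw [← mul_assoc, ← hu]
    have : i % 3 = 0 ∨ i % 3 = 1 ∨ i % 3 = 2 := by omega
    rcases this with h | h | h
    · exact ((Int.dvd_of_emod_eq_zero h).mul_right _).mul_right _
    · exact ((by omega : (3 : ℤ) ∣ i - 1).mul_left _).mul_right _
    · exact (by omega : (3 : ℤ) ∣ i - 2).mul_left _
  obtain ⟨v, hv⟩ := (by norm_num : IsCoprime (3 : ℤ) 2).dvd_of_dvd_mul_left h3
  exact ⟨u, v, hu.symm, hv.symm⟩

theorem exists_expo_eq (ν : ℤ) {i u v : ℤ} (hu : 2 * u = i * (i - 1)) (hv : 3 * v = u * (i - 2)) :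
    expo ν i = i + 12 * ν * (u + 12 * ν * v) := by
  unfold expo
  linear_combination (-6 * ν - 24 * ν ^ 2 * (i - 2)) * hu - 48 * ν ^ 2 * hv

/-- Pascal's rule takes `(t, T, S)` to `(t + 1, T + t, S + T)`, so this is the recursion "apply
`expo`, then iterate `t` more times". The next two congruences are its analogues for the other
coordinates. -/
theorem iterI_expo (ν t T S i : ℤ) :
    864 * ν ^ 3 ∣ iterI ν (t + 1) (T + t) (S + T) i - iterI ν t T S (expo ν i) := by
  obtain ⟨u, v, hu, hv⟩ := exists_choose i
  rw [exists_expo_eq ν hu hv]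
  set w := u + 12 * ν * v with hw
  obtain ⟨W₁, f1⟩ : ∃ W, 6 * ν * ((i + 12 * ν * w) * ((i + 12 * ν * w) - 1)) +
      24 * ν ^ 2 * ((i + 12 * ν * w) * ((i + 12 * ν * w) - 1) * ((i + 12 * ν * w) - 2))
      = 12 * ν * w + (72 * ν ^ 2 * ((2 * i - 1) * u) + 576 * ν ^ 3 * u) + 864 * ν ^ 3 * W := by
    refine ⟨(2 * i - 1) * v + w ^ 2 + (i ^ 2 - 2 * i) * w + 8 * ν * v + 12 * ν * (i - 1) * w ^ 2 +
      48 * ν ^ 2 * w ^ 3, ?_⟩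
    rw [hw]
    linear_combination (-6 * ν - 24 * ν ^ 2 * (i - 2)) * hu - 48 * ν ^ 2 * hv
  obtain ⟨W₂, f2⟩ : ∃ W,
      36 * ν ^ 2 * ((2 * (i + 12 * ν * w) - 1) * ((i + 12 * ν * w) * ((i + 12 * ν * w) - 1)))
      + 288 * ν ^ 3 * ((i + 12 * ν * w) * ((i + 12 * ν * w) - 1))
      = (72 * ν ^ 2 * ((2 * i - 1) * u) + 576 * ν ^ 3 * u) + 432 * ν ^ 3 * u + 864 * ν ^ 3 * W := by
    refine ⟨6 * ν * v + w * (6 * u + (6 * i - 3) * 6 * ν * w + 144 * ν ^ 2 * w ^ 2) +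
        4 * ν * w * (2 * i - 1 + 12 * ν * w), ?_⟩
    rw [hw]
    linear_combination (-36 * ν ^ 2 * (2 * i - 1) - 288 * ν ^ 3 -
      2592 * ν ^ 3 * (u + 12 * ν * v)) * hu
  obtain ⟨W₃, f3⟩ : ∃ W, 216 * ν ^ 3 * ((i + 12 * ν * w) * ((i + 12 * ν * w) - 1))
      = 432 * ν ^ 3 * u + 864 * ν ^ 3 * W := by
    refine ⟨3 * ν * w * (2 * i - 1 + 12 * ν * w), ?_⟩
    linear_combination -216 * ν ^ 3 * hu
  have g1 : 6 * ν * (i * (i - 1)) + 24 * ν ^ 2 * (i * (i - 1) * (i - 2)) = 12 * ν * w := by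
    rw [hw]
    linear_combination (-6 * ν - 24 * ν ^ 2 * (i - 2)) * hu - 48 * ν ^ 2 * hv
  have g2 : 36 * ν ^ 2 * ((2 * i - 1) * (i * (i - 1))) + 288 * ν ^ 3 * (i * (i - 1))
      = 72 * ν ^ 2 * ((2 * i - 1) * u) + 576 * ν ^ 3 * u := by
    linear_combination (-36 * ν ^ 2 * (2 * i - 1) - 288 * ν ^ 3) * hu
  have g3 : 216 * ν ^ 3 * (i * (i - 1)) = 432 * ν ^ 3 * u := by
    linear_combination (-216 * ν ^ 3) * hu
  unfold iterI
  rw [f1, f2, f3, g1, g2, g3]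
  exact ⟨-(t * W₁ + T * W₂ + S * W₃), by ring⟩

theorem iterL_expo (ν t T S i : ℤ) :
    144 * ν ^ 2 ∣ iterL ν (t + 1) (T + t) (S + T) i - (i + iterL ν t T S (expo ν i)) := by
  obtain ⟨u, v, hu, hv⟩ := exists_choose i
  rw [exists_expo_eq ν hu hv]
  set w := u + 12 * ν * v with hw
  obtain ⟨W₂, f2⟩ : ∃ W, 6 * ν * ((i + 12 * ν * w) * ((i + 12 * ν * w) - 1))
      = 12 * ν * u + 72 * ν ^ 2 * ((2 * i - 1) * u) + 144 * ν ^ 2 * W := by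
    refine ⟨6 * ν * (2 * i - 1) * v + 6 * ν * w ^ 2, ?_⟩
    rw [hw]
    linear_combination (-6 * ν) * hu
  obtain ⟨W₃, f3⟩ : ∃ W,
      36 * ν ^ 2 * ((2 * (i + 12 * ν * w) - 1) * ((i + 12 * ν * w) * ((i + 12 * ν * w) - 1)))
      = 72 * ν ^ 2 * ((2 * i - 1) * u) + 144 * ν ^ 2 * W := by
    refine ⟨3 * ν * w * (6 * i ^ 2 - 6 * i + 1 + (6 * i - 3) * (12 * ν * w) +
      2 * (12 * ν * w) ^ 2), ?_⟩
    linear_combination (-36 * ν ^ 2 * (2 * i - 1)) * hu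
  have g2 : 6 * ν * (i * (i - 1)) = 12 * ν * u := by linear_combination (-6 * ν) * hu
  have g3 : 36 * ν ^ 2 * ((2 * i - 1) * (i * (i - 1))) = 72 * ν ^ 2 * ((2 * i - 1) * u) := by
    linear_combination (-36 * ν ^ 2 * (2 * i - 1)) * hu
  unfold iterL
  rw [f2, f3, g2, g3, hw]
  exact ⟨-(t * v + T * W₂ + S * W₃), by ring⟩

theorem iterY_expo (ν t T S i : ℤ) :
    864 * ν ^ 3 ∣
      iterY ν (t + 1) (T + t) (S + T) i - (1 + weight ν i * iterY ν t T S (expo ν i)) := by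
  obtain ⟨u, v, hu, hv⟩ := exists_choose i
  rw [exists_expo_eq ν hu hv]
  set w := u + 12 * ν * v with hw
  obtain ⟨W₂, f2⟩ : ∃ W, (1 + 12 * ν * i + 144 * ν ^ 2 * u) * (12 * ν * (i + 12 * ν * w) +
      72 * ν ^ 2 * ((i + 12 * ν * w) * ((i + 12 * ν * w) - 1)))
      = 12 * ν * i + 144 * ν ^ 2 * u + (144 * ν ^ 2 * u + 144 * ν ^ 2 * i ^ 2) +
        864 * ν ^ 3 * W := by
    refine ⟨2 * v + (2 * i - 1) * w + 12 * ν * w ^ 2 + 2 * i * (u + w) +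
      12 * ν * i * ((2 * i - 1) * w + 12 * ν * w ^ 2) +
      2 * u * (i + 12 * ν * u + 12 * ν * w + 72 * ν ^ 2 * ((2 * i - 1) * w + 12 * ν * w ^ 2)), ?_⟩
    rw [hw]
    linear_combination (-72 * ν ^ 2 * (1 + 12 * ν * i + 144 * ν ^ 2 * u)) * hu
  obtain ⟨W₃, f3⟩ : ∃ W, (1 + 12 * ν * i + 144 * ν ^ 2 * u) *
      (72 * ν ^ 2 * ((i + 12 * ν * w) * ((i + 12 * ν * w) - 1)) +
      144 * ν ^ 2 * (i + 12 * ν * w) ^ 2)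
      = (144 * ν ^ 2 * u + 144 * ν ^ 2 * i ^ 2) + 864 * ν ^ 3 * W := by
    refine ⟨(6 * i - 1) * w + 36 * ν * w ^ 2 +
      (i + 12 * ν * u) * (3 * (i + 12 * ν * w) ^ 2 - (i + 12 * ν * w)), ?_⟩
    linear_combination (-72 * ν ^ 2) * hu
  have g0 : weight ν i = 1 + 12 * ν * i + 144 * ν ^ 2 * u := by
    unfold weight; linear_combination (-72 * ν ^ 2) * hu
  have g2 : 12 * ν * i + 72 * ν ^ 2 * (i * (i - 1)) = 12 * ν * i + 144 * ν ^ 2 * u := by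
    linear_combination (-72 * ν ^ 2) * hu
  have g3 : 72 * ν ^ 2 * (i * (i - 1)) + 144 * ν ^ 2 * i ^ 2
      = 144 * ν ^ 2 * u + 144 * ν ^ 2 * i ^ 2 := by
    linear_combination (-72 * ν ^ 2) * hu
  rw [g0]
  unfold iterY
  refine ⟨-(T * W₂ + S * W₃), ?_⟩
  linear_combination (T + t) * g2 + (S + T) * g3 - T * f2 - S * f3

theorem weight_add (ν l i : ℤ) :
    864 * ν ^ 3 ∣ weight ν (l + i) - weight ν l * weight ν i := by
  unfold weight
  exact ⟨-i ^ 2 * l + 2 * i * l - i * l ^ 2 + 6 * ν * (l * (l - 1)) * (i - i ^ 2), by ring⟩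

/-- The recursion of the geometric sum with ratio `δ = 1 + 12 ν`; it is the first coordinate of the
relation `a c d = d a`. -/
theorem expo_add_one (ν i : ℤ) :
    864 * ν ^ 3 ∣ expo ν (i + 1) - (1 + (1 + 12 * ν) * expo ν i) := by
  obtain ⟨u, v, hu, hv⟩ := exists_choose i
  rw [exists_expo_eq ν hu hv]
  unfold expo
  refine ⟨-2 * v, ?_⟩
  linear_combination (-6 * ν - 24 * ν ^ 2 * (i + 1)) * hu - 48 * ν ^ 2 * hv

theorem weight_add_one_mul (ν l Y : ℤ) :
    864 * ν ^ 3 ∣ weight ν (l + 1) * Y - weight ν l * ((1 + 12 * ν) * Y) := by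
  unfold weight
  exact ⟨(l - l ^ 2) * Y, by ring⟩

/-- The three constants are the expansions in `ν` of `α = (1 + 12 ν)⁻¹` and of its binomial
coefficients of orders `2` and `3`. With `iterY_inv` and `iter_inv` this checks the relation `c d =
d ^ α c`. -/
theorem iterL_inv (ν i : ℤ) :
    72 * ν ^ 2 ∣ i - iterL ν (1 - 12 * ν + 144 * ν ^ 2) (-6 * ν + 144 * ν ^ 2)
      (2 * ν - 24 * ν ^ 2) ((1 + 12 * ν) * i) := by
  obtain ⟨u, v, hu, hv⟩ := exists_choose i
  unfold iterL
  refine ⟨u + (-19) * i * ν + (-2) * i ^ 3 * ν + 3 * i ^ 2 * ν +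
    (-180) * i ^ 2 * ν ^ 2 + 144 * i * ν ^ 2 + (-48) * i ^ 3 * ν ^ 2 + (-2160) * i ^ 2 * ν ^ 3 +
    144 * i * ν ^ 3 + 6912 * i ^ 3 * ν ^ 4 + (-5184) * i ^ 2 * ν ^ 4 + 41472 * i ^ 3 * ν ^ 5, ?_⟩
  linear_combination (-36 * ν ^ 2) * hu

theorem iterY_inv (ν i : ℤ) :
    72 * ν ^ 2 ∣ (1 + 12 * ν) * iterY ν (1 - 12 * ν + 144 * ν ^ 2) (-6 * ν + 144 * ν ^ 2)
      (2 * ν - 24 * ν ^ 2) ((1 + 12 * ν) * i) - 1 := by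
  unfold iterY
  refine ⟨-i + 24 * ν + 4 * i * ν + 408 * i * ν ^ 2 + 72 * i ^ 2 * ν ^ 2 +
    1152 * i * ν ^ 3 + 2592 * i ^ 2 * ν ^ 3 + 31104 * i ^ 2 * ν ^ 4 + (-17280) * i * ν ^ 4 +
    124416 * i ^ 2 * ν ^ 5, ?_⟩
  ring

/-- Separately the second and third coordinates agree only modulo `72 ν ^ 2`. The combination of
errors here is the one in the last clause of `modelSetoid`, and it vanishes to higher order. -/
theorem iter_inv (ν i : ℤ) :
    864 * ν ^ 3 ∣ ((1 + 12 * ν) * expo ν i - iterI ν (1 - 12 * ν + 144 * ν ^ 2)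
        (-6 * ν + 144 * ν ^ 2) (2 * ν - 24 * ν ^ 2) ((1 + 12 * ν) * i)) -
      ((1 + 12 * ν) * iterY ν (1 - 12 * ν + 144 * ν ^ 2) (-6 * ν + 144 * ν ^ 2)
        (2 * ν - 24 * ν ^ 2) ((1 + 12 * ν) * i) - 1) -
      6 * ν * (i - iterL ν (1 - 12 * ν + 144 * ν ^ 2) (-6 * ν + 144 * ν ^ 2)
        (2 * ν - 24 * ν ^ 2) ((1 + 12 * ν) * i)) := by
  obtain ⟨u, v, hu, hv⟩ := exists_choose i
  unfold iterL iterY iterI expo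
  refine ⟨-i ^ 2 - 2 + v + u + i + 3 * i ^ 3 * ν + (-18) * i ^ 2 * ν +
    (-17) * i * ν + (-240) * i ^ 3 * ν ^ 2 + (-312) * i * ν ^ 2 + 192 * i ^ 2 * ν ^ 2 +
    (-5472) * i ^ 3 * ν ^ 3 + 2016 * i ^ 2 * ν ^ 3 + 1872 * i * ν ^ 3 + (-31104) * i ^ 3 * ν ^ 4 +
    (-13824) * i ^ 2 * ν ^ 4 + (-20736) * i ^ 3 * ν ^ 5, ?_⟩
  linear_combination (-432 * ν ^ 3 - 144 * ν ^ 3 * (i - 2)) * hu - 288 * ν ^ 3 * hv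

end MacdonaldModel


/-- Permutations `a`, `c`, `d` with the right relations give a Macdonald pair `(a, d⁻¹)`. -/
theorem MacdonaldPair.of_perm {X : Type*} [Group X] {α : ℤ} {a c d : X} (h1 : a * c * d = d * a)
    (h2 : a * c = c * a ^ α) (h3 : c * d = d ^ α * c) : MacdonaldPair α a d⁻¹ := by
  have hc : gcomm a d⁻¹ = c := by
    have : c = a⁻¹ * (a * c * d) * d⁻¹ := by group
    rw [this, h1, gcomm]; group
  constructor
  · rw [hc, mul_assoc, h2]; group
  · rw [hc, inv_zpow]
    have : c * d * c⁻¹ = d ^ α := by rw [h3]; group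
    rw [← this]; group

theorem dvd_of_dvd_of_eq {a b c : ℤ} (h : a ∣ b) (e : c = b) : a ∣ c := e ▸ h

namespace MacdonaldModel

/-- Divisibility conditions on the moduli of the model. -/
structure Moduli (ν Q R : ℤ) : Prop where
  dvd_mul : R ∣ 12 * ν * Q
  dvd_sq : Q ∣ 72 * ν ^ 2
  dvd : Q ∣ R
  dvd_mul_sq : R ∣ 6 * ν * Q ^ 2

/-- The equivalence relation defining the underlying set of the model. -/
def modelSetoid (ν Q R : ℤ) : Setoid (ℤ × ℤ × ℤ) where
  -- The triple `(i, l, j)` stands for `A ^ i C ^ l B ^ j`. The identifications express `A ^ R = 1`,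
  -- `B ^ Q = A ^ (-Q)` and `C ^ Q = A ^ (-6 ν Q)`.
  r v w := Q ∣ v.2.1 - w.2.1 ∧ Q ∣ v.2.2 - w.2.2 ∧
    R ∣ (v.1 - w.1) - (v.2.2 - w.2.2) - 6 * ν * (v.2.1 - w.2.1)
  iseqv := by
    constructor
    · intro v; simp
    · rintro v w ⟨h1, h2, h3⟩
      refine ⟨dvd_sub_comm.mp h1, dvd_sub_comm.mp h2, ?_⟩
      rw [← dvd_neg]; exact dvd_of_dvd_of_eq (h3) (by ring)
    · rintro u v w ⟨h1, h2, h3⟩ ⟨k1, k2, k3⟩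
      refine ⟨?_, ?_, ?_⟩
      · exact dvd_of_dvd_of_eq (dvd_add h1 k1) (by ring)
      · exact dvd_of_dvd_of_eq (dvd_add h2 k2) (by ring)
      · exact dvd_of_dvd_of_eq (dvd_add h3 k3) (by ring)

/-- The underlying set of the model. -/
abbrev Model (ν Q R : ℤ) : Type := Quotient (modelSetoid ν Q R)

variable {ν Q R : ℤ}

theorem mk_eq {v w : ℤ × ℤ × ℤ} (h1 : Q ∣ v.2.1 - w.2.1) (h2 : Q ∣ v.2.2 - w.2.2)
    (h3 : R ∣ (v.1 - w.1) - (v.2.2 - w.2.2) - 6 * ν * (v.2.1 - w.2.1)) :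
    (Quotient.mk (modelSetoid ν Q R) v) = Quotient.mk _ w :=
  Quotient.sound ⟨h1, h2, h3⟩

theorem mk_eq_of_dvd (h : Q ∣ R) {v w : ℤ × ℤ × ℤ} (h1 : R ∣ v.1 - w.1) (h2 : Q ∣ v.2.1 - w.2.1)
    (h2' : R ∣ 6 * ν * (v.2.1 - w.2.1)) (h3 : R ∣ v.2.2 - w.2.2) :
    (Quotient.mk (modelSetoid ν Q R) v) = Quotient.mk _ w :=
  mk_eq h2 (h.trans h3) (dvd_sub (dvd_sub h1 h3) h2')

namespace Moduli

theorem dvd_cube (hM : Moduli ν Q R) : R ∣ 864 * ν ^ 3 := by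
  obtain ⟨k, hk⟩ := hM.dvd_sq
  refine hM.dvd_mul.trans ⟨k, ?_⟩
  linear_combination 12 * ν * hk

/-- The translation of the first coordinate. -/
def shift (_ : Moduli ν Q R) : Equiv.Perm (Model ν Q R) where
  toFun := Quotient.map (fun v => (v.1 + 1, v.2)) (by
    rintro v w ⟨h1, h2, h3⟩
    exact ⟨h1, h2, by simpa using h3⟩)
  invFun := Quotient.map (fun v => (v.1 - 1, v.2)) (by
    rintro v w ⟨h1, h2, h3⟩
    exact ⟨h1, h2, by simpa using h3⟩)
  left_inv := by rintro ⟨v⟩; exact congrArg (Quotient.mk _) (Prod.ext (by simp) rfl)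
  right_inv := by rintro ⟨v⟩; exact congrArg (Quotient.mk _) (Prod.ext (by simp) rfl)

theorem dvd_first (hM : Moduli ν Q R) {v w : ℤ × ℤ × ℤ}
    (h : (modelSetoid ν Q R).r v w) : Q ∣ v.1 - w.1 := by
  obtain ⟨h1, h2, h3⟩ := h
  have := dvd_add (dvd_add (hM.dvd.trans h3) h2) (h1.mul_left (6 * ν))
  exact dvd_of_dvd_of_eq (this) (by ring)

theorem dvd_mul_of_dvd (hM : Moduli ν Q R) {x : ℤ} (hx : Q ∣ x) : R ∣ 12 * ν * x :=
  hM.dvd_mul.trans (mul_dvd_mul_left _ hx)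

/-- The dilation of the first coordinate by `1 + 12 ν`. -/
def dilate (hM : Moduli ν Q R) {α : ℤ} (hα : R ∣ α * (1 + 12 * ν) - 1) :
    Equiv.Perm (Model ν Q R) where
  toFun := Quotient.map (fun v => ((1 + 12 * ν) * v.1, v.2.1 + 1, v.2.2)) (by
    intro v w h
    have h0 := hM.dvd_mul_of_dvd (hM.dvd_first h)
    obtain ⟨h1, h2, h3⟩ := h
    refine ⟨by simpa using h1, h2, ?_⟩
    exact dvd_of_dvd_of_eq (dvd_add h3 h0) (by ring))
  invFun := Quotient.map (fun v => (α * v.1, v.2.1 - 1, v.2.2)) (by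
    intro v w h
    have h0 := hM.dvd_mul_of_dvd (hM.dvd_first h)
    obtain ⟨h1, h2, h3⟩ := h
    refine ⟨by simpa using h1, h2, ?_⟩
    exact dvd_of_dvd_of_eq (dvd_add (dvd_sub h3 (h0.mul_left α)) (hα.mul_right (v.1 - w.1))) (by ring))
  left_inv := by
    rintro ⟨v⟩
    apply mk_eq_of_dvd hM.dvd
    · exact dvd_of_dvd_of_eq (hα.mul_right v.1) (by ring)
    · simp
    · simp
    · simp
  right_inv := by
    rintro ⟨v⟩
    apply mk_eq_of_dvd hM.dvd
    · exact dvd_of_dvd_of_eq (hα.mul_right v.1) (by ring)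
    · simp
    · simp
    · simp

/-- The map underlying the inverse of the second generator. -/
def twist (hM : Moduli ν Q R) : Model ν Q R → Model ν Q R :=
  Quotient.map (fun v => (expo ν v.1, v.2.1 + v.1, v.2.2 - weight ν v.2.1)) (by
    intro v w h
    have h0 := hM.dvd_first h
    obtain ⟨h1, h2, h3⟩ := h
    have hw : R ∣ weight ν v.2.1 - weight ν w.2.1 := by
      have : weight ν v.2.1 - weight ν w.2.1 = 12 * ν * (v.2.1 - w.2.1) *
        (1 + 6 * ν * (v.2.1 + w.2.1 - 1)) := by unfold weight; ring
      rw [this]; exact (hM.dvd_mul_of_dvd h1).mul_right _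
    refine ⟨?_, ?_, ?_⟩
    · exact dvd_of_dvd_of_eq (dvd_add h1 h0) (by ring)
    · exact dvd_of_dvd_of_eq (dvd_sub h2 (hM.dvd.trans hw)) (by ring)
    · obtain ⟨y, hy⟩ := h0
      -- Since `twist` adds `i` to the second coordinate, the last clause is preserved if `expo`
      -- varies like `(1 + 6 ν) i` modulo `R`.
      have he : R ∣ expo ν v.1 - expo ν w.1 - (v.1 - w.1) - 6 * ν * (v.1 - w.1) := by
        have e1 : expo ν v.1 - expo ν w.1 - (v.1 - w.1) - 6 * ν * (v.1 - w.1)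
          = 12 * ν * (v.1 - w.1) * (w.1 - 1 + 2 * ν * (3 * w.1 ^ 2 - 6 * w.1 + 2 +
            (3 * w.1 - 3) * (v.1 - w.1) + (v.1 - w.1) ^ 2)) + 6 * ν * Q ^ 2 * y ^ 2 := by
          have : v.1 = w.1 + Q * y := by linarith
          unfold expo; rw [this]; ring
        rw [e1]
        exact dvd_add ((hM.dvd_mul_of_dvd ⟨y, hy⟩).mul_right _) (hM.dvd_mul_sq.mul_right _)
      exact dvd_of_dvd_of_eq (dvd_add (dvd_add h3 he) hw) (by ring))

theorem twist_mk (hM : Moduli ν Q R) (v : ℤ × ℤ × ℤ) :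
    hM.twist (Quotient.mk _ v) = Quotient.mk _ (expo ν v.1, v.2.1 + v.1, v.2.2 - weight ν v.2.1) :=
  rfl

theorem twist_iterate (hM : Moduli ν Q R) (t : ℕ) (v : ℤ × ℤ × ℤ) :
    hM.twist^[t] (Quotient.mk _ v) = Quotient.mk _
      (iterI ν t (t.choose 2) (t.choose 3) v.1,
        v.2.1 + iterL ν t (t.choose 2) (t.choose 3) v.1,
        v.2.2 - weight ν v.2.1 * iterY ν t (t.choose 2) (t.choose 3) v.1) := by
  induction t generalizing v with
  | zero => simp [iterI, iterL, iterY]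
  | succ t ih =>
    rw [Function.iterate_succ_apply, twist_mk, ih]
    have h2 : (((t + 1).choose 2 : ℕ) : ℤ) = (t.choose 2 : ℕ) + t := by
      rw [Nat.choose_succ_succ' t 1]; push_cast; simp; ring
    have h3 : (((t + 1).choose 3 : ℕ) : ℤ) = (t.choose 3 : ℕ) + (t.choose 2 : ℕ) := by
      rw [Nat.choose_succ_succ' t 2]; push_cast; ring
    rw [h2, h3]
    push_cast
    generalize ((t.choose 2 : ℕ) : ℤ) = T
    generalize ((t.choose 3 : ℕ) : ℤ) = S
    generalize (t : ℤ) = t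
    obtain ⟨i, l, j⟩ := v
    have hL := dvd_sub_comm.mp (iterL_expo ν t T S i)
    apply mk_eq_of_dvd hM.dvd
    · exact dvd_sub_comm.mp (hM.dvd_cube.trans (iterI_expo ν t T S i))
    · have h72 : Q ∣ 144 * ν ^ 2 := hM.dvd_sq.trans ⟨2, by ring⟩
      exact dvd_of_dvd_of_eq (h72.trans hL) (by ring)
    · have h864 : R ∣ 6 * ν * (144 * ν ^ 2) := dvd_of_dvd_of_eq hM.dvd_cube (by ring)
      exact dvd_of_dvd_of_eq (h864.trans (mul_dvd_mul_left _ hL)) (by ring)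
    · have hY := (hM.dvd_cube.trans (iterY_expo ν t T S i)).mul_left (weight ν l)
      have hW := (hM.dvd_cube.trans (weight_add ν l i)).mul_right (iterY ν t T S (expo ν i))
      exact dvd_of_dvd_of_eq (dvd_sub hY hW) (by ring)

/-- A power of `twist` is the identity. -/
theorem twist_iterate_eq_id (hM : Moduli ν Q R) {n : ℕ} (h1 : R ∣ n) (h2 : R ∣ (n.choose 2 : ℕ))
    (h3 : R ∣ (n.choose 3 : ℕ)) : hM.twist^[n] = id := by
  funext x
  obtain ⟨v, rfl⟩ := Quotient.exists_rep x
  refine (hM.twist_iterate n v).trans ?_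
  have hL : R ∣ iterL ν n (n.choose 2 : ℕ) (n.choose 3 : ℕ) v.1 :=
    dvd_add (dvd_add (h1.mul_right _) (h2.mul_right _)) (h3.mul_right _)
  have hY : R ∣ iterY ν n (n.choose 2 : ℕ) (n.choose 3 : ℕ) v.1 :=
    dvd_add (dvd_add h1 (h2.mul_right _)) (h3.mul_right _)
  apply mk_eq_of_dvd hM.dvd
  · have : R ∣ _ := dvd_add (dvd_add (h1.mul_right (6 * ν * (v.1 * (v.1 - 1)) +
        24 * ν ^ 2 * (v.1 * (v.1 - 1) * (v.1 - 2)))) (h2.mul_right (36 * ν ^ 2 *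
        ((2 * v.1 - 1) * (v.1 * (v.1 - 1))) + 288 * ν ^ 3 * (v.1 * (v.1 - 1)))))
        (h3.mul_right (216 * ν ^ 3 * (v.1 * (v.1 - 1))))
    exact dvd_of_dvd_of_eq this (by unfold iterI; ring)
  · exact dvd_of_dvd_of_eq (hM.dvd.trans hL) (by ring)
  · exact dvd_of_dvd_of_eq (hL.mul_left (6 * ν)) (by ring)
  · exact dvd_of_dvd_of_eq (hY.mul_left (-weight ν v.2.1)) (by ring)

/-- The inverse of the second generator, as a permutation. -/
def twistPerm (hM : Moduli ν Q R) {n : ℕ} (hn : n ≠ 0) (h : hM.twist^[n] = id) :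
    Equiv.Perm (Model ν Q R) where
  toFun := hM.twist
  invFun := hM.twist^[n - 1]
  left_inv x := by
    rw [← Function.iterate_succ_apply, Nat.succ_eq_add_one, Nat.sub_add_cancel (by omega), h]; rfl
  right_inv x := by
    rw [← Function.iterate_succ_apply' hM.twist, Nat.succ_eq_add_one,
      Nat.sub_add_cancel (by omega), h]
    rfl

theorem twistPerm_pow (hM : Moduli ν Q R) {n : ℕ} (hn : n ≠ 0) (h : hM.twist^[n] = id) (t : ℕ)
    (x : Model ν Q R) : (hM.twistPerm hn h ^ t) x = hM.twist^[t] x := by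
  rw [← Equiv.Perm.iterate_eq_pow]; rfl

theorem shift_pow (hM : Moduli ν Q R) (t : ℕ) (v : ℤ × ℤ × ℤ) :
    (hM.shift ^ t) (Quotient.mk _ v) = Quotient.mk _ (v.1 + t, v.2) := by
  induction t generalizing v with
  | zero => simp
  | succ t ih =>
    rw [pow_succ, Equiv.Perm.mul_apply]
    refine (ih (v.1 + 1, v.2)).trans ?_
    congr 2
    push_cast; ring

/-- A Macdonald pair whose first element has order at least `R`. -/
theorem exists_macdonaldPair (hM : Moduli ν Q R) {α : ℕ} (hα : R ∣ α * (1 + 12 * ν) - 1)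
    (hα2 : R ∣ (α.choose 2 : ℕ) - (-6 * ν + 144 * ν ^ 2))
    (hα3 : R ∣ (α.choose 3 : ℕ) - (2 * ν - 24 * ν ^ 2))
    {n : ℕ} (hn : n ≠ 0) (h1 : R ∣ n) (h2 : R ∣ (n.choose 2 : ℕ)) (h3 : R ∣ (n.choose 3 : ℕ)) :
    ∃ A B : Equiv.Perm (Model ν Q R), MacdonaldPair α A B ∧ A ^ n = 1 ∧ B ^ n = 1 ∧
      ∀ k : ℕ, A ^ k = 1 → R ∣ k := by
  have hid := hM.twist_iterate_eq_id h1 h2 h3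
  refine ⟨hM.shift, (hM.twistPerm hn hid)⁻¹, MacdonaldPair.of_perm (c := hM.dilate hα) ?_ ?_ ?_,
    ?_, ?_, ?_⟩
  · ext ⟨v⟩
    refine mk_eq_of_dvd hM.dvd (v := ((1 + 12 * ν) * expo ν v.1 + 1, v.2.1 + v.1 + 1,
      v.2.2 - weight ν v.2.1)) (w := (expo ν (v.1 + 1), v.2.1 + (v.1 + 1),
      v.2.2 - weight ν v.2.1)) ?_ ?_ ?_ ?_
    · exact dvd_of_dvd_of_eq ((hM.dvd_cube.trans (expo_add_one ν v.1)).neg_right) (by ring)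
    · exact ⟨0, by ring⟩
    · exact ⟨0, by ring⟩
    · exact ⟨0, by ring⟩
  · ext ⟨v⟩
    rw [zpow_natCast]
    refine Eq.trans ?_ (congrArg (hM.dilate hα) (hM.shift_pow α v).symm)
    refine mk_eq_of_dvd hM.dvd (v := ((1 + 12 * ν) * v.1 + 1, v.2.1 + 1, v.2.2))
      (w := ((1 + 12 * ν) * (v.1 + α), v.2.1 + 1, v.2.2)) ?_ ?_ ?_ ?_
    · exact dvd_of_dvd_of_eq hα.neg_right (by ring)
    · exact ⟨0, by ring⟩
    · exact ⟨0, by ring⟩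
    · exact ⟨0, by ring⟩
  · ext ⟨v⟩
    obtain ⟨i, l, j⟩ := v
    rw [zpow_natCast]
    refine Eq.trans ?_ (hM.twistPerm_pow hn hid α _).symm
    refine Eq.trans ?_ (hM.twist_iterate α ((1 + 12 * ν) * i, l + 1, j)).symm
    -- `R` divides `1728 ν ^ 3 = (12 ν) ^ 3`, so the inverse of `1 + 12 ν` modulo `R` is its
    -- expansion to second order.
    have hα1 : R ∣ α - (1 - 12 * ν + 144 * ν ^ 2) := by
      have := dvd_sub (hα.mul_right (1 - 12 * ν + 144 * ν ^ 2))
        ((hM.dvd_cube.mul_right (2 * α : ℤ)))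
      exact dvd_of_dvd_of_eq this (by ring)
    generalize ((α.choose 2 : ℕ) : ℤ) = T at *
    generalize ((α.choose 3 : ℕ) : ℤ) = S at *
    generalize (α : ℤ) = α at *
    obtain ⟨x, hx⟩ := hα1
    obtain ⟨y, hy⟩ := hα2
    obtain ⟨z, hz⟩ := hα3
    have hx' : α = (1 - 12 * ν + 144 * ν ^ 2) + R * x := by linarith
    have hy' : T = (-6 * ν + 144 * ν ^ 2) + R * y := by linarith
    have hz' : S = (2 * ν - 24 * ν ^ 2) + R * z := by linarith
    set p := (1 + 12 * ν) * i
    have dI : R ∣ iterI ν α T S p - iterI ν (1 - 12 * ν + 144 * ν ^ 2) (-6 * ν + 144 * ν ^ 2)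
      (2 * ν - 24 * ν ^ 2) p := by
      rw [hx', hy', hz']; unfold iterI
      exact ⟨x * (6 * ν * (p * (p - 1)) + 24 * ν ^ 2 * (p * (p - 1) * (p - 2))) +
        y * (36 * ν ^ 2 * ((2 * p - 1) * (p * (p - 1))) + 288 * ν ^ 3 * (p * (p - 1))) +
        z * (216 * ν ^ 3 * (p * (p - 1))), by ring⟩
    have dL : R ∣ iterL ν α T S p - iterL ν (1 - 12 * ν + 144 * ν ^ 2) (-6 * ν + 144 * ν ^ 2)
      (2 * ν - 24 * ν ^ 2) p := by
      rw [hx', hy', hz']; unfold iterL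
      exact ⟨x * p + y * (6 * ν * (p * (p - 1))) +
        z * (36 * ν ^ 2 * ((2 * p - 1) * (p * (p - 1)))), by ring⟩
    have dY : R ∣ iterY ν α T S p - iterY ν (1 - 12 * ν + 144 * ν ^ 2) (-6 * ν + 144 * ν ^ 2)
      (2 * ν - 24 * ν ^ 2) p := by
      rw [hx', hy', hz']; unfold iterY
      exact ⟨x + y * (12 * ν * p + 72 * ν ^ 2 * (p * (p - 1))) +
        z * (72 * ν ^ 2 * (p * (p - 1)) + 144 * ν ^ 2 * p ^ 2), by ring⟩
    have kL := iterL_inv ν i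
    have kY := iterY_inv ν i
    have kI := hM.dvd_cube.trans (iter_inv ν i)
    have kW := hM.dvd_cube.trans (weight_add_one_mul ν l (iterY ν α T S p))
    generalize iterL ν (1 - 12 * ν + 144 * ν ^ 2) (-6 * ν + 144 * ν ^ 2)
      (2 * ν - 24 * ν ^ 2) p = L₀ at *
    generalize iterI ν (1 - 12 * ν + 144 * ν ^ 2) (-6 * ν + 144 * ν ^ 2)
      (2 * ν - 24 * ν ^ 2) p = I₀ at *
    generalize iterY ν (1 - 12 * ν + 144 * ν ^ 2) (-6 * ν + 144 * ν ^ 2)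
      (2 * ν - 24 * ν ^ 2) p = Y₀ at *
    generalize iterL ν α T S p = L at *
    generalize iterI ν α T S p = I at *
    generalize iterY ν α T S p = Y at *
    have hwY : R ∣ (weight ν l - 1) * ((1 + 12 * ν) * Y₀ - 1) := by
      obtain ⟨k, hk⟩ := kY
      refine hM.dvd_cube.trans ⟨(l + 6 * ν * (l * (l - 1))) * k, ?_⟩
      rw [hk]; unfold weight; ring
    refine mk_eq (v := ((1 + 12 * ν) * expo ν i, l + i + 1, j - weight ν l))
      (w := (I, l + 1 + L, j - weight ν (l + 1) * Y)) ?_ ?_ ?_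
    · exact dvd_of_dvd_of_eq (dvd_sub (hM.dvd_sq.trans kL) (hM.dvd.trans dL)) (by ring)
    · exact dvd_of_dvd_of_eq (dvd_add (dvd_add (hM.dvd.trans kW)
        ((hM.dvd_sq.trans kY).mul_left (weight ν l)))
        ((hM.dvd.trans dY).mul_left (weight ν l * (1 + 12 * ν)))) (by ring)
    · exact dvd_of_dvd_of_eq (dvd_sub (dvd_sub (dvd_sub (dvd_add (dvd_sub kI dI)
        (dL.mul_left (6 * ν))) kW) (dY.mul_left (weight ν l * (1 + 12 * ν)))) hwY) (by ring)
  · ext ⟨v⟩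
    refine (hM.shift_pow n v).trans (mk_eq_of_dvd hM.dvd ?_ ?_ ?_ ?_)
    · exact dvd_of_dvd_of_eq h1 (by ring)
    · exact ⟨0, by ring⟩
    · exact ⟨0, by ring⟩
    · exact ⟨0, by ring⟩
  · rw [inv_pow, inv_eq_one]
    ext x
    rw [hM.twistPerm_pow, hid]; rfl
  · intro k hk
    -- The base point `(0, 0, 0)` is identified with `(k, 0, 0)` only when `R ∣ k`.
    have := hM.shift_pow k (0, 0, 0)
    rw [hk] at this
    have h4 := (Quotient.exact this).2.2
    exact dvd_of_dvd_of_eq h4.neg_right (by simp)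

end Moduli

end MacdonaldModel


/-! ### Choice of the parameters of the model -/

/-- Dividing by a small prime loses at most one power of `p`. -/
theorem Nat.Prime.pow_dvd_of_pow_succ_dvd_mul {p q : ℕ} (hp : p.Prime) (hq : q.Prime) {t : ℕ}
    {x : ℤ} (h : (p : ℤ) ^ (t + 1) ∣ q * x) : (p : ℤ) ^ t ∣ x := by
  by_cases hpq : p = q
  · subst hpq
    rw [pow_succ, mul_comm] at h
    exact Int.dvd_of_mul_dvd_mul_left (by exact_mod_cast hp.ne_zero) h
  · have : IsCoprime ((p : ℤ) ^ (t + 1)) q := by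
      apply IsCoprime.pow_left
      exact Nat.isCoprime_iff_coprime.mpr ((Nat.coprime_primes hp hq).mpr hpq)
    exact (pow_dvd_pow _ (Nat.le_succ t)).trans (this.dvd_of_dvd_mul_left h)

theorem Nat.Prime.pow_dvd_of_pow_dvd_two_mul {p : ℕ} (hp : p.Prime) {t e : ℕ}
    (he : p = 2 → 1 ≤ e) {x : ℤ} (h : (p : ℤ) ^ (t + e) ∣ 2 * x) : (p : ℤ) ^ t ∣ x := by
  by_cases hpq : p = 2
  · exact hp.pow_dvd_of_pow_succ_dvd_mul Nat.prime_two
      ((pow_dvd_pow _ (by have := he hpq; omega)).trans h)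
  · have : IsCoprime ((p : ℤ) ^ (t + e)) ((2 : ℕ) : ℤ) := by
      apply IsCoprime.pow_left
      exact Nat.isCoprime_iff_coprime.mpr ((Nat.coprime_primes hp Nat.prime_two).mpr hpq)
    exact (pow_dvd_pow _ (by omega)).trans (this.dvd_of_dvd_mul_left h)

/-- From `q * n.choose q = n * (n - 1).choose (q - 1)` with `n = p ^ (s + 1)`; dividing by the prime
`q` costs at most one factor `p`. -/
theorem Nat.Prime.pow_dvd_choose {p q : ℕ} (hp : p.Prime) (hq : q.Prime) (s : ℕ) :
    (p : ℤ) ^ s ∣ ((p ^ (s + 1)).choose q : ℕ) := by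
  apply hp.pow_dvd_of_pow_succ_dvd_mul hq
  obtain ⟨k, rfl⟩ : ∃ k, q = k + 1 := ⟨q - 1, by have := hq.pos; omega⟩
  obtain ⟨n, hn⟩ : ∃ n, p ^ (s + 1) = n + 1 :=
    ⟨p ^ (s + 1) - 1, by have := pow_pos hp.pos (s + 1); omega⟩
  have := Nat.add_one_mul_choose_eq n k
  rw [hn]
  refine ⟨(n.choose k : ℕ), ?_⟩
  have h2 : ((p : ℤ)) ^ (s + 1) = (n : ℤ) + 1 := by exact_mod_cast hn
  rw [h2]
  have h3 : ((n : ℤ) + 1) * (n.choose k : ℕ) = ((n + 1).choose (k + 1) : ℕ) * ((k : ℤ) + 1) := by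
    exact_mod_cast this
  rw [h3]; push_cast; ring

theorem Nat.cast_choose_three_mul (n : ℕ) :
    6 * ((n.choose 3 : ℕ) : ℤ) = n * (n - 1) * (n - 2) := by
  induction n with
  | zero => simp
  | succ n ih =>
    have h2 : 2 * ((n.choose 2 : ℕ) : ℤ) = n * (n - 1) := by
      clear ih
      induction n with
      | zero => simp
      | succ n ih => rw [Nat.choose_succ_succ' n 1]; push_cast; simp; linarith
    rw [Nat.choose_succ_succ' n 2]; push_cast; linarith

theorem Nat.cast_choose_two_mul (n : ℕ) : 2 * ((n.choose 2 : ℕ) : ℤ) = n * (n - 1) := by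
  induction n with
  | zero => simp
  | succ n ih => rw [Nat.choose_succ_succ' n 1]; push_cast; simp; linarith

theorem isCoprime_one_add_twelve_mul (ν : ℤ) : IsCoprime (1 + 12 * ν) 12 :=
  ⟨1, -ν, by ring⟩

/-- There is a Macdonald pair whose first element has order divisible by `p ^ (3 * m - e)`. -/
theorem exists_macdonaldPair_pow_dvd {p m e : ℕ} (hp : p.Prime) {α : ℤ} (hm : 1 ≤ m)
    (he : e ≤ 1) (he2 : p = 2 → e = 1 ∧ 2 ≤ m) (h : (p : ℤ) ^ m ∣ α - 1) :
    ∃ (X : Type) (_ : Group X) (A B : X), MacdonaldPair α A B ∧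
      ∀ k : ℕ, A ^ k = 1 → (p : ℤ) ^ (3 * m - e) ∣ k := by
  set s := 3 * m - e with hs
  have hαp : IsCoprime α ((p : ℤ) ^ (s + 1)) := by
    apply IsCoprime.pow_right
    obtain ⟨k, hk⟩ := (dvd_pow_self (p : ℤ) (by omega : m ≠ 0)).trans h
    exact ⟨1, -k, by linarith⟩
  obtain ⟨γ, u, hγ⟩ := hαp
  -- `γ` is an inverse of `α`
  have hγm : (p : ℤ) ^ m ∣ γ - 1 := by
    have h1 : (p : ℤ) ^ m ∣ p ^ (s + 1) := pow_dvd_pow _ (by omega)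
    exact dvd_of_dvd_of_eq (dvd_sub ((h1.mul_left u).neg_right) (h.mul_left γ))
      (by linear_combination hγ)
  -- Solvable because `gcd (12, p ^ (s + 1))` divides `γ - 1`. For `p = 2` this gcd divides `4`,
  -- which is why `m ≥ 2` is required there.
  obtain ⟨ν, hν⟩ : ∃ ν : ℤ, (p : ℤ) ^ (s + 1) ∣ 12 * ν - (γ - 1) := by
    have hg : ((Int.gcd 12 ((p : ℤ) ^ (s + 1)) : ℕ) : ℤ) ∣ γ - 1 := by
      by_cases h2 : p = 2
      · refine Dvd.dvd.trans ?_ hγm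
        have h4 : (Int.gcd 12 ((p : ℤ) ^ (s + 1)) : ℤ) ∣ 4 := by
          have hc : IsCoprime ((Int.gcd 12 ((p : ℤ) ^ (s + 1)) : ℕ) : ℤ) 3 := by
            refine IsCoprime.of_isCoprime_of_dvd_left (IsCoprime.pow_left ?_) (Int.gcd_dvd_right _ _)
            rw [h2]; norm_num
          exact hc.dvd_of_dvd_mul_left (dvd_of_dvd_of_eq (Int.gcd_dvd_left _ _) (by norm_num))
        refine h4.trans ?_
        rw [h2]
        exact dvd_of_dvd_of_eq (pow_dvd_pow 2 (he2 h2).2) rfl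
      · have hc4 : IsCoprime ((Int.gcd 12 ((p : ℤ) ^ (s + 1)) : ℕ) : ℤ) 4 := by
          refine IsCoprime.of_isCoprime_of_dvd_left (IsCoprime.pow_left ?_) (Int.gcd_dvd_right _ _)
          have : IsCoprime (p : ℤ) ((2 : ℕ) : ℤ) :=
            Nat.isCoprime_iff_coprime.mpr ((Nat.coprime_primes hp Nat.prime_two).mpr h2)
          have := this.pow_right (n := 2)
          norm_num at this; exact this
        have h3 : (Int.gcd 12 ((p : ℤ) ^ (s + 1)) : ℤ) ∣ 3 :=
          hc4.dvd_of_dvd_mul_left (dvd_of_dvd_of_eq (Int.gcd_dvd_left _ _) (by norm_num))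
        by_cases h3p : p = 3
        · refine h3.trans (Dvd.dvd.trans ?_ hγm)
          rw [h3p]; exact dvd_pow_self _ (by omega)
        · have hc3 : IsCoprime ((Int.gcd 12 ((p : ℤ) ^ (s + 1)) : ℕ) : ℤ) 3 := by
            refine IsCoprime.of_isCoprime_of_dvd_left (IsCoprime.pow_left ?_)
              (Int.gcd_dvd_right _ _)
            exact Nat.isCoprime_iff_coprime.mpr ((Nat.coprime_primes hp Nat.prime_three).mpr h3p)
          exact (hc3.isUnit_of_dvd' dvd_rfl h3).dvd
    obtain ⟨k, hk⟩ := hg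
    refine ⟨Int.gcdA 12 ((p : ℤ) ^ (s + 1)) * k, -(Int.gcdB 12 ((p : ℤ) ^ (s + 1)) * k), ?_⟩
    have := Int.gcd_eq_gcd_ab 12 ((p : ℤ) ^ (s + 1))
    rw [hk, this]; ring
  have hm12 : (p : ℤ) ^ m ∣ 12 * ν := by
    have h1 : (p : ℤ) ^ m ∣ p ^ (s + 1) := pow_dvd_pow _ (by omega)
    exact dvd_of_dvd_of_eq (dvd_add (h1.trans hν) hγm) (by ring)
  -- the natural number `a` replacing `α`
  have hcop : IsCoprime (1 + 12 * ν) (12 * (p : ℤ) ^ (s + 1)) := by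
    refine (isCoprime_one_add_twelve_mul ν).mul_right (IsCoprime.pow_right ?_)
    obtain ⟨k, hk⟩ := (dvd_pow_self (p : ℤ) (by omega : m ≠ 0)).trans hm12
    exact ⟨1, -k, by linarith⟩
  obtain ⟨b, c, hbc⟩ := hcop
  have hN : (0 : ℤ) < 12 * (p : ℤ) ^ (s + 1) := by have := hp.pos; positivity
  -- `a` inverts `1 + 12 ν` modulo `12 p ^ (s + 1)` and not just modulo `p ^ (s + 1)`, so that `a -
  -- 1` is explicitly a multiple of `12` and the denominators `2` and `6` of the binomial
  -- coefficients cancel exactly.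
  set N : ℤ := 12 * (p : ℤ) ^ (s + 1) with hNdef
  obtain ⟨a, ha⟩ : ∃ a : ℕ, (a : ℤ) = b % N :=
    ⟨(b % N).toNat, Int.toNat_of_nonneg (Int.emod_nonneg _ hN.ne')⟩
  obtain ⟨z, hz⟩ : ∃ z, (a : ℤ) * (1 + 12 * ν) = 1 + N * z := by
    have := Int.emod_add_mul_ediv b N
    exact ⟨-c - b / N * (1 + 12 * ν), by rw [ha]; linear_combination hbc + (1 + 12 * ν) * this⟩
  set P : ℤ := (p : ℤ) ^ (s + 1) with hP
  have haα : P ∣ (a : ℤ) - α := by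
    obtain ⟨k, hk⟩ := hν
    have : 12 * ν = γ - 1 + P * k := by linarith
    exact ⟨12 * z * α - a * k * α + a * u, by
      linear_combination α * hz - a * hγ - a * α * this + α * z * hNdef⟩
  have hRP : (p : ℤ) ^ s ∣ P := pow_dvd_pow _ (by omega)
  have h144 : (p : ℤ) ^ (2 * m) ∣ 2 * (72 * ν ^ 2) := by
    have := pow_dvd_pow_of_dvd hm12 2
    rw [← pow_mul, mul_comm] at this
    exact dvd_of_dvd_of_eq this (by ring)
  have hM : MacdonaldModel.Moduli ν ((p : ℤ) ^ (2 * m - e)) ((p : ℤ) ^ s) := by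
    refine ⟨?_, ?_, pow_dvd_pow _ (by omega), ?_⟩
    · have := mul_dvd_mul hm12 (dvd_refl ((p : ℤ) ^ (2 * m - e)))
      rw [← pow_add] at this
      rwa [show s = m + (2 * m - e) by omega]
    · refine hp.pow_dvd_of_pow_dvd_two_mul (e := e) (fun h => (he2 h).1.ge) ?_
      rwa [show 2 * m - e + e = 2 * m by omega]
    · refine hp.pow_dvd_of_pow_dvd_two_mul (e := e) (fun h => (he2 h).1.ge) ?_
      have := mul_dvd_mul hm12 (dvd_refl (((p : ℤ) ^ (2 * m - e)) ^ 2))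
      rw [← pow_mul, ← pow_add] at this
      refine (pow_dvd_pow _ ?_).trans (dvd_of_dvd_of_eq this (by ring))
      rcases Nat.lt_or_ge e 1 with h | h <;> omega
  obtain ⟨k864, hk864⟩ := hM.dvd_cube
  have ha1 : (p : ℤ) ^ s ∣ a * (1 + 12 * ν) - 1 := by
    rw [hz]; exact (hRP.mul_left (12 * z)).trans ⟨1, by rw [hNdef]; ring⟩
  obtain ⟨x, hx⟩ : (p : ℤ) ^ s ∣ a - (1 - 12 * ν + 144 * ν ^ 2) := by
    exact dvd_of_dvd_of_eq (dvd_sub (ha1.mul_right (1 - 12 * ν + 144 * ν ^ 2))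
      (hM.dvd_cube.mul_right (2 * a))) (by ring)
  have hx' : (a : ℤ) = (1 - 12 * ν + 144 * ν ^ 2) + p ^ s * x := by linarith
  obtain ⟨A, B, hAB, hA, hB, hord⟩ := hM.exists_macdonaldPair (α := a) ha1 (by
      have h1 : ((a.choose 2 : ℕ) : ℤ) = -6 * ν * a ^ 2 + P * (6 * a * z) := by
        have := Nat.cast_choose_two_mul a
        have h2 : (2 : ℤ) ≠ 0 := two_ne_zero
        apply mul_left_cancel₀ h2
        rw [this]; linear_combination a * hz + a * z * hNdef
      rw [h1]
      have h3 : (p : ℤ) ^ s ∣ -6 * ν * a ^ 2 - (-6 * ν + 144 * ν ^ 2) := by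
        refine ⟨-3 * k864 + 2 * k864 * 12 * ν - k864 * 144 * ν ^ 2 - 6 * ν * x * (2 * (1 - 12 * ν + 144 * ν ^ 2) + p ^ s * x), ?_⟩
        rw [hx']; linear_combination (-3 + 24 * ν - 144 * ν ^ 2) * hk864
      exact dvd_of_dvd_of_eq (dvd_add h3 (hRP.mul_right (6 * a * z))) (by ring)) (by
      have h1 : ((a.choose 3 : ℕ) : ℤ) = -2 * ν * a ^ 2 * (a - 2) + P * (2 * a * (a - 2) * z) := by
        have := Nat.cast_choose_three_mul a
        have h2 : (6 : ℤ) ≠ 0 := by norm_num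
        apply mul_left_cancel₀ h2
        rw [this]; linear_combination a * (a - 2) * hz + a * (a - 2) * z * hNdef
      rw [h1]
      set w := 1 - 12 * ν + 144 * ν ^ 2 with hw
      have h4 : (p : ℤ) ^ s ∣ -2 * ν * w ^ 2 * (w - 2) - (2 * ν - 24 * ν ^ 2) := by
        refine hM.dvd_cube.trans ⟨4 * ν * (3 - 48 * ν + 432 * ν ^ 2 - 1728 * ν ^ 3), ?_⟩
        rw [hw]; ring
      have h3 : (p : ℤ) ^ s ∣ -2 * ν * a ^ 2 * (a - 2) - -2 * ν * w ^ 2 * (w - 2) := by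
        rw [hx']
        exact ⟨-2 * ν * (2 * w * x * (w - 2) + p ^ s * x ^ 2 * (w - 2) + (w + p ^ s * x) ^ 2 * x),
          by ring⟩
      exact dvd_of_dvd_of_eq (dvd_add (dvd_add h3 h4) (hRP.mul_right (2 * a * (a - 2) * z)))
        (by ring))
    (n := p ^ (s + 1)) (pow_ne_zero _ hp.ne_zero) (by push_cast; exact hRP)
    (hp.pow_dvd_choose Nat.prime_two s) (hp.pow_dvd_choose Nat.prime_three s)
  refine ⟨_, _, A, B, hAB.congr_exponent (n := P) ?_ ?_ (dvd_sub_comm.mp haα), hord⟩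
  · rw [hP]; exact_mod_cast hA
  · rw [hP]; exact_mod_cast hB


/-! ### A finite model of exponent 81 for Case 3 -/

namespace ExceptionalModel

/-- The function `(δ ^ x - 1) / (δ - 1)` modulo `27`, for `δ = ε + 1`. -/
def next (ε x : ℕ) : ℕ := ((ε + 1) ^ x - 1) / ε % 27

/-- The function `(δ ^ x - 1) / (δ - 1) - x` modulo `81`, for `δ = ε + 1`. -/
def incr (ε x : ℕ) : ℕ := (((ε + 1) ^ x - 1) / ε + 81 - x) % 81

/-- First coordinate of the `t`-th iterate of the model map. -/
def iterX (ε t : ℕ) : ℕ → ℕ := Nat.rec (fun x => x) (fun _ ih x => ih (next ε x)) t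

/-- Increment of the second coordinate of the `t`-th iterate. -/
def iterL (ε t : ℕ) : ℕ → ℕ := Nat.rec (fun _ => 0) (fun _ ih x => (x + ih (next ε x)) % 27) t

/-- Increment of the third coordinate of the `t`-th iterate, first part. -/
def iterF (ε t : ℕ) : ℕ → ℕ :=
  Nat.rec (fun _ => 0) (fun _ ih x => (incr ε x + ih (next ε x)) % 81) t

/-- Increment of the third coordinate of the `t`-th iterate, second part. -/
def iterY (ε t : ℕ) : ℕ → ℕ :=
  Nat.rec (fun _ => 0) (fun _ ih x => (1 + (ε + 1) ^ x * ih (next ε x)) % 81) t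

/-- The numerical conditions at `x` which make the model work. -/
def Admissible (a ε x : ℕ) : Prop :=
  (a * (ε + 1) % 81 = 1 ∧ (ε + 1) ^ 27 % 81 = 1 ∧ ε % 3 = 0) ∧
  (iterX ε a ((ε + 1) * x % 27) = (ε + 1) * next ε x % 27 ∧
    iterL ε a ((ε + 1) * x % 27) = x ∧
    3 * ((ε + 1) * iterY ε a ((ε + 1) * x % 27)) % 81 = 3 ∧
    (ε * x + iterF ε a ((ε + 1) * x % 27) + (ε + 1) * iterY ε a ((ε + 1) * x % 27)) % 81 =
      (incr ε x + 1 + ε * next ε x) % 81) ∧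
  (iterX ε 81 x = x ∧ iterL ε 81 x = 0 ∧ 3 * iterY ε 81 x % 81 = 0 ∧
    (iterF ε 81 x + iterY ε 81 x) % 81 = 0) ∧
  (next ε ((x + 1) % 27) = ((ε + 1) * next ε x + 1) % 27 ∧
    incr ε ((x + 1) % 27) = (incr ε x + ε * next ε x) % 81)

instance (a ε x : ℕ) : Decidable (Admissible a ε x) := by unfold Admissible; infer_instance

/-- The residues `7 + 9 k` are those occurring in Case 3, and `ε + 1` is the inverse of `7 + 9 k`
modulo `81`. -/
theorem exists_admissible {k : ℕ} (hk : k < 9) :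
    ∃ ε, ∀ x < 27, Admissible (7 + 9 * k) ε x := by
  interval_cases k
  · exact ⟨57, by decide +kernel⟩
  · exact ⟨75, by decide +kernel⟩
  · exact ⟨12, by decide +kernel⟩
  · exact ⟨30, by decide +kernel⟩
  · exact ⟨48, by decide +kernel⟩
  · exact ⟨66, by decide +kernel⟩
  · exact ⟨3, by decide +kernel⟩
  · exact ⟨21, by decide +kernel⟩
  · exact ⟨39, by decide +kernel⟩

/-- The underlying set of the model. -/
abbrev State : Type := ZMod 27 × ZMod 27 × ZMod 81

/-- The first generator. -/
def shift : Equiv.Perm State := Equiv.addRight (1, 0, 1)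

theorem shift_pow (t : ℕ) (v : State) : (shift ^ t) v = (v.1 + t, v.2.1, v.2.2 + t) := by
  induction t with
  | zero => simp
  | succ t ih =>
    rw [pow_succ', Equiv.Perm.mul_apply, ih]
    simp [shift, add_assoc]

/-- The map underlying the commutator of the generators. -/
def dilate (ε : ℕ) (v : State) : State := ((ε + 1) * v.1, v.2.1 + 1, v.2.2 + ε * v.1.val)

/-- The map underlying the inverse of the second generator. -/
def twist (ε : ℕ) (v : State) : State :=
  (next ε v.1.val, v.2.1 + v.1, v.2.2 + incr ε v.1.val + (ε + 1) ^ v.2.1.val)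

theorem val_next (ε x : ℕ) : ((next ε x : ℕ) : ZMod 27).val = next ε x :=
  ZMod.val_cast_of_lt (Nat.mod_lt _ (by norm_num))

/-- The hypothesis makes `(ε + 1) ^ l` depend only on `l` modulo `27`. This power factors out of the
third coordinate, so the iterates are governed by the first coordinate alone and `27` numerical
checks suffice. -/
theorem twist_iterate {ε : ℕ} (hε : ((ε : ZMod 81) + 1) ^ 27 = 1) (t : ℕ) (v : State) :
    (twist ε)^[t] v = (((iterX ε t v.1.val : ℕ) : ZMod 27), v.2.1 + (iterL ε t v.1.val : ℕ),
      v.2.2 + (iterF ε t v.1.val : ℕ) + (ε + 1) ^ v.2.1.val * (iterY ε t v.1.val : ℕ)) := by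
  induction t generalizing v with
  | zero => simp [iterX, iterL, iterF, iterY]
  | succ t ih =>
    rw [Function.iterate_succ_apply, ih]
    obtain ⟨x, l, s⟩ := v
    have h1 : iterX ε (t + 1) x.val = iterX ε t (next ε x.val) := rfl
    have h2 : iterL ε (t + 1) x.val = (x.val + iterL ε t (next ε x.val)) % 27 := rfl
    have h3 : iterF ε (t + 1) x.val = (incr ε x.val + iterF ε t (next ε x.val)) % 81 := rfl
    have h4 : iterY ε (t + 1) x.val = (1 + (ε + 1) ^ x.val * iterY ε t (next ε x.val)) % 81 := rfl
    have h5 : ((ε : ZMod 81) + 1) ^ (l + x).val = (ε + 1) ^ l.val * (ε + 1) ^ x.val := by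
      rw [ZMod.val_add, ← pow_eq_pow_mod _ hε, pow_add]
    simp only [twist, val_next]
    rw [h1, h2, h3, h4, ZMod.natCast_mod, ZMod.natCast_mod, ZMod.natCast_mod, h5]
    push_cast
    rw [ZMod.natCast_zmod_val]
    refine Prod.ext rfl (Prod.ext ?_ ?_)
    · ring
    · ring

theorem natCast_eq_of_mod_eq {n a b : ℕ} (h : a % n = b % n) : (a : ZMod n) = b :=
  (ZMod.natCast_eq_natCast_iff' a b n).mpr h

theorem mul_val_natCast {ε : ℕ} (hε : (ε : ZMod 81) * 27 = 0) (n : ℕ) :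
    (ε : ZMod 81) * ((n : ZMod 27).val : ℕ) = ε * n := by
  conv_rhs => rw [← Nat.mod_add_div n 27]
  rw [ZMod.val_natCast]; push_cast
  linear_combination -((n / 27 : ℕ) : ZMod 81) * hε

/-- `y` is a multiple of `27` and `ε + 1` is `1` modulo `3`. This is why conditions on `3 * iterY`
in `Admissible` serve all values of the second coordinate. -/
theorem pow_mul_eq {ε : ℕ} {y : ZMod 81} (hy : 3 * y = 0)
    (h3 : ε % 3 = 0) (n : ℕ) : ((ε : ZMod 81) + 1) ^ n * y = y := by
  obtain ⟨k, hk⟩ := Nat.dvd_of_mod_eq_zero h3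
  induction n with
  | zero => simp
  | succ n ih =>
    rw [pow_succ, mul_assoc]
    have : ((ε : ZMod 81) + 1) * y = y := by rw [hk]; push_cast; linear_combination (k : ZMod 81) * hy
    rw [this, ih]

/-- A state `(x, l, s)` stands for `A ^ i C ^ l B ^ j` through `x = i` modulo `27`, `l` modulo `27`
and `s = i - j` modulo `81`, reflecting `A ^ 27 B ^ 27 = 1`. The last coordinate detects the order
`81` of `A`. -/
theorem exists_macdonaldPair {a ε : ℕ} (h : ∀ x < 27, Admissible a ε x) :
    ∃ A B : Equiv.Perm State, MacdonaldPair a A B ∧ A ^ 81 = 1 ∧ B ^ 81 = 1 ∧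
      ∀ k : ℕ, A ^ k = 1 → 81 ∣ k := by
  obtain ⟨⟨ha, hε, h3⟩, -⟩ := h 0 (by norm_num)
  have hε1 : ((ε : ZMod 81) + 1) ^ 27 = 1 := by
    exact_mod_cast natCast_eq_of_mod_eq (n := 81) (b := 1) hε
  have hε27 : (ε : ZMod 81) * 27 = 0 := by
    exact_mod_cast natCast_eq_of_mod_eq (n := 81) (a := ε * 27) (b := 0) (by omega)
  have ha81 : (a : ZMod 81) * (ε + 1) = 1 := by
    exact_mod_cast natCast_eq_of_mod_eq (n := 81) (a := a * (ε + 1)) (b := 1) ha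
  have ha27 : (a : ZMod 27) * (ε + 1) = 1 := by
    exact_mod_cast natCast_eq_of_mod_eq (n := 27) (a := a * (ε + 1)) (b := 1) (by omega)
  have hid : (twist ε)^[81] = id := by
    funext v
    obtain ⟨-, -, ⟨k1, k2, k3, k4⟩, -⟩ := h v.1.val (ZMod.val_lt v.1)
    have hY : 3 * ((iterY ε 81 v.1.val : ℕ) : ZMod 81) = 0 := by
      exact_mod_cast natCast_eq_of_mod_eq (n := 81) (b := 0) k3
    have hF : ((iterF ε 81 v.1.val : ℕ) : ZMod 81) + (iterY ε 81 v.1.val : ℕ) = 0 := by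
      exact_mod_cast natCast_eq_of_mod_eq (n := 81) (b := 0) k4
    rw [twist_iterate hε1, k1, k2, pow_mul_eq hY h3, add_assoc v.2.2, hF]
    simp
  let C : Equiv.Perm State :=
    { toFun := dilate ε
      invFun := fun v => (a * v.1, v.2.1 - 1, v.2.2 - ε * ((a : ZMod 27) * v.1).val)
      left_inv := fun v => by
        have : (a : ZMod 27) * ((ε + 1) * v.1) = v.1 := by rw [← mul_assoc, ha27, one_mul]
        simp [dilate, this]
      right_inv := fun v => by
        have : ((ε : ZMod 27) + 1) * (a * v.1) = v.1 := by
          rw [← mul_assoc, mul_comm _ (a : ZMod 27), ha27, one_mul]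
        simp [dilate, this] }
  let D : Equiv.Perm State :=
    { toFun := twist ε
      invFun := (twist ε)^[80]
      left_inv := fun v => by rw [← Function.iterate_succ_apply, hid]; rfl
      right_inv := fun v => by rw [← Function.iterate_succ_apply' (twist ε), hid]; rfl }
  have hDpow : ∀ t v, (D ^ t) v = (twist ε)^[t] v := fun t v => by
    rw [← Equiv.Perm.iterate_eq_pow]; rfl
  have hval : ∀ x : ZMod 27, ((x.val : ℕ) : ZMod 27) = x := fun x => ZMod.natCast_zmod_val x
  refine ⟨shift, D⁻¹, MacdonaldPair.of_perm (c := C) ?_ ?_ ?_, ?_, ?_, ?_⟩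
  · ext1 v
    obtain ⟨x, l, s⟩ := v
    obtain ⟨-, -, -, k1, k2⟩ := h x.val (ZMod.val_lt x)
    have hx : (x + 1).val = (x.val + 1) % 27 := ZMod.val_add x 1
    have e1 : ((next ε ((x.val + 1) % 27) : ℕ) : ZMod 27) = (ε + 1) * next ε x.val + 1 := by
      rw [k1, ZMod.natCast_mod]; push_cast; ring
    have e2 : ((incr ε ((x.val + 1) % 27) : ℕ) : ZMod 81) = incr ε x.val + ε * next ε x.val := by
      rw [k2, ZMod.natCast_mod]; push_cast; ring
    change shift (dilate ε (twist ε (x, l, s))) = twist ε (shift (x, l, s))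
    simp only [shift, dilate, twist, Equiv.coe_addRight, Prod.mk_add_mk, hx, e1, e2, val_next]
    refine Prod.ext rfl (Prod.ext ?_ ?_)
    · ring
    · simp only [add_zero]; ring
  · ext1 v
    obtain ⟨x, l, s⟩ := v
    rw [zpow_natCast]
    have e1 : (ε : ZMod 81) * ((x + a).val : ℕ) = ε * (x.val + a) := by
      have := mul_val_natCast hε27 (x.val + a)
      push_cast [hval] at this
      rw [this]
    change shift (dilate ε (x, l, s)) = dilate ε ((shift ^ a) (x, l, s))
    rw [shift_pow]
    simp only [shift, dilate, Equiv.coe_addRight, Prod.mk_add_mk, e1]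
    refine Prod.ext ?_ (Prod.ext ?_ ?_)
    · linear_combination -ha27
    · simp
    · linear_combination -ha81
  · ext1 v
    obtain ⟨x, l, s⟩ := v
    rw [zpow_natCast]
    obtain ⟨-, ⟨k1, k2, k3, k4⟩, -, -⟩ := h x.val (ZMod.val_lt x)
    change dilate ε (twist ε (x, l, s)) = (D ^ a) (dilate ε (x, l, s))
    have hv : (((ε : ZMod 27) + 1) * x).val = (ε + 1) * x.val % 27 := by
      rw [← ZMod.val_natCast]; push_cast [hval]; rfl
    have hw : ((ε : ZMod 81) + 1) ^ (l + 1).val = (ε + 1) ^ l.val * (ε + 1) := by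
      rw [ZMod.val_add, ← pow_eq_pow_mod _ hε1, pow_add]; exact congrArg _ (pow_one _)
    rw [hDpow, twist_iterate hε1]
    simp only [dilate, twist, val_next, hv, hw, k1, k2]
    set Y := iterY ε a ((ε + 1) * x.val % 27)
    set F := iterF ε a ((ε + 1) * x.val % 27)
    have hY : (3 : ZMod 81) * (((ε + 1) * Y : ℕ) - 1) = 0 := by
      have : ((3 * ((ε + 1) * Y) : ℕ) : ZMod 81) = (3 : ℕ) := natCast_eq_of_mod_eq k3
      push_cast at this ⊢
      linear_combination this
    have hF : (ε : ZMod 81) * x.val + F + (ε + 1) * Y = incr ε x.val + 1 + ε * next ε x.val := by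
      exact_mod_cast natCast_eq_of_mod_eq (n := 81) k4
    have hYw := pow_mul_eq hY h3 l.val
    push_cast at hYw
    refine Prod.ext ?_ (Prod.ext ?_ ?_)
    · simp [ZMod.natCast_mod]
    · simp only [hval]; ring
    · linear_combination -hF - hYw
  · ext1 v
    rw [shift_pow]
    have h1 : ((81 : ℕ) : ZMod 27) = 0 := by decide
    have h2 : ((81 : ℕ) : ZMod 81) = 0 := by decide
    rw [h1, h2]; simp
  · rw [inv_pow, inv_eq_one]
    ext1 v
    rw [hDpow, hid]; rfl
  · intro k hk
    have := shift_pow k 0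
    rw [hk] at this
    have h2 := congrArg (fun v => v.2.2) this
    simp only [Equiv.Perm.coe_one, id_eq, Prod.snd_zero, zero_add] at h2
    exact (ZMod.natCast_eq_zero_iff k 81).mp h2.symm

end ExceptionalModel

/-- There is a Macdonald pair whose first element has order divisible by `81`. -/
theorem exists_macdonaldPair_dvd_81 {α : ℤ} (h : α % 9 = 7) :
    ∃ (X : Type) (_ : Group X) (A B : X), MacdonaldPair α A B ∧ ∀ k : ℕ, A ^ k = 1 → 81 ∣ k := by
  obtain ⟨k, hk, hkα⟩ : ∃ k : ℕ, k < 9 ∧ ((7 + 9 * k : ℕ) : ℤ) = α % 81 :=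
    ⟨(α % 81 / 9).toNat, by omega, by omega⟩
  obtain ⟨ε, hε⟩ := ExceptionalModel.exists_admissible hk
  obtain ⟨A, B, hAB, hA, hB, hord⟩ := ExceptionalModel.exists_macdonaldPair hε
  refine ⟨_, _, A, B, hAB.congr_exponent (n := 81) ?_ ?_ ?_, hord⟩
  · exact_mod_cast hA
  · exact_mod_cast hB
  · rw [hkα]; omega


/-! ### Exact central powers of `A`: the upper bound for its order -/

namespace MacdonaldPair

variable {G : Type*} [Group G] {α : ℤ} {A B : G}

/-- The factors `u` and `v` are invertible modulo `p ^ K`. So `A ^ p ^ e` and `B ^ p ^ e` are the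
same power of `A ^ E` and `B ^ E`, and `A ^ p ^ (e + m)` is a power of `A ^ (E (α - 1))`. -/
theorem central_of_coprime {p K e m : ℕ} (hA : A ^ p ^ K = 1) (hB : B ^ p ^ K = 1)
    {E u v : ℤ} (hE : E = p ^ e * u) (hu : IsCoprime u p) (hα : α - 1 = p ^ m * v)
    (hv : IsCoprime v p) (h1 : Commute B (A ^ E)) (h2 : A ^ E * B ^ E = 1)
    (h3 : A ^ (E * (α - 1)) = 1) :
    Commute B (A ^ p ^ e) ∧ A ^ p ^ e * B ^ p ^ e = 1 ∧ A ^ p ^ (e + m) = 1 := by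
  have pw : ∀ {X : G} {x w z : ℤ} (n : ℕ), X ^ p ^ K = 1 → w * x + z * (p : ℤ) ^ K = 1 →
      X ^ n = (X ^ (n * x)) ^ w := by
    intro X x w z n hX hw
    have hX' : X ^ ((p : ℤ) ^ K) = 1 := by exact_mod_cast hX
    have : (n : ℤ) = (n * x) * w + p ^ K * (n * z) := by linear_combination -n * hw
    rw [← zpow_natCast, ← zpow_mul]
    conv_lhs => rw [this, zpow_add, zpow_mul X ((p : ℤ) ^ K), hX', one_zpow, mul_one]
  obtain ⟨w, z, hwz⟩ := hu.pow_right (n := K)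
  obtain ⟨w', z', hwz'⟩ := (hu.mul_left hv).pow_right (n := K)
  have hE' : ((p ^ e : ℕ) : ℤ) * u = E := by rw [hE]; push_cast; rfl
  have eA := pw (p ^ e) hA hwz
  have eB := pw (p ^ e) hB hwz
  rw [hE'] at eA eB
  refine ⟨?_, ?_, ?_⟩
  · rw [eA]; exact h1.zpow_right w
  · have : B ^ E = (A ^ E)⁻¹ := (inv_eq_of_mul_eq_one_right h2).symm
    rw [eA, eB, this, inv_zpow, mul_inv_cancel]
  · have eA' := pw (p ^ (e + m)) hA hwz'
    have : ((p ^ (e + m) : ℕ) : ℤ) * (u * v) = E * (α - 1) := by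
      rw [hE, hα]; push_cast; ring
    rw [this, h3, one_zpow] at eA'
    exact eA'

/-- A criterion for `A ^ p ^ e` to be central. -/
theorem central_prime_pow (h : MacdonaldPair α A B) {p K e m s : ℕ} (hp : p.Prime)
    (hA : A ^ p ^ K = 1) (hB : B ^ p ^ K = 1) {v : ℤ} (hα : α - 1 = p ^ m * v) (hm : 1 ≤ m)
    (hv : IsCoprime v p)
    (hs : ∀ a : ℕ, (p : ℤ) ^ (e + m + 1) ∣ a - α → ∃ u : ℤ, IsCoprime u p ∧
      (p : ℤ) ^ (e + 1) ∣ (a : ℤ) ^ (a ^ s + s) - a * geomSum a (a ^ s) - p ^ e * u) :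
    Commute B (A ^ p ^ e) ∧ A ^ p ^ e * B ^ p ^ e = 1 ∧ A ^ p ^ (e + m) = 1 := by
  set L := K + (e + m + 1) with hL
  have big : ∀ {X : G}, X ^ p ^ K = 1 → X ^ p ^ L = 1 := fun hX => by
    rw [hL, pow_add, pow_mul, hX, one_pow]
  have hA := big hA
  have hB := big hB
  have hA' : A ^ ((p : ℤ) ^ L) = 1 := by exact_mod_cast hA
  have hB' : B ^ ((p : ℤ) ^ L) = 1 := by exact_mod_cast hB
  have hpL : (0 : ℤ) < (p : ℤ) ^ L := by have := hp.pos; positivity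
  -- `a ^ s` must be a natural number to serve as `M`, so `α` is replaced by a residue. The modulus
  -- kills both generators and is large enough to preserve the valuation of `α - 1`.
  obtain ⟨a, ha⟩ : ∃ a : ℕ, (a : ℤ) = α % p ^ L :=
    ⟨(α % p ^ L).toNat, Int.toNat_of_nonneg (Int.emod_nonneg _ hpL.ne')⟩
  have haα : (p : ℤ) ^ L ∣ a - α := by
    have := Int.emod_add_mul_ediv α (p ^ L)
    exact ⟨-(α / p ^ L), by rw [ha]; linear_combination this⟩
  have hap : IsCoprime (a : ℤ) p := by
    obtain ⟨x, hx⟩ := (dvd_pow_self (p : ℤ) (by omega : L ≠ 0)).trans haα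
    obtain ⟨y, hy⟩ : (p : ℤ) ∣ α - 1 := by rw [hα]; exact (dvd_pow_self _ (by omega)).mul_right _
    exact ⟨1, -(x + y), by linarith⟩
  obtain ⟨γ, z, hγ⟩ := hap.pow_right (n := L)
  have hinv : ∀ {X : G}, X ^ ((p : ℤ) ^ L) = 1 → X ^ ((a : ℤ) * γ) = X := by
    intro X hX
    have : (a : ℤ) * γ = 1 + p ^ L * -z := by linarith
    rw [this, zpow_add, zpow_mul, hX]; simp
  obtain ⟨u, hu, hdiv⟩ := hs a ((pow_dvd_pow _ (by omega)).trans haα)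
  set E : ℤ := (a : ℤ) ^ (a ^ s) - γ ^ s * (a * geomSum a (a ^ s)) with hE
  obtain ⟨t, ht⟩ : (p : ℤ) ^ (e + 1) ∣ 1 - (a : ℤ) ^ s * γ ^ s := by
    rw [← mul_pow]
    have h1 : (p : ℤ) ^ (e + 1) ∣ a * γ - 1 :=
      (pow_dvd_pow _ (by omega : e + 1 ≤ L)).trans ⟨-z, by linarith⟩
    rw [dvd_sub_comm]
    exact h1.trans (by simpa using sub_dvd_pow_sub_pow ((a : ℤ) * γ) 1 s)
  obtain ⟨x, hx⟩ := hdiv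
  -- Multiplying the hypothesis by `γ ^ s` recovers `E` modulo `p ^ (e + 1)`, so `p ^ e` divides `E`
  -- exactly.
  have hEs : E = p ^ e * (u * γ ^ s + p * (x * γ ^ s + t * a ^ (a ^ s))) := by
    rw [hE]
    rw [pow_succ] at hx ht
    rw [pow_add] at hx
    linear_combination γ ^ s * hx + a ^ (a ^ s) * ht
  have hγp : IsCoprime γ p := by
    obtain ⟨L', hL'⟩ : ∃ L', L = L' + 1 := ⟨K + (e + m), by omega⟩
    exact ⟨a, z * p ^ L', by rw [hL', pow_succ] at hγ; linarith⟩
  refine central_of_coprime (α := a) hA hB hEs ?_ (m := m)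
    (v := v + p * (p ^ (L - m - 1) * ((a - α) / p ^ L))) ?_ ?_ ?_ ?_ ?_
  · exact IsCoprime.add_mul_right_left (hu.mul_left hγp.pow_left) _ |> fun h => by
      rwa [mul_comm (p : ℤ)]
  · obtain ⟨y, hy⟩ := haα
    rw [hy, Int.mul_ediv_cancel_left _ hpL.ne']
    have : (p : ℤ) ^ L = p ^ m * (p * p ^ (L - m - 1)) := by
      rw [← pow_succ', ← pow_add]; congr 1; omega
    linear_combination hy + hα + y * this
  · rw [mul_comm (p : ℤ)]; exact hv.add_mul_right_left _
  all_goals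
    have := (h.congr_exponent hA' hB' haα).central_power (hinv hA') (hinv hB')
      (s := s) (M := a ^ s) (by push_cast; rfl) hE
  · exact this.1
  · exact this.2.1
  · exact this.2.2

end MacdonaldPair

/-- Expansion about `a = 1`; the factor `6` clears the denominators of the binomial coefficients.
With `s = 1` the exponent `E` of `central_power` is essentially this difference. Its valuation is
read off from `3 l ^ 2 + l ^ 3`, where `l = a - 1`: the first term wins unless `p = 3` and `m = 1`,
and then the two cancel to higher order exactly in Case 3. -/
theorem pow_sub_geomSum_eq (a : ℕ) : ∃ k : ℤ, 6 * ((a : ℤ) ^ a - geomSum a a) =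
    3 * ((a : ℤ) - 1) ^ 2 + (a - 1) ^ 3 + 3 * (a - 1) ^ 4 - (a - 1) ^ 5 +
      6 * (a - 1) ^ 3 * k := by
  set l : ℤ := (a : ℤ) - 1 with hl
  have key : ∀ n : ℕ, (∃ k : ℤ, (a : ℤ) ^ n = 1 + n * l + (n.choose 2 : ℕ) * l ^ 2 + l ^ 3 * k) ∧
      ∃ k : ℤ, geomSum a n = n + (n.choose 2 : ℕ) * l + (n.choose 3 : ℕ) * l ^ 2 + l ^ 3 * k := by
    intro n
    have hal : (a : ℤ) = 1 + l := by rw [hl]; ring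
    generalize (a : ℤ) = b at *
    subst hal
    induction n with
    | zero => exact ⟨⟨0, by simp⟩, ⟨0, by simp [geomSum_zero]⟩⟩
    | succ n ih =>
      obtain ⟨⟨k, hk⟩, ⟨j, hj⟩⟩ := ih
      have h2 : (((n + 1).choose 2 : ℕ) : ℤ) = n + (n.choose 2 : ℕ) := by
        rw [Nat.choose_succ_succ' n 1]; simp
      have h3 : (((n + 1).choose 3 : ℕ) : ℤ) = (n.choose 2 : ℕ) + (n.choose 3 : ℕ) := by
        rw [Nat.choose_succ_succ' n 2]; simp
      refine ⟨⟨k * (1 + l) + (n.choose 2 : ℕ), ?_⟩, ⟨j * (1 + l) + (n.choose 3 : ℕ), ?_⟩⟩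
      · rw [pow_succ, hk, h2]; push_cast; ring
      · rw [geomSum_succ, hj, h2, h3]; push_cast; ring
  obtain ⟨⟨k, hk⟩, ⟨j, hj⟩⟩ := key a
  refine ⟨k - j, ?_⟩
  have c2 := Nat.cast_choose_two_mul a
  have c3 := Nat.cast_choose_three_mul a
  have hal : (a : ℤ) = 1 + l := by rw [hl]; ring
  rw [hk, hj]
  rw [hal] at c2 c3 ⊢
  linear_combination 3 * (l ^ 2 - l) * c2 - l ^ 2 * c3

theorem exists_eq_pow_mul {p : ℕ} (hp : p ≠ 0) {e : ℕ} {q N w : ℤ} (h : q * N = p ^ e * w)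
    (hq : IsCoprime q p) (hw : IsCoprime w p) : ∃ u : ℤ, IsCoprime u p ∧ N = p ^ e * u := by
  obtain ⟨u, hu⟩ : (p : ℤ) ^ e ∣ N := hq.symm.pow_left.dvd_of_dvd_mul_left ⟨w, h⟩
  refine ⟨u, ?_, hu⟩
  have : q * u = w := by
    apply mul_left_cancel₀ (pow_ne_zero e (by exact_mod_cast hp : (p : ℤ) ≠ 0))
    rw [← h, hu]; ring
  exact hw.of_isCoprime_of_dvd_left ⟨q, by rw [← this]; ring⟩

namespace MacdonaldPair

variable {G : Type*} [Group G] {α : ℤ} {A B : G}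

theorem exists_sub_one_eq {p e m : ℕ} {v : ℤ} (hα : α - 1 = p ^ m * v) (hv : IsCoprime v p)
    {a : ℤ} (ha : (p : ℤ) ^ (e + m + 1) ∣ a - α) :
    ∃ v' : ℤ, a - 1 = p ^ m * v' ∧ IsCoprime v' p ∧ (p : ℤ) ∣ v' - v := by
  obtain ⟨x, hx⟩ := ha
  refine ⟨v + p * (p ^ e * x), ?_, hv.add_mul_right_left _ |> fun h => by rwa [mul_comm (p : ℤ)],
    ⟨p ^ e * x, by ring⟩⟩
  rw [show e + m + 1 = m + (e + 1) by ring, pow_add, pow_succ] at hx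
  linear_combination hx + hα

theorem isCoprime_of_sub_one_eq {p m : ℕ} {a v : ℤ} (hm : 1 ≤ m) (ha : a - 1 = p ^ m * v) :
    IsCoprime a p := by
  obtain ⟨y, hy⟩ : (p : ℤ) ∣ a - 1 := by rw [ha]; exact (dvd_pow_self _ (by omega)).mul_right _
  exact ⟨1, -y, by linarith⟩

/-- The generic odd case. -/
theorem central_of_gt_three (h : MacdonaldPair α A B) {p K m : ℕ} (hp : p.Prime) (h3 : 3 < p)
    (hA : A ^ p ^ K = 1) (hB : B ^ p ^ K = 1) {v : ℤ} (hα : α - 1 = p ^ m * v) (hm : 1 ≤ m)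
    (hv : IsCoprime v p) :
    Commute B (A ^ p ^ (2 * m)) ∧ A ^ p ^ (2 * m) * B ^ p ^ (2 * m) = 1 ∧
      A ^ p ^ (2 * m + m) = 1 := by
  refine h.central_prime_pow hp hA hB hα hm hv (s := 1) fun a ha => ?_
  obtain ⟨v', ha', hv', -⟩ := exists_sub_one_eq hα hv ha
  obtain ⟨k, hk⟩ := pow_sub_geomSum_eq a
  obtain ⟨m', rfl⟩ : ∃ m', m = m' + 1 := ⟨m - 1, by omega⟩
  have c2 : IsCoprime (2 : ℤ) p := by
    exact_mod_cast Nat.isCoprime_iff_coprime.mpr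
      ((Nat.coprime_primes Nat.prime_two hp).mpr (by omega))
  have c3 : IsCoprime (3 : ℤ) p := by
    exact_mod_cast Nat.isCoprime_iff_coprime.mpr
      ((Nat.coprime_primes Nat.prime_three hp).mpr (by omega))
  obtain ⟨u, hu, hN⟩ := exists_eq_pow_mul hp.ne_zero (e := 2 * (m' + 1)) (q := 6)
    (N := (a : ℤ) ^ a - geomSum a a)
    (w := 3 * v' ^ 2 + p * (p ^ m' * (v' ^ 3 + 3 * p ^ (m' + 1) * v' ^ 4
      - (p ^ (m' + 1)) ^ 2 * v' ^ 5 + 6 * v' ^ 3 * k)))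
    (by rw [hk, ha']; ring) (by have := c2.mul_left c3; norm_num at this; exact this)
    (by rw [mul_comm (p : ℤ)]; exact (c3.mul_left (hv'.pow_left)).add_mul_right_left _)
  refine ⟨a * u, (isCoprime_of_sub_one_eq hm ha').mul_left hu, ?_⟩
  rw [pow_one, pow_succ]
  exact ⟨0, by linear_combination a * hN⟩

/-- The case `p = 3`, outside the exceptional case. -/
theorem central_of_eq_three (h : MacdonaldPair α A B) {K m : ℕ}
    (hA : A ^ 3 ^ K = 1) (hB : B ^ 3 ^ K = 1) {v : ℤ} (hα : α - 1 = 3 ^ m * v) (hm : 1 ≤ m)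
    (hv : IsCoprime v 3) (hmv : 1 < m ∨ 3 ∣ v - 1) :
    Commute B (A ^ 3 ^ (2 * m)) ∧ A ^ 3 ^ (2 * m) * B ^ 3 ^ (2 * m) = 1 ∧
      A ^ 3 ^ (2 * m + m) = 1 := by
  refine h.central_prime_pow Nat.prime_three hA hB (by exact_mod_cast hα) hm
    (by exact_mod_cast hv) (s := 1) fun a ha => ?_
  obtain ⟨v', ha', hv', hvv⟩ := exists_sub_one_eq (p := 3) (by exact_mod_cast hα)
    (by exact_mod_cast hv) ha
  obtain ⟨k, hk⟩ := pow_sub_geomSum_eq a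
  obtain ⟨m', rfl⟩ : ∃ m', m = m' + 1 := ⟨m - 1, by omega⟩
  push_cast at ha' hv' hvv
  obtain ⟨u, hu, hN⟩ := exists_eq_pow_mul three_ne_zero (e := 2 * (m' + 1)) (q := 2)
    (N := (a : ℤ) ^ a - geomSum a a)
    (w := v' ^ 2 + 3 ^ m' * v' ^ 3 + (3 ^ m' * (3 ^ (m' + 1) * v' ^ 4
      - 3 ^ m' * 3 ^ (m' + 1) * v' ^ 5 + 2 * v' ^ 3 * k)) * 3)
    (by
      apply mul_left_cancel₀ (three_ne_zero (α := ℤ))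
      rw [ha'] at hk; push_cast; linear_combination hk)
    (by norm_num) (by
      push_cast
      refine IsCoprime.add_mul_right_left ?_ _
      -- The residue modulo `3` is that of `v' ^ 2 + 3 ^ m' v' ^ 3`: it is `v' ^ 2` when `m > 1`,
      -- and `1 + 1 = 2` when `m = 1` and `v'` is `1` modulo `3`.
      rcases hmv with hm1 | hv1
      · obtain ⟨m'', rfl⟩ : ∃ m'', m' = m'' + 1 := ⟨m' - 1, by omega⟩
        rw [show v' ^ 2 + 3 ^ (m'' + 1) * v' ^ 3 = v' ^ 2 + (3 ^ m'' * v' ^ 3) * 3 by ring]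
        exact hv'.pow_left.add_mul_right_left _
      · obtain ⟨y, hy⟩ : (3 : ℤ) ∣ v' - 1 := by
          have := dvd_add hvv hv1; exact dvd_of_dvd_of_eq this (by ring)
        rcases Nat.eq_zero_or_pos m' with rfl | hm1
        · have : v' = 1 + y * 3 := by linarith
          rw [show v' ^ 2 + 3 ^ 0 * v' ^ 3 = 2 + ((v' ^ 2 + 2 * v' + 2) * y) * 3 by
            rw [this]; ring]
          exact IsCoprime.add_mul_right_left (by norm_num) _
        · obtain ⟨m'', rfl⟩ : ∃ m'', m' = m'' + 1 := ⟨m' - 1, by omega⟩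
          rw [show v' ^ 2 + 3 ^ (m'' + 1) * v' ^ 3 = v' ^ 2 + (3 ^ m'' * v' ^ 3) * 3 by ring]
          exact hv'.pow_left.add_mul_right_left _)
  refine ⟨a * u, (isCoprime_of_sub_one_eq (p := 3) hm ha').mul_left hu, ?_⟩
  rw [pow_one, pow_succ]
  exact ⟨0, by push_cast at hN ⊢; linear_combination (a : ℤ) * hN⟩

/-- The case `p = 2`. -/
theorem central_of_eq_two (h : MacdonaldPair α A B) {K m : ℕ}
    (hA : A ^ 2 ^ K = 1) (hB : B ^ 2 ^ K = 1) {v : ℤ} (hα : α - 1 = 2 ^ m * v) (hm : 2 ≤ m)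
    (hv : IsCoprime v 2) :
    Commute B (A ^ 2 ^ (2 * m - 1)) ∧ A ^ 2 ^ (2 * m - 1) * B ^ 2 ^ (2 * m - 1) = 1 ∧
      A ^ 2 ^ (2 * m - 1 + m) = 1 := by
  refine h.central_prime_pow Nat.prime_two hA hB (by exact_mod_cast hα) (by omega)
    (by exact_mod_cast hv) (s := 1) fun a ha => ?_
  obtain ⟨v', ha', hv', hvv⟩ := exists_sub_one_eq (p := 2) (by exact_mod_cast hα)
    (by exact_mod_cast hv) ha
  obtain ⟨k, hk⟩ := pow_sub_geomSum_eq a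
  obtain ⟨m', rfl⟩ : ∃ m', m = m' + 2 := ⟨m - 2, by omega⟩
  push_cast at ha' hv' hvv
  obtain ⟨u, hu, hN⟩ := exists_eq_pow_mul two_ne_zero (e := 2 * m' + 3) (q := 3)
    (N := (a : ℤ) ^ a - geomSum a a)
    (w := 3 * v' ^ 2 + (2 * 2 ^ m' * (v' ^ 3 + 3 * 2 ^ (m' + 2) * v' ^ 4
      - (2 ^ (m' + 2)) ^ 2 * v' ^ 5 + 6 * v' ^ 3 * k)) * 2)
    (by
      apply mul_left_cancel₀ (two_ne_zero (α := ℤ))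
      rw [ha'] at hk; push_cast; linear_combination hk)
    (by norm_num) (by
      push_cast
      exact (IsCoprime.mul_left (by norm_num) hv'.pow_left).add_mul_right_left _)
  refine ⟨a * u, (isCoprime_of_sub_one_eq (p := 2) (by omega) ha').mul_left hu, ?_⟩
  rw [pow_one, pow_succ, show 2 * (m' + 2) - 1 = 2 * m' + 3 by omega]
  exact ⟨0, by push_cast at hN ⊢; linear_combination (a : ℤ) * hN⟩

end MacdonaldPair

theorem geomSum_add (α : ℤ) (m n : ℕ) :
    geomSum α (m + n) = geomSum α m + α ^ m * geomSum α n := by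
  simp only [geomSum, Finset.sum_range_add, Finset.mul_sum, pow_add]

/-- The numerical condition in the exceptional case, for the residue `r` modulo `81`. -/
theorem exists_residue {k : ℕ} (hk : k < 9) : ∃ s : ℕ, ∃ u < 3, u ≠ 0 ∧
    (7 + 9 * k) ^ ((7 + 9 * k) ^ s % 81 + s) % 81 =
      ((7 + 9 * k) * (((7 + 9 * k) ^ ((7 + 9 * k) ^ s % 81) - 1) / (7 + 9 * k - 1)) + 27 * u)
        % 81 := by
  interval_cases k
  · exact ⟨1, by decide +kernel⟩
  · exact ⟨1, by decide +kernel⟩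
  · exact ⟨2, by decide +kernel⟩
  · exact ⟨1, by decide +kernel⟩
  · exact ⟨1, by decide +kernel⟩
  · exact ⟨2, by decide +kernel⟩
  · exact ⟨1, by decide +kernel⟩
  · exact ⟨1, by decide +kernel⟩
  · exact ⟨2, by decide +kernel⟩

/-- Already `a ^ 27` is `1` modulo `81`. Exponents are reduced modulo `81` so that the same
reduction applies to geometric sums, for which `81` terms are needed to get a multiple of `81`. -/
theorem pow_emod_eightyone {a : ℤ} (ha : (3 : ℤ) ∣ a - 1) (n : ℕ) :
    (81 : ℤ) ∣ a ^ n - a ^ (n % 81) := by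
  obtain ⟨x, hx⟩ := ha
  have h27 : (81 : ℤ) ∣ a ^ 27 - 1 := by
    have h3 : (9 : ℤ) ∣ a ^ 3 - 1 := ⟨x + 3 * x ^ 2 + 3 * x ^ 3, by
      have : a = 1 + 3 * x := by linarith
      rw [this]; ring⟩
    obtain ⟨y, hy⟩ := h3
    have h9 : (27 : ℤ) ∣ a ^ 9 - 1 := ⟨y + 9 * y ^ 2 + 27 * y ^ 3, by
      have : a ^ 3 = 1 + 9 * y := by linarith
      rw [show a ^ 9 = (a ^ 3) ^ 3 by ring, this]; ring⟩
    obtain ⟨z, hz⟩ := h9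
    exact ⟨z + 27 * z ^ 2 + 243 * z ^ 3, by
      have : a ^ 9 = 1 + 27 * z := by linarith
      rw [show a ^ 27 = (a ^ 9) ^ 3 by ring, this]; ring⟩
  have h2 : (81 : ℤ) ∣ (a ^ 27) ^ (3 * (n / 81)) - 1 :=
    h27.trans (by simpa using sub_dvd_pow_sub_pow (a ^ 27) 1 (3 * (n / 81)))
  conv_rhs => rw [← Nat.mod_add_div n 81]
  refine dvd_of_dvd_of_eq (h2.mul_left (a ^ (n % 81))) ?_
  rw [pow_add, Nat.mod_add_div n 81, ← pow_mul]; ring_nf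

theorem geomSum_emod_eightyone {a : ℤ} (ha : (3 : ℤ) ∣ a - 1) (n : ℕ) :
    (81 : ℤ) ∣ geomSum a n - geomSum a (n % 81) := by
  have h1 : (81 : ℤ) ∣ geomSum (a ^ (n / 81)) 81 := by
    have := dvd_geomSum (α := a ^ (n / 81)) (k := 81) (by norm_num) (fun p hp hd => by
      have : p = 3 := by
        rw [show 81 = 3 ^ 4 by norm_num] at hd
        exact (Nat.prime_dvd_prime_iff_eq hp Nat.prime_three).mp (hp.dvd_of_dvd_pow hd)
      rw [this]
      exact ha.trans (by simpa using sub_dvd_pow_sub_pow a 1 (n / 81)))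
    exact_mod_cast this
  conv_rhs => rw [← Nat.mod_add_div n 81]
  rw [geomSum_add, geomSum_mul_index, Nat.mod_add_div n 81]
  exact dvd_of_dvd_of_eq ((h1.mul_left (geomSum a (n / 81))).mul_left (a ^ (n % 81))) (by ring)

theorem geomSum_congr {n a b : ℤ} (h : n ∣ a - b) (k : ℕ) : n ∣ geomSum a k - geomSum b k := by
  rw [geomSum, geomSum, ← Finset.sum_sub_distrib]
  exact Finset.dvd_sum fun i _ => h.trans (sub_dvd_pow_sub_pow a b i)

namespace MacdonaldPair

variable {G : Type*} [Group G] {α : ℤ} {A B : G}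

/-- The exceptional case. -/
theorem central_of_exceptional (h : MacdonaldPair α A B) {K : ℕ}
    (hA : A ^ 3 ^ K = 1) (hB : B ^ 3 ^ K = 1) (hα : α % 9 = 7) :
    Commute B (A ^ 27) ∧ A ^ 27 * B ^ 27 = 1 ∧ A ^ 81 = 1 := by
  obtain ⟨k, hk, hkα⟩ : ∃ k : ℕ, k < 9 ∧ ((7 + 9 * k : ℕ) : ℤ) = α % 81 :=
    ⟨(α % 81 / 9).toNat, by omega, by omega⟩
  -- Here `s` depends on `α` modulo `81`. The residue `27 u` with `u` equal to `1` or `2` says that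
  -- the exponent has valuation exactly `3`.
  obtain ⟨s, u, hu3, hu0, hres⟩ := exists_residue hk
  have hgeo : (7 + 9 * k - 1) * (((7 + 9 * k) ^ ((7 + 9 * k) ^ s % 81) - 1) / (7 + 9 * k - 1)) =
      (7 + 9 * k) ^ ((7 + 9 * k) ^ s % 81) - 1 :=
    Nat.mul_div_cancel' (by simpa using Nat.sub_dvd_pow_sub_pow (7 + 9 * k) 1 _)
  set r := 7 + 9 * k with hr
  set g := (r ^ (r ^ s % 81) - 1) / (r - 1)
  have hg : (g : ℤ) = geomSum r (r ^ s % 81) := by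
    have h1 := geomSum_mul r (r ^ s % 81)
    have h2 : ((r : ℤ) - 1) * g = r ^ (r ^ s % 81) - 1 := by
      have h3 : 1 ≤ r ^ (r ^ s % 81) := Nat.one_le_pow _ _ (by omega)
      zify [h3, (by omega : 1 ≤ r)] at hgeo
      exact hgeo
    apply mul_left_cancel₀ (show (r : ℤ) - 1 ≠ 0 by omega)
    rw [h2, ← h1]; ring
  have := h.central_prime_pow (p := 3) (e := 3) (m := 1) Nat.prime_three hA hB
    (v := (α - 1) / 3) (by omega) le_rfl ((Int.isCoprime_iff_gcd_eq_one).mpr (by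
      rw [← Int.gcd_emod]
      have : (α - 1) / 3 % (3 : ℕ) = 2 := by omega
      rw [this]; rfl)) (s := s) fun a ha => ?_
  · exact this
  · refine ⟨u, ?_, ?_⟩
    · interval_cases u
      · exact absurd rfl hu0
      · exact isCoprime_one_left
      · norm_num
    · have har : (81 : ℤ) ∣ a - r := by
        have : ((3 : ℕ) : ℤ) ^ (3 + 1 + 1) = 243 := by norm_num
        omega
      have hr3 : (3 : ℤ) ∣ r - 1 := by omega
      have ha3 : (3 : ℤ) ∣ a - 1 := by omega
      have hM : a ^ s % 81 = r ^ s % 81 := by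
        have := har.trans (sub_dvd_pow_sub_pow (a : ℤ) r s)
        apply (Nat.ModEq.symm)
        rw [Nat.modEq_iff_dvd]; exact_mod_cast this
      have e1 : (81 : ℤ) ∣ (a : ℤ) ^ (a ^ s + s) - r ^ (r ^ s % 81 + s) := by
        have h1 := (pow_emod_eightyone ha3 (a ^ s)).mul_left ((a : ℤ) ^ s)
        rw [hM] at h1
        have h2 := har.trans (sub_dvd_pow_sub_pow (a : ℤ) r (r ^ s % 81 + s))
        exact dvd_of_dvd_of_eq (dvd_add h1 h2) (by rw [pow_add, pow_add]; ring)
      have e2 : (81 : ℤ) ∣ a * geomSum a (a ^ s) - r * g := by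
        have h1 := (geomSum_emod_eightyone ha3 (a ^ s)).mul_left a
        rw [hM] at h1
        have h2 := (geomSum_congr har (r ^ s % 81)).mul_left a
        have h3 := har.mul_right (g : ℤ)
        rw [hg] at h3 ⊢
        exact dvd_of_dvd_of_eq (dvd_add (dvd_add h1 h2) h3) (by ring)
      have e3 : (81 : ℤ) ∣ (r : ℤ) ^ (r ^ s % 81 + s) - (r * g + 27 * u) := by
        have := (Nat.modEq_iff_dvd.mp (Nat.ModEq.symm (hres : _ ≡ _ [MOD 81])))
        exact_mod_cast this
      have := dvd_sub (dvd_add e1 e3) e2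
      rw [show ((3 : ℕ) : ℤ) ^ (3 + 1) = 81 by norm_num]
      exact dvd_of_dvd_of_eq this (by push_cast; ring)

end MacdonaldPair


/-! ### Valuations of powers and geometric sums -/

/-- If `p ^ j ∣ k` and `p ^ m ∣ α - 1`, then `p ^ (j + m) ∣ α ^ k - 1`. -/
theorem pow_dvd_pow_sub_one {p m j k : ℕ} {α : ℤ} (hm : 1 ≤ m) (h : (p : ℤ) ^ m ∣ α - 1)
    (hk : p ^ j ∣ k) : (p : ℤ) ^ (j + m) ∣ α ^ k - 1 := by
  induction j generalizing k with
  | zero => rw [zero_add]; exact h.trans (by simpa using sub_dvd_pow_sub_pow α 1 k)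
  | succ j ih =>
    obtain ⟨k', rfl⟩ := (pow_dvd_pow p (Nat.le_succ j)).trans hk
    rcases Nat.eq_zero_or_pos p with rfl | hp
    · simp at hk; rcases hk with h | h
      · simp [h]
      · simp [h]
    obtain ⟨k'', rfl⟩ : p ∣ k' := by
      rw [pow_succ] at hk
      exact Nat.dvd_of_mul_dvd_mul_left (pow_pos hp j) hk
    have h1 := ih (k := p ^ j * k'') (dvd_mul_right _ _)
    have h2 : (p : ℤ) ∣ geomSum (α ^ (p ^ j * k'')) p := by
      refine (dvd_sub_left (dvd_refl _)).mp (dvd_geomSum_of_dvd ?_ p)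
      exact (dvd_pow_self _ (by omega)).trans h1
    have h3 := geomSum_mul (α ^ (p ^ j * k'')) p
    rw [show p ^ j * (p * k'') = (p ^ j * k'') * p by ring, pow_mul α (p ^ j * k'') p, ← h3,
      show j + 1 + m = 1 + (j + m) by ring, pow_add, pow_one]
    exact mul_dvd_mul h2 h1

theorem emultiplicity_sub_one {p m : ℕ} (hp : p.Prime) {α v : ℤ}
    (hα : α - 1 = p ^ m * v) (hv : IsCoprime v p) : emultiplicity (p : ℤ) (α - 1) = m := by
  rw [emultiplicity_eq_coe]
  refine ⟨⟨v, hα⟩, fun h => ?_⟩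
  rw [hα, pow_succ] at h
  have h1 : (p : ℤ) ∣ v :=
    Int.dvd_of_mul_dvd_mul_left (pow_ne_zero m (by exact_mod_cast hp.ne_zero)) h
  have := (hv.isUnit_of_dvd' h1 dvd_rfl)
  exact (Nat.prime_iff_prime_int.mp hp).not_isUnit this

/-- The exact power of `p` dividing `α ^ k - 1`. -/
theorem pow_dvd_of_pow_dvd_pow_sub_one {p m j k : ℕ} (hp : p.Prime) {α v : ℤ} (hm : 1 ≤ m)
    (hm2 : p = 2 → 2 ≤ m) (hα : α - 1 = p ^ m * v) (hv : IsCoprime v p)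
    (h : (p : ℤ) ^ (j + m) ∣ α ^ k - 1) : p ^ j ∣ k := by
  have hαp := MacdonaldPair.isCoprime_of_sub_one_eq hm hα
  have hnd : ¬ (p : ℤ) ∣ α := fun hd =>
    (Nat.prime_iff_prime_int.mp hp).not_isUnit (hαp.isUnit_of_dvd' hd dvd_rfl)
  have hpd : (p : ℤ) ∣ α - 1 := by rw [hα]; exact (dvd_pow_self _ (by omega)).mul_right _
  -- Lifting the exponent; at the prime `2` it requires `4 ∣ α - 1`, hence `m ≥ 2`.
  have key : emultiplicity (p : ℤ) (α ^ k - 1 ^ k) =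
      emultiplicity (p : ℤ) (α - 1) + emultiplicity p k := by
    by_cases h2 : p = 2
    · subst h2
      have h4 : (4 : ℤ) ∣ α - 1 := by
        rw [hα]; refine Dvd.dvd.mul_right ?_ v
        have := pow_dvd_pow (2 : ℤ) (hm2 rfl)
        norm_num at this; exact_mod_cast this
      have := Int.two_pow_sub_pow' (x := α) (y := 1) k h4 (by exact_mod_cast hnd)
      rw [← Int.natCast_emultiplicity 2 k]
      exact_mod_cast this
    · exact Int.emultiplicity_pow_sub_pow hp (hp.odd_of_ne_two h2) hpd hnd k
  rw [one_pow, emultiplicity_sub_one hp hα hv] at key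
  have h1 := le_emultiplicity_of_pow_dvd h
  rw [key] at h1
  apply pow_dvd_of_le_emultiplicity
  have h2 : ((m : ℕ) : ℕ∞) + j ≤ m + emultiplicity p k := by
    refine le_trans (le_of_eq ?_) h1; push_cast; ring
  exact (ENat.add_le_add_iff_left (ENat.natCast_ne_top m)).mp h2

/-- For odd `p`, if `p ^ j ∣ k` and `p ^ m ∣ α - 1`, then `p ^ (j + m)` divides
`1 + α + ⋯ + α ^ (k - 1) - k`. -/
theorem pow_dvd_geomSum_sub {p m j k : ℕ} (hp : p.Prime) (hp2 : p ≠ 2) {α : ℤ} (hm : 1 ≤ m)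
    (h : (p : ℤ) ^ m ∣ α - 1) (hk : p ^ j ∣ k) : (p : ℤ) ^ (j + m) ∣ geomSum α k - k := by
  induction j generalizing k with
  | zero =>
    rw [zero_add]
    have := dvd_geomSum_of_dvd (r := p ^ m) (by push_cast; exact h) k
    exact_mod_cast this
  | succ j ih =>
    obtain ⟨c, rfl⟩ := hk
    have h1 := ih (k := p ^ j * c) (dvd_mul_right _ _)
    have h2 := pow_dvd_pow_sub_one hm h (dvd_mul_right (p ^ j) c)
    set k' := p ^ j * c
    have hk' : p ^ (j + 1) * c = p * k' := by rw [pow_succ]; ring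
    rw [hk', geomSum_mul_index]
    have h3 : (p : ℤ) ^ (j + 1 + m) ∣ geomSum (α ^ k') p - p := by
      obtain ⟨x, hx⟩ := h2
      have hβ : α ^ k' = 1 + p ^ (j + m) * x := by linarith
      have h4 : ∀ n : ℕ, (p : ℤ) ^ (2 * (j + m)) ∣
          geomSum (α ^ k') n - (n + p ^ (j + m) * x * (n.choose 2 : ℕ)) := by
        intro n
        induction n with
        | zero => simp [geomSum]
        | succ n ih =>
          obtain ⟨y, hy⟩ := ih
          have hc : ((n + 1).choose 2 : ℤ) = n + (n.choose 2 : ℕ) := by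
            rw [Nat.choose_succ_succ' n 1]; simp
          rw [geomSum_succ, hc]
          refine ⟨y * α ^ k' + x ^ 2 * (n.choose 2 : ℕ), ?_⟩
          push_cast
          rw [two_mul (j + m), pow_add] at hy ⊢
          rw [hβ] at hy ⊢
          linear_combination (1 + (p : ℤ) ^ (j + m) * x) * hy
      have hc : (p : ℤ) ∣ (p.choose 2 : ℕ) := by
        exact_mod_cast hp.dvd_choose_self (by norm_num) (lt_of_le_of_ne hp.two_le (Ne.symm hp2))
      have h5 : (p : ℤ) ^ (j + 1 + m) ∣ p ^ (j + m) * x * (p.choose 2 : ℕ) := by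
        rw [show j + 1 + m = (j + m) + 1 by ring, pow_succ, mul_assoc]
        exact mul_dvd_mul_left _ (hc.mul_left x)
      rcases Nat.lt_or_ge (j + m) 1 with h6 | h6
      · omega
      exact dvd_of_dvd_of_eq (dvd_add ((pow_dvd_pow _ (by omega)).trans (h4 p)) h5) (by ring)
    have h7 : (p : ℤ) ^ (j + 1 + m) ∣ p * (geomSum α k' - k') := by
      rw [show j + 1 + m = (j + m) + 1 by ring, pow_succ']
      exact mul_dvd_mul_left _ h1
    exact dvd_of_dvd_of_eq (dvd_add (h3.mul_left (geomSum α k')) h7) (by push_cast; ring)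


/-! ### Commutation modulo a normal subgroup -/

section Quotient

variable {G : Type*} [Group G]

theorem commute_mk_iff {N : Subgroup G} [N.Normal] {x y : G} :
    Commute (x : G ⧸ N) (y : G ⧸ N) ↔ gcomm x y ∈ N := by
  rw [← QuotientGroup.eq_one_iff]
  simp only [gcomm, QuotientGroup.mk_mul, QuotientGroup.mk_inv]
  constructor
  · intro h
    rw [mul_assoc, h.eq]; group
  · intro h
    have := eq_inv_of_mul_eq_one_right (a := ((x : G ⧸ N))⁻¹ * (y : G ⧸ N)⁻¹)
      (b := (x : G ⧸ N) * (y : G ⧸ N)) (by rw [← h]; group)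
    rw [Commute, SemiconjBy, this]; group

/-- Being central modulo `N` can be tested on generators. Conjugation then changes an element by a
factor in `N`, which lies in the closure, so the closure is normal. -/
theorem closure_normal_of_commute_mk {N : Subgroup G} [N.Normal] {A B : G}
    (hgen : Subgroup.closure {A, B} = ⊤) {S : Set G} (hN : N ≤ Subgroup.closure S)
    (hS : ∀ s ∈ S, Commute (s : G ⧸ N) (A : G ⧸ N) ∧ Commute (s : G ⧸ N) (B : G ⧸ N)) :
    (Subgroup.closure S).Normal ∧
      ∀ x ∈ Subgroup.closure S, ∀ g : G, Commute (x : G ⧸ N) (g : G ⧸ N) := by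
  have hgen' : Subgroup.closure {(A : G ⧸ N), (B : G ⧸ N)} = ⊤ := by
    have := closure_map_eq_top hgen (QuotientGroup.mk'_surjective N)
    simpa using this
  have hc : Subgroup.closure S ≤ (Subgroup.center (G ⧸ N)).comap (QuotientGroup.mk' N) := by
    rw [Subgroup.closure_le]
    intro s hs
    exact mem_center_of_commute hgen' (hS s hs).1.symm (hS s hs).2.symm
  have hc' : ∀ x ∈ Subgroup.closure S, ∀ g : G, Commute (x : G ⧸ N) (g : G ⧸ N) :=
    fun x hx g => (Subgroup.mem_center_iff.mp (hc hx) (g : G ⧸ N)).symm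
  refine ⟨⟨fun x hx g => ?_⟩, hc'⟩
  have h1 : gcomm x g⁻¹ ∈ N := commute_mk_iff.mp (hc' x hx g⁻¹)
  have : g * x * g⁻¹ = x * gcomm x g⁻¹ := by simp [gcomm, mul_assoc]
  rw [this]
  exact mul_mem hx (hN h1)

/-- Elements of a subgroup generated by two commuting elements of finite order modulo `N`. -/
theorem exists_pow_mul_pow_mul {N : Subgroup G} [N.Normal] {x y : G} {S : Set G} {n : ℕ}
    (hx : x ^ n = 1) (hy : y ^ n = 1) (hn : 0 < n) (hxy : Commute (x : G ⧸ N) (y : G ⧸ N))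
    (hS : ∀ s ∈ S, s = x ∨ s = y ∨ s ∈ N) {g : G} (hg : g ∈ Subgroup.closure S) :
    ∃ (i k : ℕ), ∃ h ∈ N, g = x ^ i * y ^ k * h := by
  suffices H : ∃ i k : ℕ, (g : G ⧸ N) = (x : G ⧸ N) ^ i * (y : G ⧸ N) ^ k by
    obtain ⟨i, k, h⟩ := H
    refine ⟨i, k, (x ^ i * y ^ k)⁻¹ * g, ?_, by group⟩
    exact (QuotientGroup.eq (s := N)).mp (by rw [h]; rfl)
  have hx' : (x : G ⧸ N) ^ n = 1 := by rw [← QuotientGroup.mk_pow, hx]; rfl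
  have hy' : (y : G ⧸ N) ^ n = 1 := by rw [← QuotientGroup.mk_pow, hy]; rfl
  induction hg using Subgroup.closure_induction with
  | mem s hs =>
    rcases hS s hs with rfl | rfl | h
    · exact ⟨1, 0, by simp⟩
    · exact ⟨0, 1, by simp⟩
    · exact ⟨0, 0, by simpa using h⟩
  | one => exact ⟨0, 0, by simp⟩
  | mul a b _ _ iha ihb =>
    obtain ⟨i, k, h⟩ := iha
    obtain ⟨i', k', h'⟩ := ihb
    refine ⟨i + i', k + k', ?_⟩
    rw [QuotientGroup.mk_mul, h, h', pow_add, pow_add, mul_assoc, mul_assoc, ← mul_assoc (_ ^ k),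
      ← (hxy.pow_pow i' k).eq, mul_assoc]
  | inv a _ iha =>
    obtain ⟨i, k, h⟩ := iha
    -- Exponents are natural numbers, so inverses are taken through `x ^ n = 1` and `y ^ n = 1`.
    refine ⟨(n - 1) * i, (n - 1) * k, ?_⟩
    rw [QuotientGroup.mk_inv, h, inv_eq_iff_mul_eq_one]
    have e1 : i + (n - 1) * i = n * i := by
      obtain ⟨n', rfl⟩ : ∃ n', n = n' + 1 := ⟨n - 1, by omega⟩
      simp; ring
    have e2 : k + (n - 1) * k = n * k := by
      obtain ⟨n', rfl⟩ : ∃ n', n = n' + 1 := ⟨n - 1, by omega⟩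
      simp; ring
    rw [mul_assoc, ← mul_assoc (_ ^ k), ← (hxy.pow_pow _ k).eq, mul_assoc, ← pow_add, ← mul_assoc,
      ← pow_add, e1, e2, pow_mul, pow_mul, hx', hy']
    simp

end Quotient

/-- If a power of `A`, not a `p ^ M`-th power, lies in `H`, so does `A ^ p ^ (M - 1)`. -/
theorem pow_mem_of_not_dvd {G : Type*} [Group G] {p K M : ℕ} (hp : p.Prime) {A : G}
    (hA : A ^ p ^ K = 1) {H : Subgroup G} {i : ℕ} (hi : A ^ i ∈ H) (hM : ¬ p ^ M ∣ i) :
    A ^ p ^ (M - 1) ∈ H := by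
  obtain ⟨e, he, hgcd⟩ := (Nat.dvd_prime_pow hp).mp (Nat.gcd_dvd_right i (p ^ K))
  have heM : e < M := by
    by_contra hlt
    exact hM ((pow_dvd_pow p (not_lt.mp hlt)).trans (hgcd ▸ Nat.gcd_dvd_left i (p ^ K)))
  have h1 : A ^ p ^ e ∈ H := by
    have := Nat.gcd_eq_gcd_ab i (p ^ K)
    rw [hgcd] at this
    rw [← zpow_natCast, this, zpow_add, zpow_mul, zpow_mul, zpow_natCast, zpow_natCast, hA,
      one_zpow, mul_one]
    exact zpow_mem hi _
  obtain ⟨d, hd⟩ := pow_dvd_pow p (show e ≤ M - 1 by omega)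
  rw [hd, pow_mul]
  exact pow_mem h1 d

namespace MacdonaldPair

variable {G : Type*} [Group G] {α : ℤ} {A B : G}

/-- `conj_pow` with `A ^ (-n)` moved across `C ^ n`. The move contributes `n (1 - α ^ n)` and the
geometric sum the rest, two quantities whose valuations are estimated separately. -/
theorem gcomm_pow_left (h : MacdonaldPair α A B) (n : ℕ) :
    gcomm (A ^ n) B = gcomm A B ^ n * A ^ (n * (1 - α ^ n) + (α * geomSum α n - n)) := by
  have h1 : gcomm (A ^ n) B = (A ^ n)⁻¹ * (B⁻¹ * A ^ n * B) := by simp [gcomm, mul_assoc]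
  have h2 := h.zpow_mul_comm_pow (-n) n
  rw [h1, h.conj_pow, ← mul_assoc, ← zpow_natCast, ← zpow_neg, h2, mul_assoc, ← zpow_add]
  congr 2; ring

theorem gcomm_comm_pow_left (h : MacdonaldPair α A B) (n : ℕ) :
    gcomm (gcomm A B ^ n) A = A ^ (1 - α ^ n) := by
  have h2 := h.zpow_mul_comm_pow 1 n
  rw [zpow_one, mul_one] at h2
  have h3 : A⁻¹ * gcomm A B ^ n = gcomm A B ^ n * (A ^ α ^ n)⁻¹ := by
    rw [inv_mul_eq_iff_eq_mul, ← mul_assoc, h2]; group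
  have : gcomm (gcomm A B ^ n) A = (gcomm A B ^ n)⁻¹ * (A⁻¹ * gcomm A B ^ n) * A := by
    simp only [gcomm, mul_assoc]
  rw [this, h3, zpow_sub, zpow_one, ← mul_assoc, inv_mul_cancel, one_mul]
  exact ((Commute.refl A).zpow_left _).inv_left.eq

end MacdonaldPair

/-- The subgroup generated by `A ^ a`, `B ^ a` and `[A, B] ^ c`. -/
def powClosure {G : Type*} [Group G] (A B : G) (a c : ℕ) : Subgroup G :=
  Subgroup.closure {A ^ a, B ^ a, gcomm A B ^ c}

namespace powClosure

variable {G : Type*} [Group G] {A B : G} {a c : ℕ}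

theorem left_mem {i : ℕ} (h : a ∣ i) : A ^ i ∈ powClosure A B a c := by
  obtain ⟨k, rfl⟩ := h
  rw [pow_mul]; exact pow_mem (Subgroup.subset_closure (by simp)) k

theorem right_mem {i : ℕ} (h : a ∣ i) : B ^ i ∈ powClosure A B a c := by
  obtain ⟨k, rfl⟩ := h
  rw [pow_mul]; exact pow_mem (Subgroup.subset_closure (by simp)) k

theorem comm_mem {i : ℕ} (h : c ∣ i) : gcomm A B ^ i ∈ powClosure A B a c := by
  obtain ⟨k, rfl⟩ := h
  rw [pow_mul]; exact pow_mem (Subgroup.subset_closure (by simp)) k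

theorem zpow_left_mem {i : ℤ} (h : (a : ℤ) ∣ i) : A ^ i ∈ powClosure A B a c := by
  obtain ⟨k, rfl⟩ := h
  rw [zpow_mul, zpow_natCast]; exact zpow_mem (Subgroup.subset_closure (by simp)) k

theorem zpow_right_mem {i : ℤ} (h : (a : ℤ) ∣ i) : B ^ i ∈ powClosure A B a c := by
  obtain ⟨k, rfl⟩ := h
  rw [zpow_mul, zpow_natCast]; exact zpow_mem (Subgroup.subset_closure (by simp)) k

theorem le_iff {H : Subgroup G} :
    powClosure A B a c ≤ H ↔ A ^ a ∈ H ∧ B ^ a ∈ H ∧ gcomm A B ^ c ∈ H := by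
  rw [powClosure, Subgroup.closure_le, Set.insert_subset_iff, Set.insert_subset_iff,
    Set.singleton_subset_iff]
  rfl

theorem mono {a' c' : ℕ} (ha : a ∣ a') (hc : c ∣ c') :
    powClosure A B a' c' ≤ powClosure A B a c :=
  le_iff.mpr ⟨left_mem ha, right_mem ha, comm_mem hc⟩

theorem swap : powClosure B A a c = powClosure A B a c := by
  apply le_antisymm
  · refine le_iff.mpr ⟨right_mem dvd_rfl, left_mem dvd_rfl, ?_⟩
    rw [← gcomm_inv A B, inv_pow]; exact inv_mem (comm_mem dvd_rfl)
  · refine le_iff.mpr ⟨right_mem dvd_rfl, left_mem dvd_rfl, ?_⟩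
    rw [← gcomm_inv B A, inv_pow]; exact inv_mem (comm_mem dvd_rfl)

end powClosure


/-! ### The candidate central series for odd `p` -/

/-- A Macdonald pair generating a `p`-group with `p` odd, in which `A` has order
`p ^ (m * (T + 1))` and `A ^ p ^ (m * T)` is central. -/
structure RegularPair {G : Type*} [Group G] (p m T : ℕ) (α : ℤ) (A B : G) : Prop where
  pair : MacdonaldPair α A B
  prime : p.Prime
  ne_two : p ≠ 2
  one_le : 1 ≤ m
  exists_sub_one : ∃ v : ℤ, α - 1 = p ^ m * v ∧ IsCoprime v p
  gen : Subgroup.closure {A, B} = ⊤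
  comm : Commute B (A ^ (p ^ m) ^ T)
  mul_eq : A ^ (p ^ m) ^ T * B ^ (p ^ m) ^ T = 1
  pow_eq_one_iff : ∀ k, A ^ k = 1 ↔ (p ^ m) ^ (T + 1) ∣ k

namespace RegularPair

variable {G : Type*} [Group G] {p m T : ℕ} {α : ℤ} {A B : G}

theorem right_pow_eq (h : RegularPair p m T α A B) {n : ℕ} (hn : (p ^ m) ^ T ∣ n) :
    B ^ n = (A ^ n)⁻¹ := by
  obtain ⟨k, rfl⟩ := hn
  rw [pow_mul, pow_mul, ← inv_eq_of_mul_eq_one_right h.mul_eq, inv_pow]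

theorem base_pos (h : RegularPair p m T α A B) : 0 < p ^ m := pow_pos h.prime.pos m

theorem swap (h : RegularPair p m T α A B) : RegularPair p m T α B A where
  pair := h.pair.swap
  prime := h.prime
  ne_two := h.ne_two
  one_le := h.one_le
  exists_sub_one := h.exists_sub_one
  gen := by rw [Set.pair_comm]; exact h.gen
  comm := by
    rw [h.right_pow_eq dvd_rfl]
    exact ((Commute.refl A).pow_right _).inv_right
  mul_eq := by rw [h.right_pow_eq dvd_rfl]; simp
  pow_eq_one_iff := by
    intro k
    obtain ⟨M, hM⟩ : ∃ M, m * (T + 1) = M + 1 := by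
      have : 0 < m * (T + 1) := Nat.mul_pos h.one_le (Nat.succ_pos T)
      exact ⟨m * (T + 1) - 1, by omega⟩
    have := Fact.mk h.prime
    have hr : (p ^ m) ^ (T + 1) = p ^ (M + 1) := by rw [← pow_mul, hM]
    have hB : orderOf B = p ^ (M + 1) := by
      apply orderOf_eq_prime_pow
      · rw [h.right_pow_eq, inv_eq_one, h.pow_eq_one_iff, hr]
        · exact fun hd => absurd (Nat.le_of_dvd (pow_pos h.prime.pos M) hd)
            (not_le.mpr (Nat.pow_lt_pow_right h.prime.one_lt (Nat.lt_succ_self M)))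
        · rw [← pow_mul]
          have := h.one_le
          exact pow_dvd_pow p (by rw [mul_add] at hM; omega)
      · rw [← hr, h.right_pow_eq (pow_dvd_pow _ (Nat.le_succ T)), inv_eq_one, h.pow_eq_one_iff]
    rw [← orderOf_dvd_iff_pow_eq_one, hB, hr]

theorem dvd_one_sub_pow (h : RegularPair p m T α A B) {n u : ℕ} (hn : (p ^ m) ^ u ∣ n) :
    (((p ^ m) ^ (u + 1) : ℕ) : ℤ) ∣ 1 - α ^ n := by
  obtain ⟨v, hv, -⟩ := h.exists_sub_one
  rw [← pow_mul] at hn ⊢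
  rw [dvd_sub_comm]
  have := pow_dvd_pow_sub_one h.one_le ⟨v, hv⟩ hn
  push_cast
  rwa [mul_add, mul_one]

theorem dvd_of_dvd_one_sub_pow (h : RegularPair p m T α A B) {n u : ℕ}
    (hn : (((p ^ m) ^ (u + 1) : ℕ) : ℤ) ∣ 1 - α ^ n) : (p ^ m) ^ u ∣ n := by
  obtain ⟨v, hv, hvp⟩ := h.exists_sub_one
  rw [dvd_sub_comm, ← pow_mul, mul_add, mul_one] at hn
  rw [← pow_mul]
  exact pow_dvd_of_pow_dvd_pow_sub_one h.prime h.one_le (fun h2 => absurd h2 h.ne_two) hv hvp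
    (by push_cast at hn; exact hn)

/-- The exponent of `A` in `[A ^ n, B]` is divisible by `p ^ (j + m)` if `p ^ j ∣ n`. -/
theorem dvd_exponent (h : RegularPair p m T α A B) {n j : ℕ} (hn : p ^ j ∣ n) :
    ((p ^ (j + m) : ℕ) : ℤ) ∣ n * (1 - α ^ n) + (α * geomSum α n - n) := by
  obtain ⟨v, hv, -⟩ := h.exists_sub_one
  have h1 := pow_dvd_pow_sub_one h.one_le ⟨v, hv⟩ hn
  have h2 := pow_dvd_geomSum_sub h.prime h.ne_two h.one_le ⟨v, hv⟩ hn
  push_cast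
  have h3 := geomSum_mul α n
  exact dvd_of_dvd_of_eq (dvd_add (h1.mul_left (1 - (n : ℤ))) h2) (by linear_combination h3)

theorem dvd_exponent' (h : RegularPair p m T α A B) {n u : ℕ} (hn : (p ^ m) ^ u ∣ n) :
    (((p ^ m) ^ (u + 1) : ℕ) : ℤ) ∣ n * (1 - α ^ n) + (α * geomSum α n - n) := by
  rw [← pow_mul] at hn ⊢
  rw [mul_add, mul_one]; exact h.dvd_exponent hn

theorem left_pow_eq_one (h : RegularPair p m T α A B) : A ^ (p ^ m) ^ (T + 1) = 1 :=
  (h.pow_eq_one_iff _).mpr dvd_rfl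

/-- `[A ^ q ^ T, B]` is trivial by centrality, and in its expansion the power of `A` has exponent
divisible by the order `q ^ (T + 1)`. -/
theorem comm_pow_eq_one (h : RegularPair p m T α A B) : gcomm A B ^ (p ^ m) ^ T = 1 := by
  have h1 := h.pair.gcomm_pow_left ((p ^ m) ^ T)
  have h2 : gcomm (A ^ (p ^ m) ^ T) B = 1 := by
    rw [gcomm, mul_assoc, ← h.comm.eq]; group
  obtain ⟨k, hk⟩ := h.dvd_exponent' (dvd_refl ((p ^ m) ^ T))
  rw [h2, hk, zpow_mul, zpow_natCast, h.left_pow_eq_one] at h1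
  simpa using h1.symm

/-- The candidates for the terms of the central series. -/
def term (p m : ℕ) (A B : G) (a c : ℕ) : Subgroup G := powClosure A B ((p ^ m) ^ a) ((p ^ m) ^ c)

theorem term_swap (a c : ℕ) : term p m B A a c = term p m A B a c := powClosure.swap

theorem term_mono {a c a' c' : ℕ} (ha : a ≤ a') (hc : c ≤ c') :
    term p m A B a' c' ≤ term p m A B a c :=
  powClosure.mono (pow_dvd_pow _ ha) (pow_dvd_pow _ hc)

theorem term_bot (h : RegularPair p m T α A B) : term p m A B (T + 1) T = ⊥ := by
  rw [eq_bot_iff]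
  refine powClosure.le_iff.mpr ⟨?_, ?_, ?_⟩
  · rw [h.left_pow_eq_one]; exact one_mem _
  · rw [h.swap.left_pow_eq_one]; exact one_mem _
  · rw [h.comm_pow_eq_one]; exact one_mem _

theorem term_top (h : RegularPair p m T α A B) (c : ℕ) : term p m A B 0 c = ⊤ := by
  rw [eq_top_iff, ← h.gen, Subgroup.closure_le]
  rintro x (rfl | rfl)
  · have : x ^ 1 ∈ term p m x B 0 c := powClosure.left_mem (by simp)
    rwa [pow_one] at this
  · have : x ^ 1 ∈ term p m A x 0 c := powClosure.right_mem (by simp)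
    rwa [pow_one] at this

/-- The generators of a term are central modulo the next one. -/
theorem gcomm_mem (h : RegularPair p m T α A B) {a c : ℕ} (hca : c ≤ a) {n : ℕ}
    (hn : (p ^ m) ^ a ∣ n) : gcomm (A ^ n) B ∈ term p m A B (c + 1) a := by
  rw [h.pair.gcomm_pow_left]
  refine mul_mem (powClosure.comm_mem hn) (powClosure.zpow_left_mem ?_)
  exact (by exact_mod_cast pow_dvd_pow (p ^ m) (by omega) : (((p ^ m) ^ (c + 1) : ℕ) : ℤ) ∣
    ((p ^ m) ^ (a + 1) : ℕ)).trans (h.dvd_exponent' hn)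

theorem gcomm_comm_mem (h : RegularPair p m T α A B) {a c : ℕ} {n : ℕ}
    (hn : (p ^ m) ^ c ∣ n) : gcomm (gcomm A B ^ n) A ∈ term p m A B (c + 1) a := by
  rw [h.pair.gcomm_comm_pow_left]
  exact powClosure.zpow_left_mem (h.dvd_one_sub_pow hn)

/-- `[A ^ q ^ a, B]` is `C ^ q ^ a` times a power of `A ^ q ^ (a + 1)`, and `[C ^ q ^ c, A]` is a
power of `A ^ q ^ (c + 1)`. So commutation moves the indices `(a, c)` to `(c + 1, a)`. -/
theorem commute_mk_term (h : RegularPair p m T α A B) {a c : ℕ} (hca : c ≤ a) (hac : a ≤ c + 1)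
    [(term p m A B (c + 1) a).Normal] :
    (term p m A B a c).Normal ∧ ∀ x ∈ term p m A B a c, ∀ g : G,
      Commute (x : G ⧸ term p m A B (c + 1) a) (g : G ⧸ term p m A B (c + 1) a) := by
  refine closure_normal_of_commute_mk h.gen (term_mono hac hca) ?_
  rintro s (rfl | rfl | rfl)
  · refine ⟨?_, commute_mk_iff.mpr (h.gcomm_mem hca dvd_rfl)⟩
    rw [QuotientGroup.mk_pow]; exact (Commute.refl _).pow_left _
  · refine ⟨commute_mk_iff.mpr ?_, ?_⟩
    · have := h.swap.gcomm_mem hca (dvd_refl ((p ^ m) ^ a))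
      rwa [term_swap] at this
    · rw [QuotientGroup.mk_pow]; exact (Commute.refl _).pow_left _
  · refine ⟨commute_mk_iff.mpr (h.gcomm_comm_mem dvd_rfl), ?_⟩
    have h1 := h.swap.gcomm_comm_mem (a := a) (dvd_refl ((p ^ m) ^ c))
    rw [term_swap, ← gcomm_inv A B, ← commute_mk_iff, inv_pow, QuotientGroup.mk_inv] at h1
    exact Commute.inv_left_iff.mp h1

/-- The terms, in increasing order. -/
def series (p m T : ℕ) (A B : G) (j : ℕ) : Subgroup G :=
  term p m A B (T + 1 - (j + 1) / 2) (T - j / 2)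

theorem series_zero (h : RegularPair p m T α A B) : series p m T A B 0 = ⊥ := by
  simpa [series] using h.term_bot

theorem series_top (h : RegularPair p m T α A B) {j : ℕ} (hj : 2 * T + 1 ≤ j) :
    series p m T A B j = ⊤ := by
  rw [series, show T + 1 - (j + 1) / 2 = 0 by omega]; exact h.term_top _

theorem series_succ {j : ℕ} (hj : j ≤ 2 * T) : ∃ a c, c ≤ a ∧ a ≤ c + 1 ∧ a ≤ T ∧
    series p m T A B (j + 1) = term p m A B a c ∧ series p m T A B j = term p m A B (c + 1) a := by
  refine ⟨T - j / 2, T - (j + 1) / 2, by omega, by omega, by omega, ?_, ?_⟩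
  · rw [series]; congr 1; omega
  · rw [series]; congr 1; omega

theorem series_normal (h : RegularPair p m T α A B) (j : ℕ) : (series p m T A B j).Normal := by
  induction j with
  | zero => rw [h.series_zero]; infer_instance
  | succ j ih =>
    rcases Nat.lt_or_ge (2 * T) j with hj | hj
    · rw [h.series_top (by omega)]; infer_instance
    · obtain ⟨a, c, h1, h2, -, h4, h5⟩ := series_succ (p := p) (m := m) (A := A) (B := B) hj
      rw [h5] at ih
      rw [h4]
      exact (h.commute_mk_term h1 h2).1

theorem series_mono (j : ℕ) :
    series p m T A B j ≤ series p m T A B (j + 1) :=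
  term_mono (by omega) (by omega)

theorem gcomm_mem_series (h : RegularPair p m T α A B) (j : ℕ) {x : G}
    (hx : x ∈ series p m T A B (j + 1)) (g : G) : gcomm x g ∈ series p m T A B j := by
  rcases Nat.lt_or_ge (2 * T) j with hj | hj
  · rw [h.series_top (by omega)]; trivial
  · obtain ⟨a, c, h1, h2, -, h4, h5⟩ := series_succ (p := p) (m := m) (A := A) (B := B) hj
    have := h.series_normal j
    rw [h5] at this ⊢
    rw [h4] at hx
    exact commute_mk_iff.mp ((h.commute_mk_term h1 h2).2 x hx g)

theorem commute_mk_series (h : RegularPair p m T α A B) (j : ℕ) {x : G}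
    (hx : x ∈ series p m T A B (j + 1)) (g : G) [(series p m T A B j).Normal] :
    Commute (x : G ⧸ series p m T A B j) (g : G ⧸ series p m T A B j) :=
  commute_mk_iff.mpr (h.gcomm_mem_series j hx g)

/-- The key facts on the powers of `A` and `[A, B]` in the terms. -/
theorem dvd_of_mem_term (h : RegularPair p m T α A B) {u : ℕ} (hu : u ≤ T) :
    (∀ i : ℕ, A ^ i ∈ term p m A B (u + 1) u → (p ^ m) ^ (u + 1) ∣ i) ∧
      ∀ k : ℕ, gcomm A B ^ k ∈ term p m A B u u → (p ^ m) ^ u ∣ k := by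
  have zpw : ∀ {u : ℕ}, (∀ i : ℕ, A ^ i ∈ term p m A B (u + 1) u → (p ^ m) ^ (u + 1) ∣ i) →
      ∀ i : ℤ, A ^ i ∈ term p m A B (u + 1) u → (((p ^ m) ^ (u + 1) : ℕ) : ℤ) ∣ i := by
    intro u hu i hi
    rw [← Int.dvd_natAbs]
    refine Int.natCast_dvd_natCast.mpr (hu _ ?_)
    rcases Int.natAbs_eq i with hi' | hi'
    · rw [← zpow_natCast, ← hi']; exact hi
    · rw [hi', zpow_neg, inv_mem_iff, zpow_natCast] at hi; exact hi
  -- `[C ^ k, A] = A ^ (1 - α ^ k)` lies one term lower, and lifting the exponent recovers the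
  -- valuation of `k` from that of `1 - α ^ k`.
  have second : ∀ {u : ℕ}, u ≤ T →
      (∀ i : ℕ, A ^ i ∈ term p m A B (u + 1) u → (p ^ m) ^ (u + 1) ∣ i) →
      ∀ k : ℕ, gcomm A B ^ k ∈ term p m A B u u → (p ^ m) ^ u ∣ k := by
    intro u hu h1 k hk
    have h3 := h.gcomm_mem_series (2 * (T - u)) (x := gcomm A B ^ k) (by
      rw [series, show T + 1 - (2 * (T - u) + 1 + 1) / 2 = u by omega,
        show T - (2 * (T - u) + 1) / 2 = u by omega]; exact hk) A
    rw [series, show T + 1 - (2 * (T - u) + 1) / 2 = u + 1 by omega,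
        show T - (2 * (T - u)) / 2 = u by omega, h.pair.gcomm_comm_pow_left] at h3
    exact h.dvd_of_dvd_one_sub_pow (zpw h1 _ h3)
  induction hd : T - u generalizing u with
  | zero =>
    obtain rfl : u = T := by omega
    have h1 : ∀ i : ℕ, A ^ i ∈ term p m A B (u + 1) u → (p ^ m) ^ (u + 1) ∣ i := by
      intro i hi
      rw [h.term_bot, Subgroup.mem_bot] at hi
      exact (h.pow_eq_one_iff i).mp hi
    exact ⟨h1, second hu h1⟩
  | succ d ih =>
    have hC := (ih (u := u + 1) (by omega) (by omega)).2
    have h1 : ∀ i : ℕ, A ^ i ∈ term p m A B (u + 1) u → (p ^ m) ^ (u + 1) ∣ i := by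
      intro i hi
      -- Otherwise the term contains `A ^ p ^ M` with `p ^ (M + 1) = q ^ (u + 1)`. Commuting with
      -- `B` puts `C ^ p ^ M` into `term (u + 1) (u + 1)`, against the statement already known for
      -- `u + 1`.
      by_contra hnd
      rw [← pow_mul] at hnd
      have hA : A ^ p ^ (m * (T + 1)) = 1 := by rw [pow_mul]; exact h.left_pow_eq_one
      have hn := pow_mem_of_not_dvd h.prime hA hi hnd
      obtain ⟨M, hM⟩ : ∃ M, m * (u + 1) = M + 1 := by
        have : 0 < m * (u + 1) := Nat.mul_pos h.one_le (Nat.succ_pos u)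
        exact ⟨m * (u + 1) - 1, by omega⟩
      rw [hM, Nat.add_sub_cancel] at hn
      have h3 := h.gcomm_mem_series (2 * (T - u) - 1) (x := A ^ p ^ M) (by
        rw [series, show T + 1 - (2 * (T - u) - 1 + 1 + 1) / 2 = u + 1 by omega,
          show T - (2 * (T - u) - 1 + 1) / 2 = u by omega]; exact hn) B
      rw [series, show T + 1 - (2 * (T - u) - 1 + 1) / 2 = u + 1 by omega,
        show T - (2 * (T - u) - 1) / 2 = u + 1 by omega, h.pair.gcomm_pow_left] at h3
      have h4 := h.dvd_exponent (dvd_refl (p ^ M))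
      have h5 := hC _ ((Subgroup.mul_mem_cancel_right _ (powClosure.zpow_left_mem (by
        refine Dvd.dvd.trans ?_ h4
        rw [← pow_mul, hM]
        have := h.one_le
        exact_mod_cast pow_dvd_pow p (by omega)))).mp h3)
      rw [← pow_mul, hM] at h5
      exact absurd (Nat.le_of_dvd (pow_pos h.prime.pos M) h5)
        (not_le.mpr (Nat.pow_lt_pow_right h.prime.one_lt (Nat.lt_succ_self M)))
    exact ⟨h1, second hu h1⟩

/-- For even `j`, modulo the middle term `g` is a power of `C`, whose exponent is read from the
commutator with `A`. For odd `j` it is `A ^ x B ^ y`: the commutator with `B` isolates `x`, the one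
with `A` isolates `y`. -/
theorem mem_series_of_gcomm_mem (h : RegularPair p m T α A B) {j : ℕ} (hj : j + 2 ≤ 2 * T + 1)
    {g : G} (hg : g ∈ series p m T A B (j + 2)) (hA : gcomm g A ∈ series p m T A B j)
    (hB : gcomm g B ∈ series p m T A B j) : g ∈ series p m T A B (j + 1) := by
  have n0 := h.series_normal j
  have n1 := h.series_normal (j + 1)
  have hpos : 0 < (p ^ m) ^ (T + 1) := pow_pos h.base_pos _
  have hA1 := h.left_pow_eq_one
  have hB1 := h.swap.left_pow_eq_one
  have hC1 : gcomm A B ^ (p ^ m) ^ (T + 1) = 1 := by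
    rw [pow_succ, pow_mul, h.comm_pow_eq_one, one_pow]
  have pw : ∀ {X : G} {n : ℕ} (k : ℕ), X ^ n = 1 → (X ^ k) ^ n = 1 := by
    intro X n k hX; rw [← pow_mul, mul_comm, pow_mul, hX, one_pow]
  have hgen : ∀ x ∈ series p m T A B (j + 2), ∀ y : G,
      Commute (x : G ⧸ series p m T A B (j + 1)) (y : G ⧸ series p m T A B (j + 1)) :=
    fun x hx y => h.commute_mk_series (j + 1) hx y
  have hcen : ∀ x ∈ series p m T A B (j + 1), ∀ y : G,
      Commute (x : G ⧸ series p m T A B j) (y : G ⧸ series p m T A B j) :=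
    fun x hx y => h.commute_mk_series j hx y
  rw [← commute_mk_iff] at hA hB
  rcases Nat.even_or_odd' j with ⟨t, rfl | rfl⟩
  · obtain ⟨u, rfl⟩ : ∃ u, T = t + 1 + u := ⟨T - t - 1, by omega⟩
    have e2 : series p m (t + 1 + u) A B (2 * t + 2) = term p m A B (u + 1) u := by
      rw [series]; congr 1 <;> omega
    have e1 : series p m (t + 1 + u) A B (2 * t + 1) = term p m A B (u + 1) (u + 1) := by
      rw [series]; congr 1 <;> omega
    have e0 : series p m (t + 1 + u) A B (2 * t) = term p m A B (u + 2) (u + 1) := by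
      rw [series]; congr 1 <;> omega
    rw [e2] at hg hgen
    obtain ⟨i, k, x, hx, rfl⟩ := exists_pow_mul_pow_mul (N := series p m (t + 1 + u) A B (2 * t + 1))
      (x := gcomm A B ^ (p ^ m) ^ u) (y := 1) (pw _ hC1) (one_pow _) hpos
      (Commute.one_right _) (by
        rw [e1]
        rintro s (rfl | rfl | rfl)
        · exact Or.inr (Or.inr (powClosure.left_mem dvd_rfl))
        · exact Or.inr (Or.inr (powClosure.right_mem dvd_rfl))
        · exact Or.inl rfl) hg
    rw [one_pow, mul_one, ← pow_mul (gcomm A B)] at hA ⊢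
    refine mul_mem ?_ hx
    rw [QuotientGroup.mk_mul] at hA
    have h1 := (hA.mul_left (hcen x hx A).inv_left)
    rw [mul_inv_cancel_right, commute_mk_iff, h.pair.gcomm_comm_pow_left, e0] at h1
    have h2 : ∀ z : ℤ, A ^ z ∈ term p m A B (u + 2) (u + 1) →
        (((p ^ m) ^ (u + 2) : ℕ) : ℤ) ∣ z := by
      intro z hz
      rw [← Int.dvd_natAbs]
      refine Int.natCast_dvd_natCast.mpr ((h.dvd_of_mem_term (u := u + 1) (by omega)).1 _ ?_)
      rcases Int.natAbs_eq z with hz' | hz'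
      · rw [← zpow_natCast, ← hz']; exact hz
      · rw [hz', zpow_neg, inv_mem_iff, zpow_natCast] at hz; exact hz
    rw [e1]
    exact powClosure.comm_mem (h.dvd_of_dvd_one_sub_pow (h2 _ h1))
  · obtain ⟨u, rfl⟩ : ∃ u, T = t + 1 + u := ⟨T - t - 1, by omega⟩
    have e2 : series p m (t + 1 + u) A B (2 * t + 1 + 2) = term p m A B u u := by
      rw [series]; congr 1 <;> omega
    have e1 : series p m (t + 1 + u) A B (2 * t + 1 + 1) = term p m A B (u + 1) u := by
      rw [series]; congr 1 <;> omega
    have e0 : series p m (t + 1 + u) A B (2 * t + 1) = term p m A B (u + 1) (u + 1) := by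
      rw [series]; congr 1 <;> omega
    rw [e2] at hg hgen
    obtain ⟨i, k, x, hx, rfl⟩ := exists_pow_mul_pow_mul
      (N := series p m (t + 1 + u) A B (2 * t + 1 + 1))
      (x := A ^ (p ^ m) ^ u) (y := B ^ (p ^ m) ^ u) (pw _ hA1) (pw _ hB1) hpos
      (hgen _ (powClosure.left_mem dvd_rfl) _) (by
        rw [e1]
        rintro s (rfl | rfl | rfl)
        · exact Or.inl rfl
        · exact Or.inr (Or.inl rfl)
        · exact Or.inr (Or.inr (powClosure.comm_mem dvd_rfl))) hg
    have key : ∀ {X Y : G}, RegularPair p m (t + 1 + u) α X Y → ∀ n : ℕ, (p ^ m) ^ u ∣ n →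
        gcomm (X ^ n) Y ∈ term p m X Y (u + 1) (u + 1) → (p ^ m) ^ (u + 1) ∣ n := by
      intro X Y hXY n hn hm
      rw [hXY.pair.gcomm_pow_left] at hm
      exact (hXY.dvd_of_mem_term (u := u + 1) (by omega)).2 _
        ((Subgroup.mul_mem_cancel_right _ (powClosure.zpow_left_mem (hXY.dvd_exponent' hn))).mp hm)
    rw [← pow_mul A, ← pow_mul B] at hA hB ⊢
    refine mul_mem ?_ hx
    have h1 := (hA.mul_left (hcen x hx A).inv_left)
    have h2 := (hB.mul_left (hcen x hx B).inv_left)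
    rw [QuotientGroup.mk_mul, mul_inv_cancel_right, QuotientGroup.mk_mul, QuotientGroup.mk_pow,
      QuotientGroup.mk_pow] at h1 h2
    have h3 := ((Commute.refl (A : G ⧸ series p m (t + 1 + u) A B (2 * t + 1))).pow_left
      ((p ^ m) ^ u * i)).inv_left.mul_left h1
    have h4 := h2.mul_left ((Commute.refl (B : G ⧸ series p m (t + 1 + u) A B (2 * t + 1))).pow_left
      ((p ^ m) ^ u * k)).inv_left
    rw [inv_mul_cancel_left, ← QuotientGroup.mk_pow, commute_mk_iff, e0, ← term_swap] at h3
    rw [mul_inv_cancel_right, ← QuotientGroup.mk_pow, commute_mk_iff, e0] at h4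
    rw [e1]
    exact mul_mem (powClosure.left_mem (key h _ (dvd_mul_right _ _) h4))
      (powClosure.right_mem (key h.swap _ (dvd_mul_right _ _) h3))

end RegularPair


/-! ### Recognizing central series -/

section CentralSeries

variable {G : Type*} [Group G]

open scoped commutatorElement in
theorem commutatorElement_eq_gcomm (x g : G) : ⁅x, g⁆ = gcomm x⁻¹ g⁻¹ := by
  simp [gcomm, commutatorElement_def]

/-- Recognizing the upper central series. -/
theorem upperCentralSeries_eq {H : ℕ → Subgroup G} {A B : G} {c : ℕ} (h0 : H 0 = ⊥)
    (htop : ∀ j, c ≤ j → H j = ⊤) (hmono : ∀ j, H j ≤ H (j + 1))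
    (hstep : ∀ j, ∀ x ∈ H (j + 1), ∀ g, gcomm x g ∈ H j)
    (hmem : ∀ j, j + 2 ≤ c → ∀ g ∈ H (j + 2), gcomm g A ∈ H j → gcomm g B ∈ H j → g ∈ H (j + 1))
    (j : ℕ) : Subgroup.upperCentralSeries G j = H j := by
  apply le_antisymm
  · induction j with
    | zero => rw [Subgroup.upperCentralSeries_zero]; exact bot_le
    | succ j ih =>
      intro g hg
      have hgg : ∀ y, gcomm g y ∈ H j := by
        intro y
        rw [← inv_mem_iff (x := g), Subgroup.mem_upperCentralSeries_succ_iff] at hg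
        have := ih (hg y⁻¹)
        rwa [commutatorElement_eq_gcomm, inv_inv, inv_inv] at this
      -- Descent from the top. At an index above `j + 1`, commutators in `H j` lie in the larger
      -- group two steps down, so `hmem` moves `g` one term lower.
      have key : ∀ d, g ∈ H (max c (j + 1) - d) ∨ max c (j + 1) - d < j + 1 := by
        intro d
        induction d with
        | zero => left; rw [htop _ (by omega)]; trivial
        | succ d ihd =>
          rcases Nat.lt_or_ge (max c (j + 1) - (d + 1)) (j + 1) with h | h
          · exact Or.inr h
          · left
            obtain ⟨k, hk⟩ : ∃ k, max c (j + 1) - (d + 1) = k + 1 :=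
              ⟨max c (j + 1) - (d + 1) - 1, by omega⟩
            have hk2 : max c (j + 1) - d = k + 2 := by omega
            have h1 := ihd.resolve_right (by omega)
            have hjk : H j ≤ H k := monotone_nat_of_le_succ hmono (by omega)
            rw [hk2] at h1
            rw [hk]
            exact hmem k (by omega) g h1 (hjk (hgg A)) (hjk (hgg B))
      have := key (max c (j + 1) - (j + 1))
      rw [show max c (j + 1) - (max c (j + 1) - (j + 1)) = j + 1 by omega] at this
      exact this.resolve_right (lt_irrefl _)
  · refine Subgroup.ascending_central_series_le_upper H ⟨h0, fun x n hx g => ?_⟩ j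
    rw [commutatorElement_eq_gcomm]
    exact hstep n _ (inv_mem hx) _

theorem hasNilpotencyClass_of_upperCentralSeries {c : ℕ}
    (h : Subgroup.upperCentralSeries G (c + 1) = ⊤) (h' : Subgroup.upperCentralSeries G c ≠ ⊤) :
    HasNilpotencyClass G (c + 1) := by
  have hG : Group.IsNilpotent G := ⟨⟨_, h⟩⟩
  refine ⟨hG, le_antisymm ?_ ?_⟩
  · exact Subgroup.upperCentralSeries_eq_top_iff_nilpotencyClass_le.mp h
  · by_contra hlt
    exact h' (Subgroup.upperCentralSeries_eq_top_iff_nilpotencyClass_le.mpr (by omega))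

theorem gcomm_mem_lowerCentralSeries {n : ℕ} {x : G}
    (hx : x ∈ (⊤ : Subgroup G).lowerCentralSeries n) (g : G) :
    gcomm x g ∈ (⊤ : Subgroup G).lowerCentralSeries (n + 1) := by
  rw [← inv_inv x, ← inv_inv g, ← commutatorElement_eq_gcomm, Subgroup.lowerCentralSeries_succ]
  exact Subgroup.commutator_mem_commutator (inv_mem hx) (Subgroup.mem_top _)

/-- Bounding the lower central series. -/
theorem lowerCentralSeries_le {D : ℕ → Subgroup G} (h0 : D 0 = ⊤)
    (hstep : ∀ n, ∀ x ∈ D n, ∀ g, gcomm x g ∈ D (n + 1)) (n : ℕ) :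
    (⊤ : Subgroup G).lowerCentralSeries n ≤ D n := by
  refine Subgroup.descending_central_series_ge_lower D ⟨h0, fun x n hx g => ?_⟩ n
  rw [commutatorElement_eq_gcomm]
  exact hstep n _ (inv_mem hx) _

end CentralSeries

/-! ### Both central series for odd `p` -/

namespace RegularPair

variable {G : Type*} [Group G] {p m T : ℕ} {α : ℤ} {A B : G}

theorem upperCentralSeries_eq (h : RegularPair p m T α A B) (j : ℕ) :
    Subgroup.upperCentralSeries G j = series p m T A B j :=
  _root_.upperCentralSeries_eq (c := 2 * T + 1) h.series_zero (fun _ hj => h.series_top hj)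
    series_mono (fun j _ hx g => h.gcomm_mem_series j hx g)
    (fun _ hj _ hg hA hB => h.mem_series_of_gcomm_mem hj hg hA hB) j

theorem hasNilpotencyClass (h : RegularPair p m T α A B) : HasNilpotencyClass G (2 * T + 1) := by
  apply hasNilpotencyClass_of_upperCentralSeries
  · rw [h.upperCentralSeries_eq]; exact h.series_top le_rfl
  · rw [h.upperCentralSeries_eq]
    intro htop
    have h1 : A ^ 1 ∈ term p m A B (0 + 1) 0 := by
      have : A ∈ series p m T A B (2 * T) := by rw [htop]; trivial
      rw [series, show T + 1 - (2 * T + 1) / 2 = 0 + 1 by omega,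
        show T - 2 * T / 2 = 0 by omega] at this
      rwa [pow_one]
    have h2 := (h.dvd_of_mem_term (Nat.zero_le T)).1 1 h1
    rw [zero_add, pow_one, Nat.dvd_one] at h2
    have := Nat.one_lt_pow (by have := h.one_le; omega) h.prime.one_lt (n := m)
    omega

/-- In `[C ^ q ^ c, A] = A ^ (1 - α ^ q ^ c)` the exponent has valuation exactly `m (c + 1)`, so
this element generates the same subgroup as `A ^ q ^ (c + 1)`. -/
theorem left_pow_mem_of_comm_pow_mem (h : RegularPair p m T α A B) {n c : ℕ}
    (hC : gcomm A B ^ (p ^ m) ^ c ∈ (⊤ : Subgroup G).lowerCentralSeries n) :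
    A ^ (p ^ m) ^ (c + 1) ∈ (⊤ : Subgroup G).lowerCentralSeries (n + 1) := by
  have h1 := gcomm_mem_lowerCentralSeries hC A
  rw [h.pair.gcomm_comm_pow_left] at h1
  obtain ⟨v, hv, hvp⟩ := h.exists_sub_one
  have hA : A ^ p ^ (m * (T + 1)) = 1 := by rw [pow_mul]; exact h.left_pow_eq_one
  have h2 : A ^ (1 - α ^ (p ^ m) ^ c).natAbs ∈ (⊤ : Subgroup G).lowerCentralSeries (n + 1) := by
    rcases Int.natAbs_eq (1 - α ^ (p ^ m) ^ c) with hz | hz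
    · rw [← zpow_natCast, ← hz]; exact h1
    · rw [hz, zpow_neg, inv_mem_iff, zpow_natCast] at h1; exact h1
  have h3 := pow_mem_of_not_dvd h.prime hA h2 (M := m * (c + 1) + 1) (by
    intro hd
    rw [← Int.natCast_dvd, dvd_sub_comm] at hd
    have h4 := pow_dvd_of_pow_dvd_pow_sub_one (j := m * c + 1) h.prime h.one_le
      (fun h2 => absurd h2 h.ne_two) hv hvp (by
        rw [show m * c + 1 + m = m * (c + 1) + 1 by ring]; exact_mod_cast hd)
    rw [← pow_mul] at h4
    exact absurd (Nat.le_of_dvd (pow_pos h.prime.pos _) h4)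
        (not_le.mpr (Nat.pow_lt_pow_right h.prime.one_lt (Nat.lt_succ_self _))))
  rw [← pow_mul]
  exact h3

/-- The passage from `(a, c)` to `(c + 1, a)` loses nothing: the powers of `A` and `B` come from
commutators with `C ^ q ^ c`, and `C ^ q ^ a` is then `[A ^ q ^ a, B]` up to a power of `A` already
obtained. -/
theorem term_le_lowerCentralSeries_succ (h : RegularPair p m T α A B) {n a c : ℕ} (hca : c ≤ a)
    (hle : term p m A B a c ≤ (⊤ : Subgroup G).lowerCentralSeries n) :
    term p m A B (c + 1) a ≤ (⊤ : Subgroup G).lowerCentralSeries (n + 1) := by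
  obtain ⟨h1, h2, h3⟩ := powClosure.le_iff.mp hle
  have hA := h.left_pow_mem_of_comm_pow_mem h3
  have hB := h.swap.left_pow_mem_of_comm_pow_mem (c := c) (n := n) (by
    rw [← gcomm_inv A B, inv_pow]; exact inv_mem h3)
  refine powClosure.le_iff.mpr ⟨hA, hB, ?_⟩
  have h4 := gcomm_mem_lowerCentralSeries h1 B
  rw [h.pair.gcomm_pow_left] at h4
  refine (Subgroup.mul_mem_cancel_right _ ?_).mp h4
  obtain ⟨k, hk⟩ := h.dvd_exponent' (pow_dvd_pow (p ^ m) hca)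
  rw [hk, zpow_mul, zpow_natCast]
  exact zpow_mem hA k

theorem lowerCentralSeries_eq (h : RegularPair p m T α A B) {n : ℕ} (hn : n ≤ 2 * T + 1) :
    (⊤ : Subgroup G).lowerCentralSeries n = Subgroup.upperCentralSeries G (2 * T + 1 - n) := by
  rw [h.upperCentralSeries_eq]
  apply le_antisymm
  · refine lowerCentralSeries_le (D := fun n => series p m T A B (2 * T + 1 - n))
      (h.series_top le_rfl) (fun n x hx g => ?_) n
    rcases Nat.lt_or_ge n (2 * T + 1) with hlt | hge
    · apply h.gcomm_mem_series
      rwa [show 2 * T + 1 - (n + 1) + 1 = 2 * T + 1 - n by omega]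
    · simp only [show 2 * T + 1 - n = 0 by omega, h.series_zero, Subgroup.mem_bot] at hx
      rw [hx]
      simp [gcomm]
  · induction n with
    | zero => simp
    | succ n ih =>
      obtain ⟨a, c, h1, -, -, h4, h5⟩ := series_succ (p := p) (m := m) (A := A) (B := B)
        (show 2 * T + 1 - (n + 1) ≤ 2 * T by omega)
      rw [h5]
      refine h.term_le_lowerCentralSeries_succ h1 ?_
      rw [← h4, show 2 * T + 1 - (n + 1) + 1 = 2 * T + 1 - n by omega]
      exact ih (by omega)

end RegularPair


/-! ### Valuations at the prime 2 -/

theorem odd_geomSum {α : ℤ} (hα : Odd α) {c : ℕ} (hc : Odd c) : Odd (geomSum α c) := by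
  obtain ⟨k, hk⟩ := hα
  have h := dvd_geomSum_of_dvd (r := 2) (α := α) ⟨k, by push_cast; linarith⟩ c
  obtain ⟨l, hl⟩ := hc
  obtain ⟨t, ht⟩ := h
  exact ⟨t + l, by rw [hl] at ht ⊢; push_cast at ht ⊢; linarith⟩

theorem pow_sub_one_eq_of_odd {m : ℕ} {α v : ℤ} (hm : 1 ≤ m) (hα : α - 1 = 2 ^ m * v)
    (hv : Odd v) {c : ℕ} (hc : Odd c) : ∃ w : ℤ, Odd w ∧ α ^ c - 1 = 2 ^ m * w := by
  have hαo : Odd α := by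
    obtain ⟨m', rfl⟩ : ∃ m', m = m' + 1 := ⟨m - 1, by omega⟩
    exact ⟨2 ^ m' * v, by rw [pow_succ] at hα; linarith⟩
  refine ⟨geomSum α c * v, (odd_geomSum hαo hc).mul hv, ?_⟩
  rw [← geomSum_mul, hα]; ring

/-- The exact power of `2` in `1 + α + ⋯ + α ^ (n - 1) - n`, for even `n`. -/
theorem geomSum_sub_eq_two_pow_mul {m : ℕ} {α v : ℤ} (hm : 2 ≤ m) (hα : α - 1 = 2 ^ m * v)
    (hv : Odd v) (j : ℕ) {c : ℕ} (hc : Odd c) :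
    ∃ w : ℤ, Odd w ∧ geomSum α (2 ^ (j + 1) * c) - (2 ^ (j + 1) * c : ℕ) = 2 ^ (m + j) * w := by
  have hαo : Odd α := by
    obtain ⟨m', rfl⟩ : ∃ m', m = m' + 1 := ⟨m - 1, by omega⟩
    exact ⟨2 ^ m' * v, by rw [pow_succ] at hα; linarith⟩
  -- For odd `k` the last summand has the smaller valuation, namely `m`. For even `k` the first one
  -- does, so each further doubling raises the valuation by one.
  have dbl : ∀ k : ℕ, geomSum α (2 * k) - (2 * k : ℕ) =
      2 * (geomSum α k - k) + geomSum α k * (α ^ k - 1) := by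
    intro k
    rw [geomSum_mul_index]
    simp only [geomSum, Finset.sum_range_succ]
    push_cast; simp; ring
  induction j with
  | zero =>
    obtain ⟨w, hw, hw'⟩ := pow_sub_one_eq_of_odd (by omega) hα hv hc
    obtain ⟨g, hg⟩ : (2 : ℤ) ^ m ∣ geomSum α c - c := by
      have := dvd_geomSum_of_dvd (r := 2 ^ m) (α := α) ⟨v, by push_cast; exact hα⟩ c
      exact_mod_cast this
    refine ⟨2 * g + geomSum α c * w, ((even_two_mul g).add_odd ((odd_geomSum hαo hc).mul hw)), ?_⟩
    rw [zero_add, pow_one, dbl, hw', hg]; ring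
  | succ j ih =>
    obtain ⟨w, hw, hw'⟩ := ih
    obtain ⟨x, hx⟩ := pow_dvd_pow_sub_one (p := 2) (m := m) (α := α) (by omega)
      ⟨v, by push_cast; exact hα⟩ (dvd_mul_right (2 ^ (j + 1)) c)
    have h2 : (2 : ℤ) ∣ geomSum α (2 ^ (j + 1) * c) := by
      obtain ⟨k, hk⟩ := hαo
      have h := dvd_geomSum_of_dvd (r := 2) (α := α) ⟨k, by push_cast; linarith⟩ (2 ^ (j + 1) * c)
      refine (dvd_sub_left ?_).mp h
      rw [pow_succ]; push_cast
      exact (Dvd.intro_left _ rfl).mul_right _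
    obtain ⟨y, hy⟩ := h2
    refine ⟨w + 2 * (y * x), hw.add_even (even_two_mul _), ?_⟩
    rw [show 2 ^ (j + 1 + 1) * c = 2 * (2 ^ (j + 1) * c) by ring, dbl, hw', hx, hy]
    push_cast; ring

/-- The exponent of `A` in `[A ^ n, B]`. -/
def commExponent (α : ℤ) (n : ℕ) : ℤ := n * (1 - α ^ n) + (α * geomSum α n - n)

theorem commExponent_eq (α : ℤ) (n : ℕ) :
    commExponent α n = (1 - n) * (α ^ n - 1) + (geomSum α n - n) := by
  unfold commExponent
  linear_combination geomSum_mul α n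

/-- `α ^ n - 1` has one more factor `2` than the geometric term, which therefore decides. The
valuation is `m + j` for `n = 2 ^ (j + 1) c`, one less than the bound valid for odd primes. -/
theorem commExponent_eq_two_pow_mul {m : ℕ} {α v : ℤ} (hm : 2 ≤ m) (hα : α - 1 = 2 ^ m * v)
    (hv : Odd v) (j : ℕ) {c : ℕ} (hc : Odd c) :
    ∃ w : ℤ, Odd w ∧ commExponent α (2 ^ (j + 1) * c) = 2 ^ (m + j) * w := by
  obtain ⟨w, hw, hw'⟩ := geomSum_sub_eq_two_pow_mul hm hα hv j hc
  obtain ⟨x, hx⟩ := pow_dvd_pow_sub_one (p := 2) (m := m) (α := α) (by omega)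
    ⟨v, by push_cast; exact hα⟩ (dvd_mul_right (2 ^ (j + 1)) c)
  refine ⟨w + 2 * ((1 - (2 ^ (j + 1) * c : ℕ)) * x), hw.add_even (even_two_mul _), ?_⟩
  rw [commExponent_eq, hw', hx]; push_cast; ring

theorem dvd_commExponent {α : ℤ} {q : ℕ} (hq : (q : ℤ) ∣ α - 1) (n : ℕ) :
    (q : ℤ) ∣ commExponent α n := by
  rw [commExponent_eq]
  exact dvd_add ((hq.trans (by simpa using sub_dvd_pow_sub_pow α 1 n)).mul_left _)
    (dvd_geomSum_of_dvd hq n)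

theorem two_pow_dvd_commExponent {m : ℕ} {α v : ℤ} (hm : 2 ≤ m) (hα : α - 1 = 2 ^ m * v)
    (hv : Odd v) {j n : ℕ} (hn : 2 ^ (j + 1) ∣ n) : (2 : ℤ) ^ (m + j) ∣ commExponent α n := by
  rcases Nat.eq_zero_or_pos n with rfl | hpos
  · simp [commExponent, geomSum_zero]
  obtain ⟨e, c, hc, rfl⟩ := Nat.exists_eq_two_pow_mul_odd hpos.ne'
  have hje : j + 1 ≤ e := by
    by_contra hlt
    have h1 : 2 ^ (e + 1) ∣ 2 ^ e * c := (pow_dvd_pow 2 (by omega)).trans hn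
    rw [pow_succ] at h1
    exact (Nat.not_even_iff_odd.mpr hc)
      (even_iff_two_dvd.mpr (Nat.dvd_of_mul_dvd_mul_left (by positivity) h1))
  obtain ⟨i, rfl⟩ : ∃ i, e = i + 1 := ⟨e - 1, by omega⟩
  obtain ⟨w, -, hw⟩ := commExponent_eq_two_pow_mul hm hα hv i hc
  rw [hw]
  exact (pow_dvd_pow _ (by omega)).mul_right _

theorem two_pow_dvd_of_dvd_commExponent {m : ℕ} {α v : ℤ} (hm : 2 ≤ m) (hα : α - 1 = 2 ^ m * v)
    (hv : Odd v) {j n : ℕ} (hn : 2 ∣ n) (h : (2 : ℤ) ^ (m + j) ∣ commExponent α n) :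
    2 ^ (j + 1) ∣ n := by
  rcases Nat.eq_zero_or_pos n with rfl | hpos
  · simp
  obtain ⟨e, c, hc, rfl⟩ := Nat.exists_eq_two_pow_mul_odd hpos.ne'
  have he : e ≠ 0 := by
    rintro rfl
    rw [pow_zero, one_mul] at hn
    exact (Nat.not_even_iff_odd.mpr hc) (even_iff_two_dvd.mpr hn)
  obtain ⟨i, rfl⟩ : ∃ i, e = i + 1 := ⟨e - 1, by omega⟩
  obtain ⟨w, hw, hw'⟩ := commExponent_eq_two_pow_mul hm hα hv i hc
  have hji : j ≤ i := by
    by_contra hlt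
    rw [hw'] at h
    have h1 : (2 : ℤ) ^ (m + i + 1) ∣ 2 ^ (m + i) * w := (pow_dvd_pow 2 (by omega)).trans h
    rw [pow_succ] at h1
    exact (Int.not_even_iff_odd.mpr hw)
      (even_iff_two_dvd.mpr (Int.dvd_of_mul_dvd_mul_left (by positivity) h1))
  exact (pow_dvd_pow 2 (by omega)).mul_right c


section

variable {G : Type*} [Group G]

theorem gcomm_mul_left (x y z : G) : gcomm (x * y) z = y⁻¹ * gcomm x z * y * gcomm y z := by
  simp [gcomm, mul_assoc]

theorem gcomm_eq_one_of_commute {x y : G} (h : Commute x y) : gcomm x y = 1 := by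
  rw [gcomm, mul_assoc, h.eq]; group

theorem commute_left_of_mul_pow {x y : G} {n l : ℕ} (h : Commute (x ^ n * y ^ l) y) :
    Commute (x ^ n) y := by
  have := h.mul_left ((Commute.refl y).pow_left l).inv_left
  rwa [mul_inv_cancel_right] at this

theorem commute_right_of_mul_pow {x y : G} {n l : ℕ} (h : Commute (x ^ n * y ^ l) x) :
    Commute (y ^ l) x := by
  have := ((Commute.refl x).pow_left n).inv_left.mul_left h
  rwa [inv_mul_cancel_left] at this

end

namespace MacdonaldPair

variable {G : Type*} [Group G] {α : ℤ} {A B : G}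

theorem gcomm_pow_left' (h : MacdonaldPair α A B) (n : ℕ) :
    gcomm (A ^ n) B = gcomm A B ^ n * A ^ commExponent α n :=
  h.gcomm_pow_left n

theorem gcomm_comm_pow_right (h : MacdonaldPair α A B) (n : ℕ) :
    gcomm (gcomm A B ^ n) B = (gcomm A B ^ n)⁻¹ * B ^ (α ^ n - 1) * gcomm A B ^ n := by
  have h1 := h.swap.gcomm_comm_pow_left n
  rw [← gcomm_inv A B, inv_pow] at h1
  have h2 : B ^ (α ^ n - 1) = (B ^ (1 - α ^ n))⁻¹ := by rw [← zpow_neg]; congr 1; ring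
  rw [h2, ← h1]
  simp [gcomm, mul_assoc]

/-- A criterion for consecutive terms of a central series. -/
theorem commute_mk_powClosure (h : MacdonaldPair α A B) (hgen : Subgroup.closure {A, B} = ⊤)
    {a c a' c' : ℕ} [(powClosure A B a' c').Normal] (ha : a ∣ a') (hc : c ∣ c') (h1 : c' ∣ a)
    (h2 : (a' : ℤ) ∣ commExponent α a) (h3 : (a' : ℤ) ∣ 1 - α ^ c) :
    (powClosure A B a c).Normal ∧ ∀ x ∈ powClosure A B a c, ∀ g : G,
      Commute (x : G ⧸ powClosure A B a' c') (g : G ⧸ powClosure A B a' c') := by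
  have key : ∀ {X Y : G}, MacdonaldPair α X Y → gcomm (X ^ a) Y ∈ powClosure X Y a' c' := by
    intro X Y hXY
    rw [hXY.gcomm_pow_left']
    exact mul_mem (powClosure.comm_mem h1) (powClosure.zpow_left_mem h2)
  have key' : ∀ {X Y : G}, MacdonaldPair α X Y →
      gcomm (gcomm X Y ^ c) X ∈ powClosure X Y a' c' := by
    intro X Y hXY
    rw [hXY.gcomm_comm_pow_left]
    exact powClosure.zpow_left_mem h3
  refine closure_normal_of_commute_mk hgen (powClosure.mono ha hc) ?_
  rintro s (rfl | rfl | rfl)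
  · refine ⟨?_, commute_mk_iff.mpr (key h)⟩
    rw [QuotientGroup.mk_pow]; exact (Commute.refl _).pow_left _
  · refine ⟨commute_mk_iff.mpr (powClosure.swap (A := A) (B := B) ▸ key h.swap), ?_⟩
    rw [QuotientGroup.mk_pow]; exact (Commute.refl _).pow_left _
  · refine ⟨commute_mk_iff.mpr (key' h), ?_⟩
    have h4 := key' h.swap
    rw [powClosure.swap, ← gcomm_inv A B, ← commute_mk_iff, inv_pow, QuotientGroup.mk_inv] at h4
    exact Commute.inv_left_iff.mp h4

end MacdonaldPair

/-! ### The upper central series for `p = 2` -/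

/-- A Macdonald pair generating a `2`-group, with `v₂ (α - 1) = n + 1`, in which `A` has order
`2 ^ (3 * n + 2)` and `A ^ 2 ^ (2 * n + 1)` is central. -/
structure EvenPair {G : Type*} [Group G] (n : ℕ) (α : ℤ) (A B : G) : Prop where
  pair : MacdonaldPair α A B
  one_le : 1 ≤ n
  exists_sub_one : ∃ v : ℤ, α - 1 = 2 ^ (n + 1) * v ∧ Odd v
  gen : Subgroup.closure {A, B} = ⊤
  comm : Commute B (A ^ 2 ^ (2 * n + 1))
  mul_eq : A ^ 2 ^ (2 * n + 1) * B ^ 2 ^ (2 * n + 1) = 1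
  pow_eq_one_iff : ∀ k, A ^ k = 1 ↔ 2 ^ (3 * n + 2) ∣ k

namespace EvenPair

variable {G : Type*} [Group G] {n : ℕ} {α : ℤ} {A B : G}

theorem right_pow_eq (h : EvenPair n α A B) {k : ℕ} (hk : 2 ^ (2 * n + 1) ∣ k) :
    B ^ k = (A ^ k)⁻¹ := by
  obtain ⟨k, rfl⟩ := hk
  rw [pow_mul, pow_mul, ← inv_eq_of_mul_eq_one_right h.mul_eq, inv_pow]

theorem swap (h : EvenPair n α A B) : EvenPair n α B A where
  pair := h.pair.swap
  one_le := h.one_le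
  exists_sub_one := h.exists_sub_one
  gen := by rw [Set.pair_comm]; exact h.gen
  comm := by
    rw [h.right_pow_eq dvd_rfl]
    exact ((Commute.refl A).pow_right _).inv_right
  mul_eq := by rw [h.right_pow_eq dvd_rfl]; simp
  pow_eq_one_iff := by
    intro k
    have hB : orderOf B = 2 ^ (3 * n + 1 + 1) := by
      apply orderOf_eq_prime_pow
      · rw [h.right_pow_eq (pow_dvd_pow 2 (by omega)), inv_eq_one, h.pow_eq_one_iff]
        exact fun hd => absurd (Nat.le_of_dvd (by positivity) hd)
            (not_le.mpr (Nat.pow_lt_pow_right one_lt_two (by omega)))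
      · rw [h.right_pow_eq (pow_dvd_pow 2 (by omega)), inv_eq_one, h.pow_eq_one_iff]
    rw [← orderOf_dvd_iff_pow_eq_one, hB]

theorem left_pow_eq_one (h : EvenPair n α A B) : A ^ 2 ^ (3 * n + 2) = 1 :=
  (h.pow_eq_one_iff _).mpr dvd_rfl

theorem dvd_sub_one (h : EvenPair n α A B) : ((2 ^ (n + 1) : ℕ) : ℤ) ∣ α - 1 := by
  obtain ⟨v, hv, -⟩ := h.exists_sub_one
  exact ⟨v, by push_cast; exact hv⟩

theorem dvd_one_sub_pow (h : EvenPair n α A B) {j k t : ℕ} (hk : 2 ^ j ∣ k)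
    (ht : t ≤ j + (n + 1)) : ((2 ^ t : ℕ) : ℤ) ∣ 1 - α ^ k := by
  obtain ⟨v, hv, -⟩ := h.exists_sub_one
  have := pow_dvd_pow_sub_one (p := 2) (m := n + 1) (α := α) (by omega)
    ⟨v, by push_cast; exact hv⟩ hk
  rw [dvd_sub_comm]
  push_cast at this ⊢
  exact (pow_dvd_pow 2 ht).trans this

theorem dvd_of_dvd_one_sub_pow (h : EvenPair n α A B) {j k t : ℕ}
    (hk : ((2 ^ t : ℕ) : ℤ) ∣ 1 - α ^ k) (ht : j + (n + 1) ≤ t) : 2 ^ j ∣ k := by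
  obtain ⟨v, hv, hv2⟩ := h.exists_sub_one
  have := h.one_le
  refine pow_dvd_of_pow_dvd_pow_sub_one (m := n + 1) Nat.prime_two (by omega) (by omega)
    (by push_cast; exact hv) (Int.isCoprime_iff_gcd_eq_one.mpr ?_) (α := α) ?_
  · rw [Int.gcd_comm]
    exact (Int.isCoprime_iff_gcd_eq_one.mp
      ((Int.prime_two.coprime_iff_not_dvd).mpr (fun hd =>
        Int.not_even_iff_odd.mpr hv2 (even_iff_two_dvd.mpr hd))))
  · rw [dvd_sub_comm] at hk
    push_cast at hk ⊢
    exact (pow_dvd_pow 2 ht).trans hk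

theorem dvd_commExponent (h : EvenPair n α A B) {j k t : ℕ} (hk : 2 ^ (j + 1) ∣ k)
    (ht : t ≤ n + 1 + j) : ((2 ^ t : ℕ) : ℤ) ∣ commExponent α k := by
  obtain ⟨v, hv, hv2⟩ := h.exists_sub_one
  have := h.one_le
  push_cast
  exact (pow_dvd_pow 2 ht).trans (two_pow_dvd_commExponent (by omega) hv hv2 hk)

theorem dvd_of_dvd_commExponent (h : EvenPair n α A B) {j k : ℕ} (hk : 2 ∣ k)
    (hd : ((2 ^ (n + 1 + j) : ℕ) : ℤ) ∣ commExponent α k) : 2 ^ (j + 1) ∣ k := by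
  obtain ⟨v, hv, hv2⟩ := h.exists_sub_one
  have := h.one_le
  push_cast at hd
  exact two_pow_dvd_of_dvd_commExponent (by omega) hv hv2 hk hd

theorem zpow_mem_center (h : EvenPair n α A B) {z : ℤ} (hz : ((2 ^ (2 * n + 1) : ℕ) : ℤ) ∣ z) :
    A ^ z ∈ Subgroup.center G := by
  obtain ⟨k, rfl⟩ := hz
  rw [zpow_mul, zpow_natCast]
  exact zpow_mem (mem_center_of_commute h.gen ((Commute.refl A).pow_right _) h.comm) k

theorem pow_mem_center (h : EvenPair n α A B) : A ^ 2 ^ (2 * n + 1) ∈ Subgroup.center G :=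
  mem_center_of_commute h.gen ((Commute.refl A).pow_right _) h.comm

/-- The terms of the upper central series. -/
def series (n : ℕ) (A B : G) : ℕ → Subgroup G
  | 0 => ⊥
  | 1 => powClosure A B (2 ^ (2 * n + 1)) (2 ^ (2 * n + 1))
  | 2 => powClosure A B (2 ^ (2 * n + 1)) (2 ^ n)
  | 3 => powClosure A B (2 ^ (n + 1)) (2 ^ n)
  | 4 => powClosure A B (2 ^ n) 1
  | _ => ⊤

/-- Triviality of `[A ^ 2 ^ (2 n + 1), B]` gives `C ^ 2 ^ (2 n + 1)` as a power of `A`. In contrast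
to odd `p` it is not `1`: the exponent has valuation `3 n + 1`, one short of the order of `A`. -/
theorem comm_pow_eq (h : EvenPair n α A B) :
    ∃ k : ℤ, gcomm A B ^ 2 ^ (2 * n + 1) = (A ^ 2 ^ (2 * n + 1)) ^ k := by
  obtain ⟨k, hk⟩ := h.dvd_commExponent (dvd_refl (2 ^ (2 * n + 1))) (t := 2 * n + 1) (by omega)
  have h1 := h.pair.gcomm_pow_left' (2 ^ (2 * n + 1))
  rw [gcomm_eq_one_of_commute h.comm.symm, hk, zpow_mul, zpow_natCast] at h1
  exact ⟨-k, by rw [zpow_neg]; exact eq_inv_of_mul_eq_one_left h1.symm⟩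

theorem series_one_eq (h : EvenPair n α A B) :
    series n A B 1 = Subgroup.closure {A ^ 2 ^ (2 * n + 1)} := by
  apply le_antisymm
  · refine powClosure.le_iff.mpr ⟨Subgroup.subset_closure (Set.mem_singleton _), ?_, ?_⟩
    · rw [h.right_pow_eq dvd_rfl]; exact inv_mem (Subgroup.subset_closure (Set.mem_singleton _))
    · obtain ⟨k, hk⟩ := h.comm_pow_eq
      rw [hk]; exact zpow_mem (Subgroup.subset_closure (Set.mem_singleton _)) k
  · rw [Subgroup.closure_le, Set.singleton_subset_iff]
    exact powClosure.left_mem dvd_rfl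

theorem series_one_le_center (h : EvenPair n α A B) : series n A B 1 ≤ Subgroup.center G := by
  rw [h.series_one_eq, Subgroup.closure_le, Set.singleton_subset_iff]
  exact h.pow_mem_center

theorem powClosure_one_one (h : EvenPair n α A B) : powClosure A B 1 1 = ⊤ := by
  rw [eq_top_iff, ← h.gen, Subgroup.closure_le]
  rintro x (rfl | rfl)
  · have : x ^ 1 ∈ powClosure x B 1 1 := powClosure.left_mem dvd_rfl
    rwa [pow_one] at this
  · have : x ^ 1 ∈ powClosure A x 1 1 := powClosure.right_mem dvd_rfl
    rwa [pow_one] at this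

theorem series_one_normal (h : EvenPair n α A B) : (series n A B 1).Normal :=
  ⟨fun x hx g => by
    rw [Subgroup.mem_center_iff.mp (h.series_one_le_center hx) g, mul_inv_cancel_right]; exact hx⟩

theorem step_one (h : EvenPair n α A B) [(series n A B 1).Normal] :
    (series n A B 2).Normal ∧ ∀ x ∈ series n A B 2, ∀ g : G,
      Commute (x : G ⧸ series n A B 1) (g : G ⧸ series n A B 1) := by
  have : (powClosure A B (2 ^ (2 * n + 1)) (2 ^ (2 * n + 1))).Normal := ‹_›
  exact h.pair.commute_mk_powClosure h.gen dvd_rfl (pow_dvd_pow 2 (by omega)) dvd_rfl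
    (h.dvd_commExponent dvd_rfl (by omega)) (h.dvd_one_sub_pow dvd_rfl (by omega))

theorem step_two (h : EvenPair n α A B) [(series n A B 2).Normal] :
    (series n A B 3).Normal ∧ ∀ x ∈ series n A B 3, ∀ g : G,
      Commute (x : G ⧸ series n A B 2) (g : G ⧸ series n A B 2) := by
  have : (powClosure A B (2 ^ (2 * n + 1)) (2 ^ n)).Normal := ‹_›
  exact h.pair.commute_mk_powClosure h.gen (pow_dvd_pow 2 (by omega)) dvd_rfl
    (pow_dvd_pow 2 (by omega))
    (h.dvd_commExponent dvd_rfl (by omega)) (h.dvd_one_sub_pow dvd_rfl (by omega))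

theorem step_three (h : EvenPair n α A B) [(series n A B 3).Normal] :
    (series n A B 4).Normal ∧ ∀ x ∈ series n A B 4, ∀ g : G,
      Commute (x : G ⧸ series n A B 3) (g : G ⧸ series n A B 3) := by
  have : (powClosure A B (2 ^ (n + 1)) (2 ^ n)).Normal := ‹_›
  exact h.pair.commute_mk_powClosure h.gen (pow_dvd_pow 2 (by omega)) (one_dvd _) dvd_rfl
    (_root_.dvd_commExponent h.dvd_sub_one _) (h.dvd_one_sub_pow (j := 0) (by simp) (by omega))

theorem step_four (h : EvenPair n α A B) [(series n A B 4).Normal] (x g : G) :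
    Commute (x : G ⧸ series n A B 4) (g : G ⧸ series n A B 4) := by
  have : (powClosure A B (2 ^ n) 1).Normal := ‹_›
  have h2 : ((2 ^ n : ℕ) : ℤ) ∣ α - 1 :=
    (by exact_mod_cast pow_dvd_pow 2 (by omega) :
      ((2 ^ n : ℕ) : ℤ) ∣ ((2 ^ (n + 1) : ℕ) : ℤ)).trans h.dvd_sub_one
  exact (h.pair.commute_mk_powClosure h.gen (one_dvd _) dvd_rfl dvd_rfl
    (_root_.dvd_commExponent h2 _)
    (h.dvd_one_sub_pow (j := 0) (by simp) (by omega))).2 x (by rw [h.powClosure_one_one]; trivial) g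

theorem series_normal (h : EvenPair n α A B) (j : ℕ) : (series n A B j).Normal := by
  have h1 := h.series_one_normal
  have h2 := h.step_one.1
  have h3 := h.step_two.1
  have h4 := h.step_three.1
  match j with
  | 0 => exact (inferInstance : (⊥ : Subgroup G).Normal)
  | 1 => exact h1
  | 2 => exact h2
  | 3 => exact h3
  | 4 => exact h4
  | j + 5 => exact (inferInstance : (⊤ : Subgroup G).Normal)

theorem series_mono (j : ℕ) : series n A B j ≤ series n A B (j + 1) := by
  match j with
  | 0 => exact bot_le
  | 1 => exact powClosure.mono dvd_rfl (pow_dvd_pow 2 (by omega))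
  | 2 => exact powClosure.mono (pow_dvd_pow 2 (by omega)) dvd_rfl
  | 3 => exact powClosure.mono (pow_dvd_pow 2 (by omega)) (one_dvd _)
  | j + 4 => exact le_top

theorem gcomm_mem_series (h : EvenPair n α A B) (j : ℕ) {x : G}
    (hx : x ∈ series n A B (j + 1)) (g : G) : gcomm x g ∈ series n A B j := by
  have n1 := h.series_normal 1
  have n2 := h.series_normal 2
  have n3 := h.series_normal 3
  have n4 := h.series_normal 4
  match j with
  | 0 =>
    rw [gcomm_eq_one_of_commute (Subgroup.mem_center_iff.mp (h.series_one_le_center hx) g).symm]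
    exact one_mem _
  | 1 => exact commute_mk_iff.mp (h.step_one.2 x hx g)
  | 2 => exact commute_mk_iff.mp (h.step_two.2 x hx g)
  | 3 => exact commute_mk_iff.mp (h.step_three.2 x hx g)
  | 4 => exact commute_mk_iff.mp (h.step_four x g)
  | j + 5 => trivial

/-- A power of the commutator in the first term. -/
theorem dvd_of_comm_pow_mem_one (h : EvenPair n α A B) {k : ℕ}
    (hk : gcomm A B ^ k ∈ series n A B 1) : 2 ^ (2 * n + 1) ∣ k := by
  have h1 := h.pair.gcomm_comm_pow_left k
  rw [gcomm_eq_one_of_commute (Subgroup.mem_center_iff.mp (h.series_one_le_center hk) A).symm] at h1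
  refine h.dvd_of_dvd_one_sub_pow (t := 3 * n + 2) ?_ (by omega)
  rw [← Int.dvd_natAbs, Int.natCast_dvd_natCast, ← h.pow_eq_one_iff, pow_natAbs_eq_one]
  exact h1.symm

theorem dvd_of_gcomm_pow_mem_one (h : EvenPair n α A B) {k : ℕ} (hk : 2 ^ (n + 1) ∣ k)
    (hm : gcomm (A ^ k) B ∈ series n A B 1) : 2 ^ (2 * n + 1) ∣ k := by
  rw [h.pair.gcomm_pow_left'] at hm
  exact h.dvd_of_comm_pow_mem_one ((Subgroup.mul_mem_cancel_right _
    (powClosure.zpow_left_mem (h.dvd_commExponent hk (by omega)))).mp hm)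

theorem series_one_swap : series n B A 1 = series n A B 1 := powClosure.swap
theorem series_three_swap : series n B A 3 = series n A B 3 := powClosure.swap

/-- Uniqueness of exponents modulo the second term. -/
theorem dvd_of_commute_mk_one (h : EvenPair n α A B) [(series n A B 1).Normal] {k l : ℕ}
    (hk : 2 ^ (n + 1) ∣ k) (hl : 2 ^ (n + 1) ∣ l)
    (hA : Commute ((A ^ k * B ^ l : G) : G ⧸ series n A B 1) (A : G ⧸ series n A B 1))
    (hB : Commute ((A ^ k * B ^ l : G) : G ⧸ series n A B 1) (B : G ⧸ series n A B 1)) :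
    2 ^ (2 * n + 1) ∣ k ∧ 2 ^ (2 * n + 1) ∣ l := by
  rw [QuotientGroup.mk_mul, QuotientGroup.mk_pow, QuotientGroup.mk_pow] at hA hB
  have h1 := commute_left_of_mul_pow hB
  have h2 := commute_right_of_mul_pow hA
  rw [← QuotientGroup.mk_pow, commute_mk_iff] at h1 h2
  refine ⟨h.dvd_of_gcomm_pow_mem_one hk h1, h.swap.dvd_of_gcomm_pow_mem_one hl ?_⟩
  rw [series_one_swap]; exact h2

/-- An element of the second term is central modulo the first; there the commutator with `B`
constrains `x` alone and the one with `A` constrains `y` alone. -/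
theorem dvd_of_mul_mem_two (h : EvenPair n α A B) {x y : ℤ}
    (hx : ((2 ^ (n + 1) : ℕ) : ℤ) ∣ x) (hy : ((2 ^ (n + 1) : ℕ) : ℤ) ∣ y)
    (hm : A ^ x * B ^ y ∈ series n A B 2) :
    ((2 ^ (2 * n + 1) : ℕ) : ℤ) ∣ x ∧ ((2 ^ (2 * n + 1) : ℕ) : ℤ) ∣ y := by
  have n1 := h.series_normal 1
  have nat : ∀ z : ℤ, ∃ k : ℕ, ((2 ^ (3 * n + 2) : ℕ) : ℤ) ∣ z - k ∧ A ^ z = A ^ k ∧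
      B ^ z = B ^ k := by
    intro z
    have hpos : (0 : ℤ) < ((2 ^ (3 * n + 2) : ℕ) : ℤ) := by positivity
    have h1 := Int.emod_add_mul_ediv z ((2 ^ (3 * n + 2) : ℕ) : ℤ)
    obtain ⟨k, hk⟩ := Int.eq_ofNat_of_zero_le (Int.emod_nonneg z hpos.ne')
    have hz : z = k + ((2 ^ (3 * n + 2) : ℕ) : ℤ) * (z / ((2 ^ (3 * n + 2) : ℕ) : ℤ)) := by
      rw [hk] at h1; exact h1.symm
    refine ⟨k, ⟨z / ((2 ^ (3 * n + 2) : ℕ) : ℤ), by linarith⟩, ?_, ?_⟩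
    · conv_lhs => rw [hz]
      rw [zpow_add, zpow_mul A ((2 ^ (3 * n + 2) : ℕ) : ℤ), zpow_natCast, zpow_natCast,
        h.left_pow_eq_one, one_zpow, mul_one]
    · conv_lhs => rw [hz]
      rw [zpow_add, zpow_mul B ((2 ^ (3 * n + 2) : ℕ) : ℤ), zpow_natCast, zpow_natCast,
        h.swap.left_pow_eq_one, one_zpow, mul_one]
  obtain ⟨k, hk, hkA, -⟩ := nat x
  obtain ⟨l, hl, -, hlB⟩ := nat y
  rw [hkA, hlB] at hm
  have d1 : ((2 ^ (n + 1) : ℕ) : ℤ) ∣ ((2 ^ (3 * n + 2) : ℕ) : ℤ) :=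
    Int.natCast_dvd_natCast.mpr (pow_dvd_pow 2 (by omega))
  have d2 : ((2 ^ (2 * n + 1) : ℕ) : ℤ) ∣ ((2 ^ (3 * n + 2) : ℕ) : ℤ) :=
    Int.natCast_dvd_natCast.mpr (pow_dvd_pow 2 (by omega))
  obtain ⟨h1, h2⟩ := h.dvd_of_commute_mk_one
    (Int.natCast_dvd_natCast.mp ((dvd_sub_right hx).mp (d1.trans hk)))
    (Int.natCast_dvd_natCast.mp ((dvd_sub_right hy).mp (d1.trans hl)))
    (h.step_one.2 _ hm A) (h.step_one.2 _ hm B)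
  exact ⟨(dvd_sub_left (Int.natCast_dvd_natCast.mpr h1)).mp (d2.trans hk),
    (dvd_sub_left (Int.natCast_dvd_natCast.mpr h2)).mp (d2.trans hl)⟩

/-- A power of the commutator in the third term. -/
theorem dvd_of_comm_pow_mem_three (h : EvenPair n α A B) {k : ℕ}
    (hk : gcomm A B ^ k ∈ series n A B 3) : 2 ^ n ∣ k := by
  have h1 := h.gcomm_mem_series 2 hk A
  rw [h.pair.gcomm_comm_pow_left] at h1
  have h2 := (h.dvd_of_mul_mem_two (x := 1 - α ^ k) (y := 0)
    (h.dvd_one_sub_pow (j := 0) (by simp) (by omega)) (dvd_zero _) (by simpa using h1)).1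
  exact h.dvd_of_dvd_one_sub_pow h2 (by omega)

theorem dvd_of_gcomm_pow_mem_three (h : EvenPair n α A B) {k : ℕ}
    (hm : gcomm (A ^ k) B ∈ series n A B 3) : 2 ^ n ∣ k := by
  rw [h.pair.gcomm_pow_left'] at hm
  exact h.dvd_of_comm_pow_mem_three ((Subgroup.mul_mem_cancel_right _
    (powClosure.zpow_left_mem (_root_.dvd_commExponent h.dvd_sub_one k))).mp hm)

end EvenPair


namespace EvenPair

variable {G : Type*} [Group G] {n : ℕ} {α : ℤ} {A B : G}

/-- A common exponent for the generators and their commutator. -/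
theorem exists_exponent (h : EvenPair n α A B) : ∃ N : ℕ, 0 < N ∧
    (∀ k : ℕ, (A ^ k) ^ N = 1) ∧ (∀ k : ℕ, (B ^ k) ^ N = 1) ∧
      ∀ k : ℕ, (gcomm A B ^ k) ^ N = 1 := by
  have pw : ∀ {X : G} {N : ℕ}, X ^ N = 1 → ∀ k : ℕ, (X ^ k) ^ N = 1 := by
    intro X N hX k; rw [← pow_mul, mul_comm, pow_mul, hX, one_pow]
  refine ⟨2 ^ (2 * n + 1) * 2 ^ (3 * n + 2), by positivity, pw ?_, pw ?_, pw ?_⟩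
  · rw [mul_comm, pow_mul, h.left_pow_eq_one, one_pow]
  · rw [mul_comm, pow_mul, h.swap.left_pow_eq_one, one_pow]
  · obtain ⟨k, hk⟩ := h.comm_pow_eq
    have : ((A ^ 2 ^ (2 * n + 1)) ^ k) ^ 2 ^ (3 * n + 2) =
        ((A ^ 2 ^ (3 * n + 2)) ^ 2 ^ (2 * n + 1)) ^ k := by
      rw [← zpow_natCast ((A ^ 2 ^ (2 * n + 1)) ^ k), ← zpow_mul, mul_comm k, zpow_mul,
        zpow_natCast, pow_right_comm]
    rw [pow_mul, hk, this, h.left_pow_eq_one, one_pow, one_zpow]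

theorem commute_mk_series (h : EvenPair n α A B) {j : ℕ} [(series n A B j).Normal] {x : G}
    (hx : x ∈ series n A B (j + 1)) (g : G) :
    Commute (x : G ⧸ series n A B j) (g : G ⧸ series n A B j) :=
  commute_mk_iff.mpr (h.gcomm_mem_series j hx g)

theorem commute_mk_of_mul (h : EvenPair n α A B) {j : ℕ} [(series n A B j).Normal] {y x : G}
    (hx : x ∈ series n A B (j + 1)) {z : G} (hz : gcomm (y * x) z ∈ series n A B j) :
    Commute (y : G ⧸ series n A B j) (z : G ⧸ series n A B j) := by
  rw [← commute_mk_iff, QuotientGroup.mk_mul] at hz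
  have := hz.mul_left (h.commute_mk_series hx z).inv_left
  rwa [mul_inv_cancel_right] at this

theorem mem_one (h : EvenPair n α A B) {g : G} (hg : g ∈ series n A B 2)
    (hA : gcomm g A ∈ series n A B 0) : g ∈ series n A B 1 := by
  have n0 := h.series_normal 0
  have n1 := h.series_normal 1
  obtain ⟨N, hN, -, -, hC⟩ := h.exists_exponent
  obtain ⟨i, k, x, hx, rfl⟩ := exists_pow_mul_pow_mul (N := series n A B 1)
    (x := gcomm A B ^ 2 ^ n) (y := 1) (hC _) (one_pow _) hN (Commute.one_right _) (by
      rintro s (rfl | rfl | rfl)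
      · exact Or.inr (Or.inr (powClosure.left_mem dvd_rfl))
      · exact Or.inr (Or.inr (powClosure.right_mem dvd_rfl))
      · exact Or.inl rfl) hg
  rw [one_pow, mul_one, ← pow_mul (gcomm A B)] at hA ⊢
  refine mul_mem ?_ hx
  have h1 := commute_mk_iff.mp (h.commute_mk_of_mul hx hA)
  rw [h.pair.gcomm_comm_pow_left] at h1
  refine powClosure.comm_mem (h.dvd_of_dvd_one_sub_pow (t := 3 * n + 2) ?_ (by omega))
  rw [← Int.dvd_natAbs, Int.natCast_dvd_natCast, ← h.pow_eq_one_iff, pow_natAbs_eq_one]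
  exact Subgroup.mem_bot.mp h1

theorem mem_two (h : EvenPair n α A B) {g : G} (hg : g ∈ series n A B 3)
    (hA : gcomm g A ∈ series n A B 1) (hB : gcomm g B ∈ series n A B 1) :
    g ∈ series n A B 2 := by
  have n1 := h.series_normal 1
  have n2 := h.series_normal 2
  obtain ⟨N, hN, oA, oB, -⟩ := h.exists_exponent
  obtain ⟨i, k, x, hx, rfl⟩ := exists_pow_mul_pow_mul (N := series n A B 2)
    (x := A ^ 2 ^ (n + 1)) (y := B ^ 2 ^ (n + 1)) (oA _) (oB _) hN
    (h.commute_mk_series (powClosure.left_mem dvd_rfl) _) (by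
      rintro s (rfl | rfl | rfl)
      · exact Or.inl rfl
      · exact Or.inr (Or.inl rfl)
      · exact Or.inr (Or.inr (powClosure.comm_mem dvd_rfl))) hg
  rw [← pow_mul A, ← pow_mul B] at hA hB ⊢
  obtain ⟨h1, h2⟩ := h.dvd_of_commute_mk_one (dvd_mul_right _ _) (dvd_mul_right _ _)
    (h.commute_mk_of_mul hx hA) (h.commute_mk_of_mul hx hB)
  exact mul_mem (mul_mem (powClosure.left_mem h1) (powClosure.right_mem h2)) hx

theorem mem_four (h : EvenPair n α A B) {g : G}
    (hA : gcomm g A ∈ series n A B 3) (hB : gcomm g B ∈ series n A B 3) :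
    g ∈ series n A B 4 := by
  have n3 := h.series_normal 3
  have n4 := h.series_normal 4
  obtain ⟨N, hN, oA, oB, -⟩ := h.exists_exponent
  obtain ⟨i, k, x, hx, rfl⟩ := exists_pow_mul_pow_mul (N := series n A B 4)
    (x := A) (y := B) (by simpa using oA 1) (by simpa using oB 1) hN
    (h.step_four A B) (S := {A, B}) (by
      rintro s (rfl | rfl)
      · exact Or.inl rfl
      · exact Or.inr (Or.inl rfl)) (g := g) (by rw [h.gen]; trivial)
  have h1 := h.commute_mk_of_mul hx hA
  have h2 := h.commute_mk_of_mul hx hB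
  rw [QuotientGroup.mk_mul, QuotientGroup.mk_pow, QuotientGroup.mk_pow] at h1 h2
  have h3 := commute_left_of_mul_pow h2
  have h4 := commute_right_of_mul_pow h1
  rw [← QuotientGroup.mk_pow, commute_mk_iff] at h3 h4
  rw [← series_three_swap] at h4
  exact mul_mem (mul_mem (powClosure.left_mem (h.dvd_of_gcomm_pow_mem_three h3))
    (powClosure.right_mem (h.swap.dvd_of_gcomm_pow_mem_three h4))) hx

/-- The subgroup generated by `A ^ q`, `B ^ q` and the commutator is normal. -/
theorem powClosure_normal (h : EvenPair n α A B) : (powClosure A B (2 ^ (n + 1)) 1).Normal := by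
  have := h.series_normal 3
  have : (powClosure A B (2 ^ (n + 1)) (2 ^ n)).Normal := this
  exact (h.pair.commute_mk_powClosure h.gen (a := 2 ^ (n + 1)) (c := 1) (a' := 2 ^ (n + 1))
    (c' := 2 ^ n) dvd_rfl (one_dvd _) (pow_dvd_pow 2 (by omega))
    (_root_.dvd_commExponent h.dvd_sub_one _) (h.dvd_one_sub_pow (j := 0) (by simp) (by omega))).1

/-- Decomposition of the elements of the fourth term. -/
theorem exists_eq_of_mem_four (h : EvenPair n α A B) {g : G} (hg : g ∈ series n A B 4) :
    ∃ i k l : ℕ, ∃ x ∈ series n A B 3,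
      g = A ^ (2 ^ n * i) * B ^ (2 ^ n * k) * gcomm A B ^ l * x := by
  have n3 := h.series_normal 3
  have nD := h.powClosure_normal
  obtain ⟨N, hN, oA, oB, oC⟩ := h.exists_exponent
  have hAB : Commute ((A : G) : G ⧸ powClosure A B (2 ^ (n + 1)) 1) (B : G) := by
    rw [commute_mk_iff]
    have : gcomm A B ^ 1 ∈ powClosure A B (2 ^ (n + 1)) 1 := powClosure.comm_mem dvd_rfl
    rwa [pow_one] at this
  obtain ⟨i, k, y, hy, rfl⟩ := exists_pow_mul_pow_mul (N := powClosure A B (2 ^ (n + 1)) 1)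
    (x := A ^ 2 ^ n) (y := B ^ 2 ^ n) (oA _) (oB _) hN
    (by rw [QuotientGroup.mk_pow, QuotientGroup.mk_pow]; exact hAB.pow_pow _ _) (by
      rintro s (rfl | rfl | rfl)
      · exact Or.inl rfl
      · exact Or.inr (Or.inl rfl)
      · exact Or.inr (Or.inr (powClosure.comm_mem dvd_rfl))) hg
  obtain ⟨l, -, x, hx, rfl⟩ := exists_pow_mul_pow_mul (N := series n A B 3)
    (x := gcomm A B ^ 1) (y := 1) (oC _) (one_pow _) hN (Commute.one_right _) (by
      rintro s (rfl | rfl | rfl)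
      · exact Or.inr (Or.inr (powClosure.left_mem dvd_rfl))
      · exact Or.inr (Or.inr (powClosure.right_mem dvd_rfl))
      · exact Or.inl rfl) hy
  refine ⟨i, k, l, x, hx, ?_⟩
  rw [pow_mul, pow_mul]; simp [mul_assoc]

/-- For `g = A ^ a B ^ b C ^ l` modulo the third term, the lost factor `2` lets `A ^ e(a)` and `B ^
e(b)` survive modulo the second. The commutators with `B` and `A` become `A ^ e(a) B ^ (α ^ l - 1)`
and `A ^ (1 - α ^ l) B ^ e(b)`, and `dvd_of_mul_mem_two` separates their factors. -/
theorem mem_three (h : EvenPair n α A B) {g : G} (hg : g ∈ series n A B 4)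
    (hA : gcomm g A ∈ series n A B 2) (hB : gcomm g B ∈ series n A B 2) :
    g ∈ series n A B 3 := by
  have n2 := h.series_normal 2
  obtain ⟨i, k, l, x, hx, rfl⟩ := h.exists_eq_of_mem_four hg
  have hA' := h.commute_mk_of_mul hx hA
  have hB' := h.commute_mk_of_mul hx hB
  clear hA hB hg
  set a := 2 ^ n * i
  set b := 2 ^ n * k
  have one_mk : ∀ {y : G}, y ∈ series n A B 2 → (y : G ⧸ series n A B 2) = 1 :=
    fun hy => (QuotientGroup.eq_one_iff _).mpr hy
  have hn := h.one_le
  have dE : ∀ {c : ℕ}, 2 ^ n ∣ c → ((2 ^ (n + 1) : ℕ) : ℤ) ∣ commExponent α c :=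
    fun {c} _ => _root_.dvd_commExponent h.dvd_sub_one c
  have dL : ((2 ^ (n + 1) : ℕ) : ℤ) ∣ 1 - α ^ l :=
    h.dvd_one_sub_pow (j := 0) (by simp) (by omega)
  have dL' : ((2 ^ (n + 1) : ℕ) : ℤ) ∣ α ^ l - 1 := dvd_sub_comm.mp dL
  have gA : ((gcomm (A ^ a) B : G) : G ⧸ series n A B 2) = ((A ^ commExponent α a : G) : G ⧸ _) := by
    rw [h.pair.gcomm_pow_left', QuotientGroup.mk_mul,
      one_mk (powClosure.comm_mem (dvd_mul_right _ _)), one_mul]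
  have gB : ((gcomm (B ^ b) A : G) : G ⧸ series n A B 2) = ((B ^ commExponent α b : G) : G ⧸ _) := by
    rw [h.pair.swap.gcomm_pow_left', QuotientGroup.mk_mul, ← gcomm_inv A B, inv_pow,
      one_mk (inv_mem (powClosure.comm_mem (dvd_mul_right _ _))), one_mul]
  have cen : ∀ {y y' : G}, (y : G ⧸ series n A B 2) = y' → y' ∈ series n A B 3 → ∀ z : G,
      ((z⁻¹ * y * z : G) : G ⧸ series n A B 2) = y' := by
    intro y y' hyy hy z
    rw [mul_assoc, QuotientGroup.mk_mul, QuotientGroup.mk_mul, hyy,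
      (h.commute_mk_series hy z).eq, QuotientGroup.mk_inv, inv_mul_cancel_left]
  have cA : A ^ commExponent α a ∈ series n A B 3 :=
    powClosure.zpow_left_mem (dE (dvd_mul_right _ _))
  have cB : B ^ commExponent α b ∈ series n A B 3 :=
    powClosure.zpow_right_mem (dE (dvd_mul_right _ _))
  have cB' : B ^ (α ^ l - 1) ∈ series n A B 3 := powClosure.zpow_right_mem dL'
  -- commutation with `B`
  have e1 : A ^ commExponent α a * B ^ (α ^ l - 1) ∈ series n A B 2 := by
    rw [commute_mk_iff, gcomm_mul_left, gcomm_mul_left, h.pair.gcomm_comm_pow_right,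
      gcomm_eq_one_of_commute ((Commute.refl B).pow_left b), mul_one,
      ← QuotientGroup.eq_one_iff] at hB'
    rwa [QuotientGroup.mk_mul, cen (cen gA cA (B ^ b)) cA (gcomm A B ^ l),
      cen rfl cB' (gcomm A B ^ l), ← QuotientGroup.mk_mul, QuotientGroup.eq_one_iff] at hB'
  -- commutation with `A`
  have e2 : A ^ (1 - α ^ l) * B ^ commExponent α b ∈ series n A B 2 := by
    rw [mul_assoc, commute_mk_iff, gcomm_mul_left,
      gcomm_eq_one_of_commute ((Commute.refl A).pow_left a), mul_one, inv_mul_cancel, one_mul,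
      gcomm_mul_left, h.pair.gcomm_comm_pow_left, ← QuotientGroup.eq_one_iff] at hA'
    rwa [QuotientGroup.mk_mul, cen gB cB (gcomm A B ^ l), (h.commute_mk_series cB _).eq,
      ← QuotientGroup.mk_mul, QuotientGroup.eq_one_iff] at hA'
  obtain ⟨h1, h2⟩ := h.dvd_of_mul_mem_two (dE (dvd_mul_right _ _)) dL' e1
  obtain ⟨h3, h4⟩ := h.dvd_of_mul_mem_two dL (dE (dvd_mul_right _ _)) e2
  have ha : 2 ^ (n + 1) ∣ a := h.dvd_of_dvd_commExponent
    ((dvd_pow_self 2 (by omega)).trans (dvd_mul_right _ _))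
    (by rwa [show n + 1 + n = 2 * n + 1 by ring])
  have hb : 2 ^ (n + 1) ∣ b := h.dvd_of_dvd_commExponent
    ((dvd_pow_self 2 (by omega)).trans (dvd_mul_right _ _))
    (by rwa [show n + 1 + n = 2 * n + 1 by ring])
  have hl : 2 ^ n ∣ l := h.dvd_of_dvd_one_sub_pow h3 (by omega)
  exact mul_mem (mul_mem (mul_mem (powClosure.left_mem ha) (powClosure.right_mem hb))
    (powClosure.comm_mem hl)) hx

end EvenPair


/-! ### The lower central series for `p = 2` -/

/-- If an odd multiple of `2 ^ M` is the exponent of an element of `H`, then so is `2 ^ M`. -/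
theorem pow_two_pow_mem {G : Type*} [Group G] {K M : ℕ} {A : G} (hA : A ^ 2 ^ K = 1)
    {H : Subgroup G} {z : ℤ} (hz : A ^ z ∈ H) (hM : ¬ ((2 ^ (M + 1) : ℕ) : ℤ) ∣ z) :
    A ^ 2 ^ M ∈ H := by
  have h2 : A ^ z.natAbs ∈ H := by
    rcases Int.natAbs_eq z with hz' | hz'
    · rw [← zpow_natCast, ← hz']; exact hz
    · rw [hz', zpow_neg, inv_mem_iff, zpow_natCast] at hz; exact hz
  have := pow_mem_of_not_dvd Nat.prime_two hA h2 (M := M + 1) (by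
    rwa [← Int.natCast_dvd])
  simpa using this

namespace EvenPair

variable {G : Type*} [Group G] {n : ℕ} {α : ℤ} {A B : G}

theorem upperCentralSeries_eq (h : EvenPair n α A B) (j : ℕ) :
    Subgroup.upperCentralSeries G j = series n A B j := by
  refine _root_.upperCentralSeries_eq (c := 5) (A := A) (B := B) rfl ?_ series_mono
    (fun j _ hx g => h.gcomm_mem_series j hx g) ?_ j
  · intro j hj
    obtain ⟨k, rfl⟩ : ∃ k, j = k + 5 := ⟨j - 5, by omega⟩
    rfl
  · intro j hj g hg hA hB
    match j with
    | 0 => exact h.mem_one hg hA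
    | 1 => exact h.mem_two hg hA hB
    | 2 => exact h.mem_three hg hA hB
    | 3 => exact h.mem_four hA hB
    | j + 4 => omega

theorem hasNilpotencyClass (h : EvenPair n α A B) : HasNilpotencyClass G 5 := by
  apply hasNilpotencyClass_of_upperCentralSeries
  · rw [h.upperCentralSeries_eq]; rfl
  · rw [h.upperCentralSeries_eq]
    intro htop
    have hA : A ∈ series n A B 4 := by rw [htop]; trivial
    have h1 := h.gcomm_mem_series 3 hA B
    have h2 := h.dvd_of_gcomm_pow_mem_three (k := 1) (by rwa [pow_one])
    have := Nat.one_lt_pow (by have := h.one_le; omega) one_lt_two (n := n)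
    rw [Nat.dvd_one] at h2
    omega

/-- The third term (from the bottom) of the lower central series. -/
def lowerThree (n : ℕ) (A B : G) : Subgroup G :=
  Subgroup.closure {A ^ 2 ^ (2 * (n + 1)), gcomm A (B ^ 2 ^ (n + 1))}

/-- The terms of the lower central series. -/
def lowerSeries (n : ℕ) (A B : G) : ℕ → Subgroup G
  | 0 => ⊤
  | 1 => powClosure A B (2 ^ (n + 1)) 1
  | 2 => powClosure A B (2 ^ (n + 1)) (2 ^ (n + 1))
  | 3 => lowerThree n A B
  | 4 => Subgroup.closure {A ^ 2 ^ (2 * (n + 1))}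
  | _ => ⊥

theorem dvd_commExponent_base (h : EvenPair n α A B) :
    ((2 ^ (2 * n + 1) : ℕ) : ℤ) ∣ commExponent α (2 ^ (n + 1)) :=
  h.dvd_commExponent dvd_rfl (by omega)

theorem zpow_mul_zpow (h : EvenPair n α A B) {z : ℤ} (hz : ((2 ^ (2 * n + 1) : ℕ) : ℤ) ∣ z) :
    A ^ z * B ^ z = 1 := by
  obtain ⟨k, rfl⟩ := hz
  rw [zpow_mul, zpow_mul, zpow_natCast, zpow_natCast, h.right_pow_eq dvd_rfl, inv_zpow,
    mul_inv_cancel]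

theorem gcomm_pow_right_eq (h : EvenPair n α A B) : gcomm A (B ^ 2 ^ (n + 1)) =
    A ^ commExponent α (2 ^ (n + 1)) * gcomm A B ^ 2 ^ (n + 1) := by
  have h1 := h.pair.swap.gcomm_pow_left' (2 ^ (n + 1))
  rw [← gcomm_inv A B, inv_pow] at h1
  rw [← gcomm_inv (B ^ 2 ^ (n + 1)) A, h1, mul_inv_rev, inv_inv]
  congr 1
  exact (eq_inv_of_mul_eq_one_left (h.zpow_mul_zpow h.dvd_commExponent_base)).symm

/-- Both are `C ^ 2 ^ (n + 1)` times the same power of `A`, since that power is central and inverse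
to the corresponding power of `B`. The symmetry allows arguments for `A` to be reused for `B`. -/
theorem gcomm_left_pow_eq (h : EvenPair n α A B) :
    gcomm (A ^ 2 ^ (n + 1)) B = gcomm A (B ^ 2 ^ (n + 1)) := by
  rw [h.gcomm_pow_right_eq, h.pair.gcomm_pow_left']
  exact Subgroup.mem_center_iff.mp (h.zpow_mem_center h.dvd_commExponent_base) _

theorem gcomm_gcomm_left (h : EvenPair n α A B) :
    gcomm (gcomm A (B ^ 2 ^ (n + 1))) A = A ^ (1 - α ^ 2 ^ (n + 1)) := by
  have hc := Subgroup.mem_center_iff.mp (h.zpow_mem_center h.dvd_commExponent_base)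
  rw [h.gcomm_pow_right_eq, gcomm_mul_left, gcomm_eq_one_of_commute (hc A).symm, mul_one,
    inv_mul_cancel, one_mul, h.pair.gcomm_comm_pow_left]

theorem four_le_center (h : EvenPair n α A B) : lowerSeries n A B 4 ≤ Subgroup.center G := by
  rw [lowerSeries, Subgroup.closure_le, Set.singleton_subset_iff]
  have := h.zpow_mem_center (z := (2 ^ (2 * (n + 1)) : ℕ))
    (Int.natCast_dvd_natCast.mpr (pow_dvd_pow 2 (by omega)))
  rwa [zpow_natCast] at this

theorem four_normal (h : EvenPair n α A B) : (lowerSeries n A B 4).Normal :=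
  ⟨fun x hx g => by
    rw [Subgroup.mem_center_iff.mp (h.four_le_center hx) g, mul_inv_cancel_right]; exact hx⟩

theorem lower_step_three (h : EvenPair n α A B) [(lowerSeries n A B 4).Normal] :
    (lowerSeries n A B 3).Normal ∧ ∀ x ∈ lowerSeries n A B 3, ∀ g : G,
      Commute (x : G ⧸ lowerSeries n A B 4) (g : G ⧸ lowerSeries n A B 4) := by
  have mem4 : ∀ {z : ℤ}, ((2 ^ (2 * (n + 1)) : ℕ) : ℤ) ∣ z → A ^ z ∈ lowerSeries n A B 4 := by
    rintro z ⟨k, rfl⟩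
    rw [zpow_mul, zpow_natCast]
    exact zpow_mem (Subgroup.subset_closure (Set.mem_singleton _)) k
  have d1 : ((2 ^ (2 * (n + 1)) : ℕ) : ℤ) ∣ 1 - α ^ 2 ^ (n + 1) :=
    h.dvd_one_sub_pow dvd_rfl (by omega)
  refine closure_normal_of_commute_mk h.gen ?_ ?_
  · rw [lowerSeries, Subgroup.closure_le, Set.singleton_subset_iff]
    exact Subgroup.subset_closure (by simp)
  · rintro s (rfl | rfl)
    · have hc := Subgroup.mem_center_iff.mp
        (h.four_le_center (Subgroup.subset_closure (Set.mem_singleton _)))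
      constructor
      · exact congrArg (QuotientGroup.mk (s := lowerSeries n A B 4)) (hc A).symm
      · exact congrArg (QuotientGroup.mk (s := lowerSeries n A B 4)) (hc B).symm
    · constructor
      · rw [commute_mk_iff, h.gcomm_gcomm_left]
        exact mem4 d1
      · rw [← h.gcomm_left_pow_eq, ← gcomm_inv B, QuotientGroup.mk_inv, Commute.inv_left_iff,
          commute_mk_iff, h.swap.gcomm_gcomm_left]
        have hd : ((2 ^ (2 * n + 1) : ℕ) : ℤ) ∣ 1 - α ^ 2 ^ (n + 1) :=
          h.dvd_one_sub_pow dvd_rfl (by omega)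
        rw [← inv_eq_of_mul_eq_one_right (h.zpow_mul_zpow hd)]
        exact inv_mem (mem4 d1)

/-- `C ^ 2 ^ (n + 1)` is `[A, B ^ 2 ^ (n + 1)]` times a central power of `A`, so it is central
modulo the next term without having to lie in it. -/
theorem lower_step_two (h : EvenPair n α A B) [(lowerSeries n A B 3).Normal] :
    (lowerSeries n A B 2).Normal ∧ ∀ x ∈ lowerSeries n A B 2, ∀ g : G,
      Commute (x : G ⧸ lowerSeries n A B 3) (g : G ⧸ lowerSeries n A B 3) := by
  have d0 : ((2 ^ (n + 1) : ℕ) : ℤ) ∣ commExponent α (2 ^ (n + 1)) :=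
    _root_.dvd_commExponent h.dvd_sub_one _
  have hw : gcomm A (B ^ 2 ^ (n + 1)) ∈ lowerSeries n A B 3 :=
    Subgroup.subset_closure (by simp)
  refine closure_normal_of_commute_mk h.gen ?_ ?_
  · change Subgroup.closure _ ≤ powClosure A B (2 ^ (n + 1)) (2 ^ (n + 1))
    rw [Subgroup.closure_le]
    rintro s (rfl | rfl)
    · exact powClosure.left_mem (pow_dvd_pow 2 (by omega))
    · rw [h.gcomm_pow_right_eq]
      exact mul_mem (powClosure.zpow_left_mem d0) (powClosure.comm_mem dvd_rfl)
  · rintro s (rfl | rfl | rfl)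
    · refine ⟨?_, ?_⟩
      · rw [QuotientGroup.mk_pow]; exact (Commute.refl _).pow_left _
      · rw [commute_mk_iff, h.gcomm_left_pow_eq]; exact hw
    · refine ⟨?_, ?_⟩
      · rw [commute_mk_iff, ← gcomm_inv A]; exact inv_mem hw
      · rw [QuotientGroup.mk_pow]; exact (Commute.refl _).pow_left _
    · have hcen : ∀ g : G, Commute
          ((gcomm A B ^ 2 ^ (n + 1) : G) : G ⧸ lowerSeries n A B 3) (g : G ⧸ lowerSeries n A B 3) := by
        intro g
        have e : gcomm A B ^ 2 ^ (n + 1) = (A ^ commExponent α (2 ^ (n + 1)))⁻¹ *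
            gcomm A (B ^ 2 ^ (n + 1)) := by
          rw [h.gcomm_pow_right_eq, inv_mul_cancel_left]
        rw [e, QuotientGroup.mk_mul, (QuotientGroup.eq_one_iff _).mpr hw, mul_one]
        have hc := Subgroup.mem_center_iff.mp
          (inv_mem (h.zpow_mem_center h.dvd_commExponent_base)) g
        exact congrArg (QuotientGroup.mk (s := lowerSeries n A B 3)) hc.symm
      exact ⟨hcen A, hcen B⟩

theorem lower_step_one (h : EvenPair n α A B) [(lowerSeries n A B 2).Normal] :
    (lowerSeries n A B 1).Normal ∧ ∀ x ∈ lowerSeries n A B 1, ∀ g : G,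
      Commute (x : G ⧸ lowerSeries n A B 2) (g : G ⧸ lowerSeries n A B 2) := by
  have : (powClosure A B (2 ^ (n + 1)) (2 ^ (n + 1))).Normal := ‹_›
  exact h.pair.commute_mk_powClosure h.gen dvd_rfl (one_dvd _) dvd_rfl
    (_root_.dvd_commExponent h.dvd_sub_one _) (h.dvd_one_sub_pow (j := 0) (by simp) (by omega))

theorem lower_step_zero (h : EvenPair n α A B) [(lowerSeries n A B 1).Normal] (x g : G) :
    Commute (x : G ⧸ lowerSeries n A B 1) (g : G ⧸ lowerSeries n A B 1) := by
  have : (powClosure A B (2 ^ (n + 1)) 1).Normal := ‹_›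
  exact (h.pair.commute_mk_powClosure h.gen (a := 1) (c := 1) (a' := 2 ^ (n + 1)) (c' := 1)
    (one_dvd _) dvd_rfl dvd_rfl
    (_root_.dvd_commExponent h.dvd_sub_one _)
    (h.dvd_one_sub_pow (j := 0) (by simp) (by omega))).2 x (by rw [h.powClosure_one_one]; trivial) g

theorem gcomm_mem_lowerSeries (h : EvenPair n α A B) (j : ℕ) {x : G}
    (hx : x ∈ lowerSeries n A B j) (g : G) : gcomm x g ∈ lowerSeries n A B (j + 1) := by
  have n4 := h.four_normal
  have n3 := h.lower_step_three.1
  have n2 := h.lower_step_two.1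
  have n1 := h.lower_step_one.1
  match j with
  | 0 => exact commute_mk_iff.mp (h.lower_step_zero x g)
  | 1 => exact commute_mk_iff.mp (h.lower_step_one.2 x hx g)
  | 2 => exact commute_mk_iff.mp (h.lower_step_two.2 x hx g)
  | 3 => exact commute_mk_iff.mp (h.lower_step_three.2 x hx g)
  | 4 =>
    rw [gcomm_eq_one_of_commute (Subgroup.mem_center_iff.mp (h.four_le_center hx) g).symm]
    exact one_mem _
  | j + 5 =>
    rw [Subgroup.mem_bot.mp hx, gcomm_eq_one_of_commute (Commute.one_left g)]
    exact one_mem _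

theorem left_pow_mem_of_comm_pow_mem (h : EvenPair n α A B) {j k : ℕ}
    (hC : gcomm A B ^ 2 ^ j ∈ (⊤ : Subgroup G).lowerCentralSeries k) :
    A ^ 2 ^ (j + (n + 1)) ∈ (⊤ : Subgroup G).lowerCentralSeries (k + 1) := by
  have h1 := gcomm_mem_lowerCentralSeries hC A
  rw [h.pair.gcomm_comm_pow_left] at h1
  refine pow_two_pow_mem h.left_pow_eq_one h1 (fun hd => ?_)
  have := h.dvd_of_dvd_one_sub_pow (j := j + 1) hd (by omega)
  exact absurd (Nat.le_of_dvd (by positivity) this)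
        (not_le.mpr (Nat.pow_lt_pow_right one_lt_two (Nat.lt_succ_self _)))

/-- For the lower bound, commutators starting from `C` produce `A ^ 2 ^ (n + 1)`, then `C ^ 2 ^ (n +
1)`. The commutator of `[A, B ^ 2 ^ (n + 1)]` with `A` is `A ^ (1 - α ^ 2 ^ (n + 1))`, of valuation
exactly `2 (n + 1)`, which gives the last nontrivial term. -/
theorem lowerCentralSeries_eq (h : EvenPair n α A B) (j : ℕ) :
    (⊤ : Subgroup G).lowerCentralSeries j = lowerSeries n A B j := by
  apply le_antisymm
  · exact lowerCentralSeries_le rfl (fun j _ hx g => h.gcomm_mem_lowerSeries j hx g) j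
  have c1 : gcomm A B ^ 2 ^ 0 ∈ (⊤ : Subgroup G).lowerCentralSeries 1 := by
    rw [pow_zero, pow_one]
    exact gcomm_mem_lowerCentralSeries (Subgroup.mem_top A) B
  have hA2 := h.left_pow_mem_of_comm_pow_mem c1
  have hB2 := h.swap.left_pow_mem_of_comm_pow_mem (j := 0) (k := 1) (by
    rw [← gcomm_inv A B, inv_pow]; exact inv_mem c1)
  rw [zero_add] at hA2 hB2
  have anti := Subgroup.lowerCentralSeries_antitone (S := (⊤ : Subgroup G)) (Nat.le_succ 1)
  have c2 : gcomm A B ^ 2 ^ (n + 1) ∈ (⊤ : Subgroup G).lowerCentralSeries 2 := by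
    have h4 := gcomm_mem_lowerCentralSeries (anti hA2) B
    rw [h.pair.gcomm_pow_left'] at h4
    refine (Subgroup.mul_mem_cancel_right _ ?_).mp h4
    obtain ⟨k, hk⟩ := _root_.dvd_commExponent h.dvd_sub_one (2 ^ (n + 1))
    rw [hk, zpow_mul, zpow_natCast]
    exact zpow_mem hA2 k
  have hA3 := h.left_pow_mem_of_comm_pow_mem c2
  rw [← two_mul] at hA3
  have w3 : gcomm A (B ^ 2 ^ (n + 1)) ∈ (⊤ : Subgroup G).lowerCentralSeries 3 := by
    rw [← h.gcomm_left_pow_eq]; exact gcomm_mem_lowerCentralSeries hA2 B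
  have hA4 : A ^ 2 ^ (2 * (n + 1)) ∈ (⊤ : Subgroup G).lowerCentralSeries 4 := by
    have h1 := gcomm_mem_lowerCentralSeries w3 A
    rw [h.gcomm_gcomm_left] at h1
    refine pow_two_pow_mem h.left_pow_eq_one h1 (fun hd => ?_)
    have := h.dvd_of_dvd_one_sub_pow (j := n + 2) hd (by omega)
    exact absurd (Nat.le_of_dvd (by positivity) this)
        (not_le.mpr (Nat.pow_lt_pow_right one_lt_two (Nat.lt_succ_self _)))
  match j with
  | 0 => exact le_rfl
  | 1 => exact powClosure.le_iff.mpr ⟨anti hA2, anti hB2, by simpa using c1⟩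
  | 2 => exact powClosure.le_iff.mpr ⟨hA2, hB2, c2⟩
  | 3 =>
    change Subgroup.closure _ ≤ _
    rw [Subgroup.closure_le]
    rintro s (rfl | rfl)
    · exact hA3
    · exact w3
  | 4 =>
    change Subgroup.closure _ ≤ _
    rw [Subgroup.closure_le, Set.singleton_subset_iff]
    exact hA4
  | j + 5 => exact bot_le

end EvenPair


/-! ### Transfer to the Sylow subgroup and the three cases -/

namespace powClosure

variable {G : Type*} [Group G] {A B : G} {a c : ℕ}

theorem eq_closure_pair (hB : B ^ a = (A ^ a)⁻¹) :
    powClosure A B a c = Subgroup.closure {A ^ a, gcomm A B ^ c} := by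
  apply le_antisymm
  · refine le_iff.mpr ⟨Subgroup.subset_closure (by simp), ?_, Subgroup.subset_closure (by simp)⟩
    rw [hB]; exact inv_mem (Subgroup.subset_closure (by simp))
  · rw [Subgroup.closure_le]
    rintro x (rfl | rfl)
    · exact left_mem dvd_rfl
    · exact comm_mem dvd_rfl

theorem eq_closure_singleton (hB : B ^ a = (A ^ a)⁻¹) (hC : gcomm A B ^ c = 1) :
    powClosure A B a c = Subgroup.closure {A ^ a} := by
  rw [eq_closure_pair hB, hC, Set.pair_comm]
  exact Subgroup.closure_insert_one _

end powClosure

/-- The order of the image of the first generator in a Sylow subgroup is bounded below by its order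
in any model. -/
theorem IsSylowProjection.pow_dvd_of_pow_eq_one {α : ℤ} [Finite (MacdonaldGroup α)] {p s : ℕ}
    {J : Sylow p (MacdonaldGroup α)} {π : MacdonaldGroup α →* J} (h : IsSylowProjection J π)
    {X : Type*} [Group X] {A B : X} (hAB : MacdonaldPair α A B)
    (hord : ∀ k : ℕ, A ^ k = 1 → p ^ s ∣ k) {k : ℕ} (hk : π (macdonaldX α) ^ k = 1) :
    p ^ s ∣ k := by
  have hrel : ∀ r ∈ macdonaldRels α, FreeGroup.lift ![A, B] r = 1 := by
    rintro r (rfl | rfl)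
    · have := hAB.left
      simp only [map_mul, map_inv, map_zpow, conjBy, gcomm, FreeGroup.lift_apply_of,
        Matrix.cons_val_zero, Matrix.cons_val_one] at this ⊢
      rw [this, mul_inv_cancel]
    · have := hAB.swap.left
      simp only [map_mul, map_inv, map_zpow, conjBy, gcomm, FreeGroup.lift_apply_of,
        Matrix.cons_val_zero, Matrix.cons_val_one] at this ⊢
      rw [this, mul_inv_cancel]
  -- Killing `x ^ k` in `J` kills `x ^ (k t)` in the model for some `t` prime to `p`, and such a `t`
  -- does not affect divisibility by `p ^ s`.
  obtain ⟨t, ht, hft⟩ := h.exists_coprime_pow_eq_one hk (PresentedGroup.toGroup hrel)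
  have hX : PresentedGroup.toGroup hrel (macdonaldX α) = A := by
    simp [macdonaldX]
  rw [hX] at hft
  exact (Nat.Coprime.pow_left s ht.symm).dvd_of_dvd_mul_right (hord _ hft)

theorem exists_sub_one_eq_pow_padicValInt_mul {p : ℕ} [Fact p.Prime] {a : ℤ} (ha : a ≠ 0) :
    ∃ v : ℤ, a = p ^ padicValInt p a * v ∧ IsCoprime v p := by
  obtain ⟨v, hv⟩ := padicValInt_dvd (p := p) a
  refine ⟨v, hv, ?_⟩
  have hp : Prime (p : ℤ) := Nat.prime_iff_prime_int.mp Fact.out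
  refine ((hp.coprime_iff_not_dvd).mpr fun hd => ?_).symm
  have h1 : (p : ℤ) ^ (padicValInt p a + 1) ∣ a := by
    conv_rhs => rw [hv]
    rw [pow_succ]; exact mul_dvd_mul_left _ hd
  rw [padicValInt_dvd_iff] at h1
  rcases h1 with h1 | h1
  · exact ha h1
  · omega

namespace RegularPair

variable {G : Type*} [Group G] {p m T : ℕ} {α : ℤ} {A B : G}

theorem series_one_eq (h : RegularPair p m T α A B) :
    series p m T A B 1 = Subgroup.closure {A ^ (p ^ m) ^ T} :=
  powClosure.eq_closure_singleton (h.right_pow_eq dvd_rfl) h.comm_pow_eq_one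

theorem series_two_eq (h : RegularPair p m (T + 1) α A B) :
    series p m (T + 1) A B 2 =
      Subgroup.closure {A ^ (p ^ m) ^ (T + 1), gcomm A B ^ (p ^ m) ^ T} :=
  powClosure.eq_closure_pair (h.right_pow_eq dvd_rfl)

end RegularPair

theorem theorem8p1 (α : ℤ) (hα : α ≠ 0 ∧ α ≠ 1 ∧ α ≠ 2) (p : ℕ) [Fact p.Prime]
    (hp : (p : ℤ) ∣ α - 1) (m : ℕ) (hm : m = padicValInt p (α - 1))
    (J : Sylow p (MacdonaldGroup α)) :
    ∃ π : MacdonaldGroup α →* J, IsSylowProjection J π ∧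
      ∀ A B C : J, A = π (macdonaldX α) → B = π (macdonaldY α) → C = gcomm A B →
      (IsCase1 α p →
        HasNilpotencyClass J 5 ∧
        upperZ J 1 = Subgroup.closure {A ^ p ^ (2 * m)} ∧
        upperZ J 2 = Subgroup.closure {A ^ p ^ (2 * m), C ^ p ^ m} ∧
        upperZ J 3 = Subgroup.closure {A ^ p ^ m, B ^ p ^ m, C ^ p ^ m} ∧
        upperZ J 4 = Subgroup.closure {A ^ p ^ m, B ^ p ^ m, C} ∧
        ∀ i ∈ Finset.Icc 1 6, lowerGamma J i = upperZ J (6 - i)) ∧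
      (IsCase2 p → 1 < m →
        HasNilpotencyClass J 5 ∧
        upperZ J 1 = Subgroup.closure {A ^ 2 ^ (2 * m - 1)} ∧
        upperZ J 2 = Subgroup.closure {A ^ 2 ^ (2 * m - 1), C ^ 2 ^ (m - 1)} ∧
        upperZ J 3 = Subgroup.closure {A ^ 2 ^ m, B ^ 2 ^ m, C ^ 2 ^ (m - 1)} ∧
        upperZ J 4 = Subgroup.closure {A ^ 2 ^ (m - 1), B ^ 2 ^ (m - 1), C} ∧
        lowerGamma J 2 = Subgroup.closure {A ^ 2 ^ m, B ^ 2 ^ m, C} ∧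
        lowerGamma J 3 = Subgroup.closure {A ^ 2 ^ m, B ^ 2 ^ m, C ^ 2 ^ m} ∧
        lowerGamma J 4 = Subgroup.closure {A ^ 2 ^ (2 * m), gcomm A (B ^ 2 ^ m)} ∧
        lowerGamma J 5 = Subgroup.closure {A ^ 2 ^ (2 * m)}) ∧
      (IsCase3 α p →
        HasNilpotencyClass J 7 ∧
        upperZ J 1 = Subgroup.closure {A ^ 27} ∧
        upperZ J 2 = Subgroup.closure {A ^ 27, C ^ 9} ∧
        upperZ J 3 = Subgroup.closure {A ^ 9, B ^ 9, C ^ 9} ∧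
        upperZ J 4 = Subgroup.closure {A ^ 9, B ^ 9, C ^ 3} ∧
        upperZ J 5 = Subgroup.closure {A ^ 3, B ^ 3, C ^ 3} ∧
        upperZ J 6 = Subgroup.closure {A ^ 3, B ^ 3, C} ∧
        ∀ i ∈ Finset.Icc 1 8, lowerGamma J i = upperZ J (8 - i)) := by
  obtain ⟨h0, h1, -⟩ := hα
  obtain ⟨hnil, hfin⟩ := macdonaldGroup_isNilpotent_and_finite h0 h1
  obtain ⟨π, hπ⟩ := exists_isSylowProjection hnil J
  refine ⟨π, hπ, ?_⟩
  rintro A B C hA hB rfl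
  have hpp : p.Prime := Fact.out
  have pair : MacdonaldPair α A B := by
    rw [hA, hB]; exact (macdonaldPair_macdonaldGroup α).map π
  have gen : Subgroup.closure {A, B} = ⊤ := by
    rw [hA, hB]; exact closure_map_eq_top (closure_macdonald α) hπ.surjective
  obtain ⟨v, hv, hvp⟩ := exists_sub_one_eq_pow_padicValInt_mul (p := p) (sub_ne_zero.mpr h1)
  have hm1 : 1 ≤ m := by
    have h2 : (p : ℤ) ^ 1 ∣ α - 1 := by rwa [pow_one]
    rw [padicValInt_dvd_iff] at h2
    rw [hm]; exact h2.resolve_left (sub_ne_zero.mpr h1)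
  rw [← hm] at hv
  obtain ⟨K, hAK, hBK⟩ : ∃ K, A ^ p ^ K = 1 ∧ B ^ p ^ K = 1 := by
    obtain ⟨k, hk⟩ := J.isPGroup' A
    obtain ⟨l, hl⟩ := J.isPGroup' B
    exact ⟨k + l, by rw [pow_add, pow_mul, hk, one_pow],
      by rw [pow_add, mul_comm, pow_mul, hl, one_pow]⟩
  have lower : ∀ {s : ℕ}, (∃ (X : Type) (_ : Group X) (A B : X), MacdonaldPair α A B ∧
      ∀ k : ℕ, A ^ k = 1 → p ^ s ∣ k) → ∀ k : ℕ, A ^ k = 1 → p ^ s ∣ k := by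
    rintro s ⟨X, _, A', B', hAB', hord⟩ k hk
    rw [hA] at hk
    exact hπ.pow_dvd_of_pow_eq_one hAB' hord hk
  have order : ∀ {s : ℕ}, A ^ p ^ s = 1 → (∃ (X : Type) (_ : Group X) (A B : X),
      MacdonaldPair α A B ∧ ∀ k : ℕ, A ^ k = 1 → p ^ s ∣ k) → ∀ k : ℕ, A ^ k = 1 ↔ p ^ s ∣ k := by
    intro s hs hX k
    refine ⟨lower hX k, ?_⟩
    rintro ⟨l, rfl⟩
    rw [pow_mul, hs, one_pow]
  refine ⟨fun hc => ?_, fun hc hm2 => ?_, fun hc => ?_⟩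
  · have hp2 : p ≠ 2 := by rcases hc with h | ⟨h, -⟩ <;> omega
    obtain ⟨c1, c2, c3⟩ : Commute B (A ^ p ^ (2 * m)) ∧ A ^ p ^ (2 * m) * B ^ p ^ (2 * m) = 1 ∧
        A ^ p ^ (2 * m + m) = 1 := by
      rcases hc with h | ⟨rfl, h⟩
      · exact pair.central_of_gt_three hpp h hAK hBK hv hm1 hvp
      · refine pair.central_of_eq_three hAK hBK (by exact_mod_cast hv) hm1
          (by exact_mod_cast hvp) ?_
        rw [← hm] at h
        rcases Nat.lt_or_ge 1 m with hm2 | hm2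
        · exact Or.inl hm2
        · right
          obtain rfl : m = 1 := by omega
          have h3 := h.resolve_left (lt_irrefl _)
          push_cast at hv
          have h4 := h3.dvd
          omega
    -- `T = 2`: the central power is `A ^ q ^ 2`, the order is `q ^ 3`, and the class is `2 * 2 + 1
    -- = 5`.
    have reg : RegularPair p m 2 α A B :=
      { pair := pair
        prime := hpp
        ne_two := hp2
        one_le := hm1
        exists_sub_one := ⟨v, hv, hvp⟩
        gen := gen
        comm := by rw [← pow_mul, mul_comm m]; exact c1
        mul_eq := by rw [← pow_mul, mul_comm m]; exact c2
        pow_eq_one_iff := by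
          rw [← pow_mul, show m * (2 + 1) = 2 * m + m by ring]
          refine order c3 ?_
          obtain ⟨X, i, A', B', h, h'⟩ := exists_macdonaldPair_pow_dvd (e := 0) hpp hm1
            zero_le_one (fun h => absurd h hp2) ⟨v, hv⟩
          refine ⟨X, i, A', B', h, fun k hk => ?_⟩
          have := h' k hk
          rw [show 3 * m - 0 = 2 * m + m by omega] at this
          exact_mod_cast this }
    have e2 : (p ^ m) ^ 2 = p ^ (2 * m) := by rw [← pow_mul, mul_comm m]
    refine ⟨reg.hasNilpotencyClass, ?_, ?_, ?_, ?_, ?_⟩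
    · refine (reg.upperCentralSeries_eq _).trans ?_
      rw [reg.series_one_eq, e2]
    · refine (reg.upperCentralSeries_eq _).trans ?_
      rw [reg.series_two_eq, e2, pow_one]
    · refine (reg.upperCentralSeries_eq _).trans ?_
      simp [RegularPair.series, RegularPair.term, powClosure]
    · refine (reg.upperCentralSeries_eq _).trans ?_
      simp [RegularPair.series, RegularPair.term, powClosure]
    · intro i hi
      rw [Finset.mem_Icc] at hi
      rw [lowerGamma, reg.lowerCentralSeries_eq (by omega), upperZ]
      congr 1; omega
  · obtain rfl : p = 2 := hc
    -- With `n = m - 1` the exponents `2m - 1` and `3m - 1` become `2n + 1` and `3n + 2`.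
    obtain ⟨n, rfl⟩ : ∃ n, m = n + 1 := ⟨m - 1, by omega⟩
    push_cast at hv hvp
    obtain ⟨c1, c2, c3⟩ := pair.central_of_eq_two hAK hBK hv (by omega) hvp
    have ev : EvenPair n α A B :=
      { pair := pair
        one_le := by omega
        exists_sub_one := ⟨v, hv, by
          rw [← Int.not_even_iff_odd]
          exact fun he => Int.prime_two.coprime_iff_not_dvd.mp hvp.symm (even_iff_two_dvd.mp he)⟩
        gen := gen
        comm := c1
        mul_eq := c2
        pow_eq_one_iff := by
          rw [show 2 * (n + 1) - 1 + (n + 1) = 3 * n + 2 by omega] at c3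
          refine order c3 ?_
          obtain ⟨X, i, A', B', h, h'⟩ := exists_macdonaldPair_pow_dvd (p := 2) (e := 1) hpp hm1
            le_rfl (fun _ => ⟨rfl, by omega⟩) (α := α) ⟨v, by push_cast; exact hv⟩
          refine ⟨X, i, A', B', h, fun k hk => ?_⟩
          have := h' k hk
          rw [show 3 * (n + 1) - 1 = 3 * n + 2 by omega] at this
          exact_mod_cast this }
    have e1 : 2 * (n + 1) - 1 = 2 * n + 1 := by omega
    refine ⟨ev.hasNilpotencyClass, ?_, ?_, ?_, ?_, ?_, ?_, ?_, ?_⟩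
    · refine (ev.upperCentralSeries_eq _).trans ?_
      rw [ev.series_one_eq, e1]
    · refine (ev.upperCentralSeries_eq _).trans ?_
      rw [e1]
      exact powClosure.eq_closure_pair (ev.right_pow_eq dvd_rfl)
    · refine (ev.upperCentralSeries_eq _).trans ?_
      rfl
    · refine (ev.upperCentralSeries_eq _).trans ?_
      simp [EvenPair.series, powClosure]
    · rw [lowerGamma, ev.lowerCentralSeries_eq]
      simp [EvenPair.lowerSeries, powClosure]
    · rw [lowerGamma, ev.lowerCentralSeries_eq]; rfl
    · rw [lowerGamma, ev.lowerCentralSeries_eq]; rfl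
    · rw [lowerGamma, ev.lowerCentralSeries_eq]; rfl
  · obtain ⟨rfl, hc1, hc2⟩ := hc
    obtain rfl : m = 1 := hm.trans hc1
    have hα9 : α % 9 = 7 := by
      have := hc2.dvd
      push_cast at hp
      omega
    obtain ⟨c1, c2, c3⟩ := pair.central_of_exceptional hAK hBK hα9
    -- `T = 3` with `q = 3`: the central power is `A ^ 27`, the order is `81`, and the class is `2 *
    -- 3 + 1 = 7`.
    have reg : RegularPair 3 1 3 α A B :=
      { pair := pair
        prime := hpp
        ne_two := by norm_num
        one_le := le_rfl
        exists_sub_one := ⟨v, hv, hvp⟩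
        gen := gen
        comm := c1
        mul_eq := c2
        pow_eq_one_iff := order (s := 4) c3 (exists_macdonaldPair_dvd_81 hα9) }
    refine ⟨reg.hasNilpotencyClass, ?_, ?_, ?_, ?_, ?_, ?_, ?_⟩
    · refine (reg.upperCentralSeries_eq _).trans ?_
      rw [reg.series_one_eq]; norm_num
    · refine (reg.upperCentralSeries_eq _).trans ?_
      rw [reg.series_two_eq]; norm_num
    · refine (reg.upperCentralSeries_eq _).trans ?_
      simp [RegularPair.series, RegularPair.term, powClosure]
    · refine (reg.upperCentralSeries_eq _).trans ?_
      simp [RegularPair.series, RegularPair.term, powClosure]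
    · refine (reg.upperCentralSeries_eq _).trans ?_
      simp [RegularPair.series, RegularPair.term, powClosure]
    · refine (reg.upperCentralSeries_eq _).trans ?_
      simp [RegularPair.series, RegularPair.term, powClosure]
    · intro i hi
      rw [Finset.mem_Icc] at hi
      rw [lowerGamma, reg.lowerCentralSeries_eq (by omega), upperZ]
      congr 1; omega
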